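/- Let $T>0$, let $U\subset\mathbb R^d$ and $S\subset\mathbb R^m$ be open, and let $(\mathbb T_n)_{n}$ be a fixed refining sequence of partitions of $[0,T]$: finite sets $\mathbb T_1\subset\mathbb T_2\subset\cdots\subset[0,T]$ containing $0$ and $T$, with mesh tending to $0$. For $s\in\mathbb T_n$ let $s'$ be the successor of $s$ in $\mathbb T_n$, with $T'=T$. **Paths.** $D([0,T],V)$ is the set of $V$-valued càdlàg paths whose left limits lie in $V$, with the supremum norm; $CBV([0,T],S)$ is the set of continuous $S$-valued paths with components of bounded variation. $X^t=X(t\wedge\cdot)$ is the stopped path, and $A_0(r):=r$. **Functionals.** A functional $F:[0,T]\times D([0,T],U)\times CBV([0,T],S)\to\mathbb R$ is *non-anticipative* if $F(t,X,A)=F(t,X^t,A^t)$; *boundedness-preserving* if for all $A$ and all compact $K\subset U$ it is bounded on $[0,T]\times D([0,T],K)\times\{A\}$; *continuous at fixed times* if for all $\varepsilon,t,X,A$ there is $\delta>0$ with $|F(t,X,A)-F(t,Z,A)|<\varepsilon$ whenever $\|X^t-Z^t\|_\infty<\delta$; *left-continuous* if for all $t\in(0,T]$, $\varepsilon,X,A$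 there is $\delta>0$ with $|F(t,X,A)-F(t-h,Z,A)|<\varepsilon$ whenever $0\le h<\delta$, $h\le t$ and $\|X^t-Z^{t-h}\|_\infty<\delta$; *continuous in $X$ locally uniformly in $t$* if for all $\varepsilon,t,X,A$ there is $\delta>0$ with $|F(u,X,A)-F(u,Z,A)|<\varepsilon$ whenever $|t-u|<\delta$ and $\|X-Z\|_\infty<\delta$. A *horizontal derivative* of $F$ is a tuple $\mathscr DF=(\mathscr D_0F,\dots,\mathscr D_mF)$ of non-anticipative, boundedness-preserving functionals such that, for all $0\le s<t\le T$, $X$ and $A$, the maps $[s,t]\ni r\mapsto\mathscr D_iF(r,X^s,A)$ are Borel measurable and $$F(t,X^s,A)-F(s,X^s,A)=\sum_{i=0}^m\int_s^t\mathscr D_iF(r,X^s,A)\,dA_i(r).$$ The *vertical derivative* $\nabla_XF(t,X,A)=(\partial_iF(t,X,A))_{i=1,\dots,d}$ is the gradient at $v=0$ of $v\mapsto F(t,X+v\mathbf 1_{[t,T]},A^t)$, and $\partial_{ij}F=\partial_i(\partial_jF)$. $\mathbb C^{1,2}_c(U,S)$ is the class of non-anticipative $F$ that are left-continuous, boundedness-preserving,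 continuous in $X$ locally uniformly in $t$, have a horizontal derivative that is continuous at fixed times, and are twice vertically differentiable with all $\partial_iF$ and $\partial_{ij}F$ left-continuous and boundedness-preserving. For $F\in\mathbb C^{1,2}_c(U,S)$, $\mathscr DF$ denotes any horizontal derivative that is continuous at fixed times. **Integrands and integrals.** $\xi:[0,T]\times D([0,T],U)\to\mathbb R^d$ is an *admissible functional integrand* if $\xi(t,X)=\nabla_XG(t,X,B)$ for some $p\in\mathbb N$, open $W\subset\mathbb R^p$, $B\in CBV([0,T],W)$ and $G\in\mathbb C^{1,2}_c(U,W)$. For $X\in C([0,T],U)$ put $X^n=\sum_{s\in\mathbb T_n}X(s')\mathbf 1_{[s,s')}+X(T)\mathbf 1_{\{T\}}$, let $X^{n,s-}$ be $X^n$ on $[0,s)$ and constant equal to $X(s)$ on $[s,T]$, and $$\int_0^t\xi(s,X)\,dX(s):=\lim_{n\to\infty}\sum_{s\in\mathbb T_n,\,s\le t}\xi(s,X^{n,s-})\cdot(X(s')-X(s))$$ when the limit exists. A continuous real path $x$ has the *continuous quadratic variation* $[x]$ if $\sum_{s\in\mathbb T_n,s\le t}(x(s')-x(s))^2\to[x](t)$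 for all $t\in(0,T]$ and $[x]$, with $[x](0)=0$, is continuous; an $\mathbb R^d$-valued path $X$ has the continuous quadratic variation $([X_i,X_j])_{i,j}$ if all $X_i+X_j$ have one, with $[X_i,X_j]=\frac12([X_i+X_j]-[X_i]-[X_j])$. **Statement.** Let $X\in C([0,T],U)$ have the continuous quadratic variation $[X]$, let $A\in CBV([0,T],S)$ and $F_1,\dots,F_\nu\in\mathbb C^{1,2}_c(U,S)$, write $F=(F_1,\dots,F_\nu)$, and suppose that $Y(t):=F(t,X,A)$ admits the continuous quadratic variation $$[Y_i,Y_j](t)=\sum_{k,\ell=1}^d\int_0^t\partial_kF_i(s,X,A)\,\partial_\ell F_j(s,X,A)\,d[X_k,X_\ell](s),\qquad i,j=1,\dots,\nu.$$ Let $\eta:[0,T]\times D([0,T],\mathbb R^\nu)\to\mathbb R^\nu$ be an admissible functional integrand. Then $$(t,Z)\longmapsto\sum_{\ell=1}^\nu\eta_\ell\big(t,F(\cdot,Z,A)\big)\nabla_XF_\ell(t,Z,A),\qquad Z\in D([0,T],U),$$ is an admissible functional integrand and, for every $t\in[0,T]$ (in particular for $t=T$), the two Itô integrals below exist, the Lebesgue–Stieltjes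 integrands are integrable, and $$\begin{aligned}\int_0^t\eta(s,Y)\,dY(s)&=\int_0^t\sum_{\ell=1}^\nu\eta_\ell\big(s,F(\cdot,X,A)\big)\nabla_XF_\ell(s,X,A)\,dX(s)\\&\quad+\sum_{\ell=1}^\nu\bigg(\sum_{i=0}^m\int_0^t\eta_\ell(s,Y)\,\mathscr D_iF_\ell(s,X,A)\,dA_i(s)+\frac12\sum_{i,j=1}^d\int_0^t\eta_\ell(s,Y)\,\partial_{ij}F_\ell(s,X,A)\,d[X_i,X_j](s)\bigg).\end{aligned}$$ -/

import Mathlib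

open MeasureTheory Filter Topology

noncomputable section

namespace FunctionalIto

/-- The time interval `[0,T]`. -/
abbrev Time (T : ℝ) : Type := Set.Icc (0 : ℝ) T

/-- Euclidean space `ℝ^d`. -/
abbrev E (d : ℕ) : Type := EuclideanSpace ℝ (Fin d)

/-- Arbitrary functions `[0,T] → ℝ^d`; the path spaces are singled out by predicates below. -/
abbrev PathFn (T : ℝ) (d : ℕ) : Type := Time T → E d

/-- Functionals of `(t, X, A)`. Only the values at `X ∈ D([0,T],U)` and `A ∈ CBV([0,T],S)` matter:
every notion below refers to these values only. -/
abbrev Functional (T : ℝ) (d m : ℕ) : Type := Time T → PathFn T d → PathFn T m → ℝ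

variable {T : ℝ} {d m ν : ℕ}

/-! ### Path spaces -/

/-- `X ∈ D([0,T],V)`: càdlàg and `V`-valued, with left limits in `V`. (At time `0` the condition on
the left limit is void as soon as `V` is non-empty, because `𝓝[<] 0 = ⊥`.) -/
structure IsCadlag (V : Set (E d)) (X : PathFn T d) : Prop where
  mem : ∀ t, X t ∈ V
  right : ∀ t, ContinuousWithinAt X (Set.Ici t) t
  left : ∀ t, ∃ l ∈ V, Tendsto X (𝓝[<] t) (𝓝 l)

/-- `A ∈ CBV([0,T],S)`: continuous, `S`-valued, with components of bounded variation. -/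
structure IsCBV (S : Set (E m)) (A : PathFn T m) : Prop where
  mem : ∀ t, A t ∈ S
  cont : Continuous A
  bv : ∀ i, BoundedVariationOn (fun t => A t i) Set.univ

/-- The path `X^t` stopped at `t`. -/
def stopped (X : PathFn T d) (t : Time T) : PathFn T d := fun s => X (min t s)

/-- The path `X + v 1_{[t,T]}`. -/
def bump (X : PathFn T d) (t : Time T) (v : E d) : PathFn T d :=
  fun s => X s + if t ≤ s then v else 0

/-- The supremum norm (the paths it is applied to are bounded). -/
def supNorm (X : PathFn T d) : ℝ := ⨆ u, ‖X u‖

/-! ### Regularity of functionals -/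

section Regularity

variable (U : Set (E d)) (S : Set (E m)) (F : Functional T d m)

def NonAnticipative : Prop :=
  ∀ t X A, IsCadlag U X → IsCBV S A → F t X A = F t (stopped X t) (stopped A t)

def BoundednessPreserving : Prop :=
  ∀ A, IsCBV S A → ∀ K ⊆ U, IsCompact K →
    ∃ C : ℝ, ∀ t X, IsCadlag K X → |F t X A| ≤ C

def ContinuousAtFixedTimes : Prop :=
  ∀ ε > (0 : ℝ), ∀ t X A, IsCadlag U X → IsCBV S A →
    ∃ δ > (0 : ℝ), ∀ Y, IsCadlag U Y → supNorm (stopped X t - stopped Y t) < δ →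
      |F t X A - F t Y A| < ε

/-- Left-continuity; the time `s` below is `t - h` with `0 ≤ h < δ`. -/
def LeftContinuous : Prop :=
  ∀ t : Time T, (0 : ℝ) < t → ∀ ε > (0 : ℝ), ∀ X A, IsCadlag U X → IsCBV S A →
    ∃ δ > (0 : ℝ), ∀ s ≤ t, (t : ℝ) - s < δ → ∀ Y, IsCadlag U Y →
      supNorm (stopped X t - stopped Y s) < δ → |F t X A - F s Y A| < ε

/-- Continuity in `X` locally uniformly in `t`. -/
def ContinuousLocallyUniformly : Prop :=
  ∀ ε > (0 : ℝ), ∀ (t : Time T) X A, IsCadlag U X → IsCBV S A →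
    ∃ δ > (0 : ℝ), ∀ (u : Time T) Y, IsCadlag U Y → supNorm (X - Y) < δ → |(t : ℝ) - u| < δ →
      |F u X A - F u Y A| < ε

end Regularity

/-! ### Lebesgue–Stieltjes integrals -/

instance : CompactIccSpace (Time T) where
  isCompact_Icc {_ _} := IsClosed.isCompact isClosed_Icc

open Classical in
/-- The signed measure `dg` on `[0,T]` of a function `g` of bounded variation. -/
def stieltjes (g : Time T → ℝ) : SignedMeasure (Time T) :=
  if h : BoundedVariationOn g Set.univ then h.vectorMeasure else 0

/-- The Lebesgue–Stieltjes integral `∫_J f dg`. All integrators below are continuous, so the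
end points of the interval `J` do not matter. -/
def lsIntegral (f g : Time T → ℝ) (J : Set (Time T)) : ℝ :=
  ((stieltjes g).restrict J).integral f (ContinuousLinearMap.lsmul ℝ ℝ)

/-- `f` is integrable over `J` with respect to (the total variation of) `dg`. -/
def LSIntegrable (f g : Time T → ℝ) (J : Set (Time T)) : Prop :=
  (stieltjes g).IntegrableOn f J

/-! ### Functional derivatives -/

/-- The integrators `A_0, A_1, …, A_m`, where `A_0(r) = r`. -/
def withTime (A : PathFn T m) : Fin (m + 1) → Time T → ℝ :=
  Fin.cons (fun r => (r : ℝ)) (fun i r => A r i)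

/-- `D = (D_0, …, D_m)` is a horizontal derivative of `F`. -/
structure IsHorizontalDeriv (U : Set (E d)) (S : Set (E m)) (F : Functional T d m)
    (D : Fin (m + 1) → Functional T d m) : Prop where
  nonAnticipative : ∀ i, NonAnticipative U S (D i)
  boundednessPreserving : ∀ i, BoundednessPreserving U S (D i)
  measurable : ∀ i s t X A, s < t → IsCadlag U X → IsCBV S A →
    Measurable fun r : Set.Icc s t => D i r (stopped X s) A
  integral_eq : ∀ s t X A, s < t → IsCadlag U X → IsCBV S A →
    F t (stopped X s) A - F s (stopped X s) A
      = ∑ i, lsIntegral (fun r => D i r (stopped X s) A) (withTime A i) (Set.Ioc s t)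

/-- `F` is vertically differentiable at all `(t, X, A)`. Since `U` is open and the range of a
path in `D([0,T],U)` is relatively compact in `U`, the perturbed path stays in `D([0,T],U)` for
small `v`. -/
def VerticallyDifferentiable (U : Set (E d)) (S : Set (E m)) (F : Functional T d m) : Prop :=
  ∀ t X A, IsCadlag U X → IsCBV S A →
    DifferentiableAt ℝ (fun v : E d => F t (bump X t v) (stopped A t)) 0

/-- The vertical derivative `∇_X F`. -/
def vgrad (F : Functional T d m) (t : Time T) (X : PathFn T d) (A : PathFn T m) : E d :=
  gradient (fun v : E d => F t (bump X t v) (stopped A t)) 0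

/-- The partial vertical derivative `∂_i F`; second derivatives are `∂_{ij} F = ∂_i (∂_j F)`. -/
def vpartial (i : Fin d) (F : Functional T d m) : Functional T d m :=
  fun t X A => vgrad F t X A i

/-- The class `ℂ^{1,2}_b(U,S)`. -/
structure MemC12b (U : Set (E d)) (S : Set (E m)) (F : Functional T d m) : Prop where
  nonAnticipative : NonAnticipative U S F
  leftContinuous : LeftContinuous U S F
  horizontal : ∃ D : Fin (m + 1) → Functional T d m,
    IsHorizontalDeriv U S F D ∧ ∀ i, ContinuousAtFixedTimes U S (D i)
  vertical : VerticallyDifferentiable U S F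
  vertical₂ : ∀ j, VerticallyDifferentiable U S (vpartial j F)
  vpartial_leftContinuous : ∀ i, LeftContinuous U S (vpartial i F)
  vpartial_boundednessPreserving : ∀ i, BoundednessPreserving U S (vpartial i F)
  vpartial₂_leftContinuous : ∀ i j, LeftContinuous U S (vpartial i (vpartial j F))
  vpartial₂_boundednessPreserving :
    ∀ i j, BoundednessPreserving U S (vpartial i (vpartial j F))

/-- The class `ℂ^{1,2}_c(U,S)`. -/
structure MemC12c (U : Set (E d)) (S : Set (E m)) (F : Functional T d m) : Prop
    extends MemC12b U S F where
  continuousLocallyUniformly : ContinuousLocallyUniformly U S F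
  boundednessPreserving : BoundednessPreserving U S F

/-- `ξ : [0,T] × D([0,T],U) → ℝ^d` is an admissible functional integrand. -/
def IsAdmissible (U : Set (E d)) (ξ : Time T → PathFn T d → E d) : Prop :=
  ∃ (m : ℕ) (S : Set (E m)) (A : PathFn T m) (F : Functional T d m),
    IsOpen S ∧ IsCBV S A ∧ MemC12c U S F ∧
      ∀ t X, IsCadlag U X → ξ t X = vgrad F t X A

/-! ### Partitions, quadratic variation and the pathwise Itô integral -/

/-- The smallest point of the partition `P` that is larger than `t` (and `t` if there is none). For
`t ∈ P` this is the successor `t'`, with `T' = T`. -/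
def succPt (P : Finset (Time T)) (t : Time T) : Time T :=
  if h : (P.filter (t < ·)).Nonempty then (P.filter (t < ·)).min' h else t

/-- A refining sequence of partitions of `[0,T]` with mesh tending to zero. -/
structure PartitionSeq (T : ℝ) where
  pts : ℕ → Finset (Time T)
  zero_mem : ∀ n, ∃ s ∈ pts n, (s : ℝ) = 0
  top_mem : ∀ n, ∃ s ∈ pts n, (s : ℝ) = T
  mono : Monotone pts
  mesh : ∀ ε > (0 : ℝ), ∀ᶠ n in atTop, ∀ s ∈ pts n, (succPt (pts n) s : ℝ) - s < ε

/-- The real-valued function `x` admits the continuous quadratic variation `q`. -/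
def HasQV (P : PartitionSeq T) (x q : Time T → ℝ) : Prop :=
  (∀ t : Time T, (0 : ℝ) < t → Tendsto
    (fun n => ∑ s ∈ (P.pts n).filter (· ≤ t), (x (succPt (P.pts n) s) - x s) ^ 2) atTop (𝓝 (q t)))
  ∧ (∀ t : Time T, (t : ℝ) = 0 → q t = 0) ∧ Continuous q

/-- The path `X` admits the continuous quadratic variation `Q = ([X_i,X_j])_{i,j}`: all `X_i + X_j`
and all `X_i` admit a continuous quadratic variation, and `Q` is given by polarization. -/
def HasCovariation (P : PartitionSeq T) (X : PathFn T d) (Q : Fin d → Fin d → Time T → ℝ) : Prop :=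
  ∃ (q₂ : Fin d → Fin d → Time T → ℝ) (q₁ : Fin d → Time T → ℝ),
    (∀ i j, HasQV P (fun t => X t i + X t j) (q₂ i j)) ∧
    (∀ i, HasQV P (fun t => X t i) (q₁ i)) ∧
    ∀ i j t, Q i j t = (1 / 2) * (q₂ i j t - q₁ i t - q₁ j t)

/-- The approximating path `X^n = ∑_{s} X(s') 1_{[s,s')} + X(T) 1_{{T}}`: for `t ∈ [s,s')` the
point `s'` is the smallest partition point larger than `t`. -/
def approx (P : Finset (Time T)) (X : PathFn T d) : PathFn T d := fun t => X (succPt P t)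

/-- The path `X^{n,s-}` for a partition point `s`: it equals `X^n` before `s` and stays from `s` on
at the left limit `X^n(s-)`, which is `X(s)`. (For `s = 0` it is the constant path `X(0)`.) -/
def approxLeft (P : Finset (Time T)) (X : PathFn T d) (s : Time T) : PathFn T d :=
  fun u => if u < s then approx P X u else X s

/-- The pathwise Itô integral `∫_0^t ξ(s,X) dX(s)` along `P` exists and equals `L`. -/
def HasItoIntegral (P : PartitionSeq T) (ξ : Time T → PathFn T d → E d) (X : PathFn T d)
    (t : Time T) (L : ℝ) : Prop :=
  Tendsto (fun n => ∑ s ∈ (P.pts n).filter (· ≤ t),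
    inner ℝ (ξ s (approxLeft (P.pts n) X s)) (X (succPt (P.pts n) s) - X s)) atTop (𝓝 L)

/-! ### Composition -/

/-- The path `t ↦ F(t,X,A) = (F_1(t,X,A), …, F_ν(t,X,A))`. -/
def imagePath (F : Fin ν → Functional T d m) (X : PathFn T d) (A : PathFn T m) : PathFn T ν :=
  fun t => WithLp.toLp 2 fun l => F l t X A

/-- The functional `(t,X) ↦ ∑_ℓ η_ℓ(t, F(·,X,A)) ∇_X F_ℓ(t,X,A)`. -/
def pullbackIntegrand (η : Time T → PathFn T ν → E ν) (F : Fin ν → Functional T d m) (A : PathFn T m) :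
    Time T → PathFn T d → E d :=
  fun t X => ∑ l, η t (imagePath F X A) l • vgrad (F l) t X A

end FunctionalIto

end

open FunctionalIto

/-!
For `F ∈ ℂ^{1,2}_c(U,S)` and a continuous path `X` with continuous quadratic variation, the
functional Itô formula writes the compensated Riemann sums of `∇_X F` as a telescoping sum of
increments of `F` along the approximating paths, up to horizontal and second order terms that
converge to the corresponding Lebesgue–Stieltjes integrals; so the Itô integral of `∇_X F` exists
and equals `F(t,X,A) - F(0,X,A)` minus a drift.

The composition `G(t, F(·,X,A), B)` is a functional of `X` and of the pair `(A,B)`. Along a frozen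
path `X^s` the image `F(·,X^s,A)` is continuous and of bounded variation after time `s`, so Itô's
formula for `G` with vanishing quadratic variation provides a horizontal derivative of the
composition; with the chain rule for vertical derivatives the composition is again of class
`ℂ^{1,2}_c`. If `η = ∇_X G(·,·,B)`, then the pulled back integrand is the vertical derivative of
the composition. Both Itô integrals therefore come from Itô's formula, for `G` along `Y` and for
the composition along `X`, and the theorem is the difference of the two drifts, in which the terms
with `[Y_i,Y_j]` cancel by the assumption on `[Y]`.
-/

noncomputable section

namespace FunctionalIto

/-! ### Bounded variation and signed measures -/

section BoundedVariation

variable {α : Type*} [LinearOrder α]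

theorem boundedVariationOn_add {V : Type*} [SeminormedAddCommGroup V] {g h : α → V} {s : Set α}
    (hg : BoundedVariationOn g s) (hh : BoundedVariationOn h s) :
    BoundedVariationOn (fun t => g t + h t) s := by
  refine ne_top_of_le_ne_top (ENNReal.add_ne_top.2 ⟨hg, hh⟩) (iSup_le fun p => ?_)
  calc ∑ i ∈ Finset.range p.1, edist (g (p.2.1 (i + 1)) + h (p.2.1 (i + 1)))
          (g (p.2.1 i) + h (p.2.1 i))
      ≤ ∑ i ∈ Finset.range p.1, (edist (g (p.2.1 (i + 1))) (g (p.2.1 i))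
          + edist (h (p.2.1 (i + 1))) (h (p.2.1 i))) :=
        Finset.sum_le_sum fun _ _ => edist_add_add_le _ _ _ _
    _ ≤ eVariationOn g s + eVariationOn h s := by
        rw [Finset.sum_add_distrib]
        exact add_le_add (eVariationOn.sum_le p.2.2.1 p.2.2.2)
          (eVariationOn.sum_le p.2.2.1 p.2.2.2)

theorem boundedVariationOn_of_dist_le {V W : Type*} [PseudoMetricSpace V] [PseudoMetricSpace W]
    {g : α → V} {h : α → W} {s : Set α} (hg : BoundedVariationOn g s)
    (hle : ∀ a b, a ≤ b → dist (h b) (h a) ≤ dist (g b) (g a)) : BoundedVariationOn h s :=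
  ne_top_of_le_ne_top hg <| iSup_mono fun p => Finset.sum_le_sum fun i _ => by
    rw [edist_dist, edist_dist]
    exact ENNReal.ofReal_le_ofReal (hle _ _ (p.2.2.1 i.le_succ))

theorem boundedVariationOn_of_monotone [BoundedOrder α] {g : α → ℝ} (hg : Monotone g) :
    BoundedVariationOn g Set.univ :=
  (hg.monotoneOn _).boundedVariationOn fun _ _ =>
    abs_le_max_abs_abs (hg bot_le) (hg le_top)

/-- A continuous function of bounded variation, the kind of integrator used throughout. -/
structure IsContBV [TopologicalSpace α] (g : α → ℝ) : Prop where
  cont : Continuous g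
  bv : BoundedVariationOn g Set.univ

namespace IsContBV

variable [TopologicalSpace α] {g h : α → ℝ}

theorem of_monotone [BoundedOrder α] (hg : Monotone g) (hc : Continuous g) : IsContBV g :=
  ⟨hc, boundedVariationOn_of_monotone hg⟩

theorem const (c : ℝ) : IsContBV fun _ : α => c :=
  ⟨continuous_const, (eVariationOn.constant_on <| by
    rintro _ ⟨_, _, rfl⟩ _ ⟨_, _, rfl⟩; rfl).trans_ne ENNReal.zero_ne_top⟩

theorem add (hg : IsContBV g) (hh : IsContBV h) : IsContBV fun t => g t + h t :=
  ⟨hg.cont.add hh.cont, boundedVariationOn_add hg.bv hh.bv⟩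

theorem sum {ι : Type*} (s : Finset ι) {g : ι → α → ℝ} (hg : ∀ i ∈ s, IsContBV (g i)) :
    IsContBV fun t => ∑ i ∈ s, g i t := by
  classical
  induction s using Finset.induction_on with
  | empty => simpa using const 0
  | insert a s ha ih =>
    simp only [Finset.sum_insert ha]
    exact (hg a (by simp)).add (ih fun i hi => hg i (by simp [hi]))

end IsContBV

end BoundedVariation

section SignedMeasure

variable {α : Type*} [MeasurableSpace α]

instance isFiniteMeasure_variation (μ : SignedMeasure α) : IsFiniteMeasure μ.variation := by
  rw [← SignedMeasure.totalVariation_eq_variation]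
  infer_instance

theorem variation_singleton_eq_zero [MeasurableSingletonClass α] {μ : SignedMeasure α} {a : α}
    (h : μ {a} = 0) : μ.variation {a} = 0 := by
  have hdirac := VectorMeasure.variation_restrict (μ := μ) (MeasurableSet.singleton a)
  rw [VectorMeasure.restrict_singleton, h, VectorMeasure.variation_dirac] at hdirac
  simpa using (congrArg (fun ν : Measure α => ν {a}) hdirac).symm

section Interval

variable [LinearOrder α] [TopologicalSpace α] [OrderTopology α] [BorelSpace α]

theorem signedMeasure_ext_of_Iic [SecondCountableTopology α] [OrderTop α] {μ ν : SignedMeasure α}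
    (h : ∀ b, μ (Set.Iic b) = ν (Set.Iic b)) : μ = ν := by
  refine VectorMeasure.ext_of_generateFrom (Set.range Set.Iic) ?_ ?_ isPiSystem_Iic ?_
  · rintro _ ⟨b, rfl⟩
    exact h b
  · rw [← borel_eq_generateFrom_Iic]
    exact BorelSpace.measurable_eq
  · rw [← Set.Iic_top, h]

theorem boundedVariationOn_measure_Iic [BoundedOrder α] (μ : SignedMeasure α) :
    BoundedVariationOn (fun b => μ (Set.Iic b)) Set.univ := by
  have hM : Monotone fun b => μ.variation.real (Set.Iic b) := fun a b hab =>
    measureReal_mono (Set.Iic_subset_Iic.2 hab)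
  refine boundedVariationOn_of_dist_le (boundedVariationOn_of_monotone hM) fun a b hab => ?_
  have hd : Disjoint (Set.Iic a) (Set.Ioc a b) := Set.Iic_disjoint_Ioc le_rfl
  rw [Real.dist_eq, Real.dist_eq, ← Set.Iic_union_Ioc_eq_Iic hab,
    measureReal_union hd measurableSet_Ioc,
    VectorMeasure.of_union hd measurableSet_Iic measurableSet_Ioc, add_sub_cancel_left,
    add_sub_cancel_left]
  exact (VectorMeasure.norm_measure_le_variation (μ := μ) (measure_ne_top _ _)).trans
    (le_abs_self _)

end Interval

end SignedMeasure

/-! ### Bounded measurable integrands -/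

section BddMeasOn

variable {α : Type*} [MeasurableSpace α]

/-- The restriction of `f` to `J` is measurable and bounded; measurability is expressed through
the extension of this restriction by zero. -/
structure BddMeasOn (f : α → ℝ) (J : Set α) : Prop where
  meas : Measurable (J.indicator f)
  bdd : ∃ C, ∀ x ∈ J, |f x| ≤ C

namespace BddMeasOn

variable {f f₁ f₂ : α → ℝ} {J J' : Set α}

theorem mono (h : BddMeasOn f J) (hJ' : MeasurableSet J') (hJJ : J' ⊆ J) : BddMeasOn f J' := by
  refine ⟨?_, h.bdd.imp fun C hC x hx => hC x (hJJ hx)⟩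
  have := h.meas.indicator hJ'
  rwa [Set.indicator_indicator, Set.inter_eq_left.2 hJJ] at this

theorem congr (h : BddMeasOn f₁ J) (he : Set.EqOn f₁ f₂ J) : BddMeasOn f₂ J := by
  obtain ⟨C, hC⟩ := h.bdd
  exact ⟨by rw [← Set.indicator_congr he]; exact h.meas, C, fun x hx => he hx ▸ hC x hx⟩

theorem const (hJ : MeasurableSet J) (c : ℝ) : BddMeasOn (fun _ => c) J :=
  ⟨measurable_const.indicator hJ, |c|, fun _ _ => le_rfl⟩

theorem add (h₁ : BddMeasOn f₁ J) (h₂ : BddMeasOn f₂ J) :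
    BddMeasOn (fun x => f₁ x + f₂ x) J := by
  obtain ⟨C₁, hC₁⟩ := h₁.bdd
  obtain ⟨C₂, hC₂⟩ := h₂.bdd
  refine ⟨?_, C₁ + C₂, fun x hx => (abs_add_le _ _).trans (add_le_add (hC₁ x hx) (hC₂ x hx))⟩
  have := h₁.meas.add h₂.meas
  rwa [← Set.indicator_add'] at this

theorem mul (h₁ : BddMeasOn f₁ J) (h₂ : BddMeasOn f₂ J) :
    BddMeasOn (fun x => f₁ x * f₂ x) J := by
  obtain ⟨C₁, hC₁⟩ := h₁.bdd
  obtain ⟨C₂, hC₂⟩ := h₂.bdd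
  refine ⟨?_, C₁ * C₂, fun x hx => ?_⟩
  · rw [Set.indicator_mul]
    exact h₁.meas.mul h₂.meas
  · rw [abs_mul]
    exact mul_le_mul (hC₁ x hx) (hC₂ x hx) (abs_nonneg _) ((abs_nonneg _).trans (hC₁ x hx))

theorem sum {ι : Type*} (s : Finset ι) {f : ι → α → ℝ} (hJ : MeasurableSet J)
    (h : ∀ i ∈ s, BddMeasOn (f i) J) : BddMeasOn (fun x => ∑ i ∈ s, f i x) J := by
  classical
  induction s using Finset.induction_on with
  | empty => simpa using const hJ 0
  | insert a s ha ih =>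
    simp only [Finset.sum_insert ha]
    exact (h a (by simp)).add (ih fun i hi => h i (by simp [hi]))

theorem exists_abs_indicator_le (h : BddMeasOn f J) : ∃ C, ∀ x, |J.indicator f x| ≤ C := by
  obtain ⟨C, hC⟩ := h.bdd
  refine ⟨|C|, fun x => ?_⟩
  by_cases hx : x ∈ J
  · simpa [hx] using (hC x hx).trans (le_abs_self C)
  · simp [hx]

theorem indicator (h : BddMeasOn f J) : BddMeasOn (J.indicator f) Set.univ :=
  ⟨by simpa using h.meas, h.exists_abs_indicator_le.imp fun _ hC x _ => hC x⟩

theorem integrable_indicator (h : BddMeasOn f J) (μ : SignedMeasure α) :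
    μ.Integrable (J.indicator f) := by
  obtain ⟨C, hC⟩ := h.exists_abs_indicator_le
  exact Integrable.of_bound h.meas.aestronglyMeasurable C (Eventually.of_forall hC)

theorem integrableOn (h : BddMeasOn f J) (hJ : MeasurableSet J) (μ : SignedMeasure α) :
    μ.IntegrableOn f J :=
  (VectorMeasure.integrable_indicator_iff hJ).1 (h.integrable_indicator μ)

theorem insert [MeasurableSingletonClass α] (h : BddMeasOn f J) (a : α) :
    BddMeasOn f (insert a J) := by
  classical
  obtain ⟨C, hC⟩ := h.bdd
  refine ⟨?_, max C |f a|, ?_⟩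
  · have : (Insert.insert a J).indicator f
        = ({a} : Set α).piecewise (fun _ => f a) (J.indicator f) := by
      ext x
      by_cases hx : x = a
      · subst hx; simp
      · by_cases hJ : x ∈ J <;> simp [hx, hJ]
    rw [this]
    exact Measurable.piecewise (by simp) measurable_const h.meas
  · rintro x (rfl | hx)
    · exact le_max_right _ _
    · exact (hC x hx).trans (le_max_left _ _)

theorem measurable_comp_subtypeVal (h : BddMeasOn f J) (hJ : J' ⊆ J) :
    Measurable fun x : J' => f x := by
  have := h.meas.comp (measurable_subtype_coe (p := (· ∈ J')))
  convert this using 1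
  ext x
  simp [hJ x.2]

end BddMeasOn

end BddMeasOn

/-! ### Lebesgue–Stieltjes integrals with continuous integrators -/

section WithDensity

open ContinuousLinearMap (lsmul)

variable {α : Type*} [MeasurableSpace α] (μ : SignedMeasure α) {k : α → ℝ}

theorem integral_withDensity_simpleFunc (hk : μ.Integrable k) (g : SimpleFunc α ℝ) :
    (μ.withDensity k (lsmul ℝ ℝ)).integral g (lsmul ℝ ℝ)
      = μ.integral (fun x => g x * k x) (lsmul ℝ ℝ) := by
  induction g using SimpleFunc.induction with
  | @const c s hs =>
    have hpw : ⇑(SimpleFunc.piecewise s hs (SimpleFunc.const α c) (SimpleFunc.const α 0))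
        = s.indicator fun _ => c := by
      ext x; by_cases hx : x ∈ s <;> simp [hx]
    have hmul : (fun x => s.indicator (fun _ => c) x * k x) = s.indicator fun x => c * k x := by
      ext x; by_cases hx : x ∈ s <;> simp [hx]
    rw [hpw, hmul, VectorMeasure.integral_indicator hs, VectorMeasure.integral_indicator hs,
      VectorMeasure.integral_const, VectorMeasure.restrict_apply _ hs MeasurableSet.univ,
      Set.univ_inter, VectorMeasure.withDensity_apply hk]
    exact (VectorMeasure.integral_fun_smul _ _ c k).symm
  | @add g₁ g₂ _ h₁ h₂ =>
    have h_int : ∀ (ν : SignedMeasure α) (g : SimpleFunc α ℝ), ν.Integrable g := fun ν g =>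
      SimpleFunc.integrable_of_isFiniteMeasure g
    have hmul : ∀ g : SimpleFunc α ℝ, μ.Integrable fun x => g x * k x := fun g =>
      hk.bdd_mul g.measurable.aestronglyMeasurable
        (Eventually.of_forall g.exists_forall_norm_le.choose_spec)
    simp only [SimpleFunc.coe_add, Pi.add_apply, add_mul]
    rw [VectorMeasure.integral_fun_add (hmul g₁) (hmul g₂), ← h₁, ← h₂]
    exact VectorMeasure.integral_fun_add (h_int _ g₁) (h_int _ g₂)

theorem integral_withDensity (hk : μ.Integrable k) {f : α → ℝ} (hf : Measurable f) {C : ℝ}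
    (hC : ∀ x, |f x| ≤ C) :
    (μ.withDensity k (lsmul ℝ ℝ)).integral f (lsmul ℝ ℝ)
      = μ.integral (fun x => f x * k x) (lsmul ℝ ℝ) := by
  set g := hf.stronglyMeasurable.approxBounded C
  have hlim : ∀ x, Tendsto (fun n => g n x) atTop (𝓝 (f x)) := fun x =>
    hf.stronglyMeasurable.tendsto_approxBounded_of_norm_le (hC x)
  have hle : ∀ n x, ‖g n x‖ ≤ C := fun n x =>
    hf.stronglyMeasurable.norm_approxBounded_le ((abs_nonneg (f x)).trans (hC x)) n x
  have hleft : Tendsto (fun n => (μ.withDensity k (lsmul ℝ ℝ)).integral (g n) (lsmul ℝ ℝ)) atTop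
      (𝓝 ((μ.withDensity k (lsmul ℝ ℝ)).integral f (lsmul ℝ ℝ))) :=
    VectorMeasure.tendsto_integral_of_dominated_convergence (fun _ => C)
      (fun n => (g n).measurable.aestronglyMeasurable) (integrable_const _)
      (fun n => Eventually.of_forall (hle n)) (Eventually.of_forall hlim)
  have hright : Tendsto (fun n => μ.integral (fun x => g n x * k x) (lsmul ℝ ℝ)) atTop
      (𝓝 (μ.integral (fun x => f x * k x) (lsmul ℝ ℝ))) :=
    VectorMeasure.tendsto_integral_of_dominated_convergence (fun x => C * ‖k x‖)
      (fun n => (g n).measurable.aestronglyMeasurable.mul hk.aestronglyMeasurable)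
      (hk.norm.const_mul _)
      (fun n => Eventually.of_forall fun x => by
        rw [norm_mul]; exact mul_le_mul_of_nonneg_right (hle n x) (norm_nonneg _))
      (Eventually.of_forall fun x => (hlim x).mul_const _)
  simp only [integral_withDensity_simpleFunc μ hk] at hleft
  exact tendsto_nhds_unique hleft hright

end WithDensity

section Stieltjes

variable {T : ℝ} {f f₁ f₂ g : Time T → ℝ} {J J' N : Set (Time T)}

theorem stieltjes_Ioc (hg : IsContBV g) {a b : Time T} (h : a ≤ b) :
    stieltjes g (Set.Ioc a b) = g b - g a := by
  rw [stieltjes, dif_pos hg.bv, hg.bv.vectorMeasure_Ioc h,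
    hg.cont.continuousAt.continuousWithinAt.rightLim_eq,
    hg.cont.continuousAt.continuousWithinAt.rightLim_eq]

theorem stieltjes_singleton (hg : IsContBV g) (a : Time T) : stieltjes g {a} = 0 := by
  rw [stieltjes, dif_pos hg.bv, hg.bv.vectorMeasure_singleton,
    hg.cont.continuousAt.continuousWithinAt.rightLim_eq,
    hg.cont.continuousAt.continuousWithinAt.leftLim_eq, sub_self]

theorem stieltjes_Iic [Fact (0 ≤ T)] (hg : IsContBV g) (b : Time T) :
    stieltjes g (Set.Iic b) = g b - g ⊥ := by
  have hd : Disjoint (Set.Iic (⊥ : Time T)) (Set.Ioc ⊥ b) := Set.Iic_disjoint_Ioc le_rfl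
  rw [← Set.Iic_union_Ioc_eq_Iic (bot_le (a := b)),
    VectorMeasure.of_union hd measurableSet_Iic measurableSet_Ioc, stieltjes_Ioc hg bot_le,
    Set.Iic_bot, stieltjes_singleton hg, zero_add]

theorem variation_stieltjes_countable (hg : IsContBV g) (hN : N.Countable) :
    (stieltjes g).variation N = 0 := by
  rw [← Set.biUnion_of_singleton N, measure_biUnion_null_iff hN]
  exact fun a _ => variation_singleton_eq_zero (stieltjes_singleton hg a)

theorem lsIntegral_eq_indicator (f g : Time T → ℝ) (hJ : MeasurableSet J) :
    lsIntegral f g J = (stieltjes g).integral (J.indicator f) (ContinuousLinearMap.lsmul ℝ ℝ) :=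
  (VectorMeasure.integral_indicator hJ).symm

theorem lsIntegral_congr (g : Time T → ℝ) (h : Set.EqOn f₁ f₂ J) :
    lsIntegral f₁ g J = lsIntegral f₂ g J :=
  VectorMeasure.setIntegral_congr_fun h

theorem lsIntegral_empty (f g : Time T → ℝ) : lsIntegral f g ∅ = 0 :=
  (lsIntegral_congr (f₂ := fun _ => 0) g (Set.eqOn_empty _ _)).trans VectorMeasure.integral_zero

theorem lsIntegral_add (g : Time T → ℝ) (hJ : MeasurableSet J) (h₁ : BddMeasOn f₁ J)
    (h₂ : BddMeasOn f₂ J) :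
    lsIntegral (fun x => f₁ x + f₂ x) g J = lsIntegral f₁ g J + lsIntegral f₂ g J :=
  VectorMeasure.integral_fun_add (h₁.integrableOn hJ _) (h₂.integrableOn hJ _)

theorem lsIntegral_sum {ι : Type*} (s : Finset ι) {f : ι → Time T → ℝ} (g : Time T → ℝ)
    (hJ : MeasurableSet J) (h : ∀ i ∈ s, BddMeasOn (f i) J) :
    lsIntegral (fun x => ∑ i ∈ s, f i x) g J = ∑ i ∈ s, lsIntegral (f i) g J :=
  VectorMeasure.integral_finsetSum s fun i hi => (h i hi).integrableOn hJ _

theorem lsIntegral_const_mul (c : ℝ) (f g : Time T → ℝ) (J : Set (Time T)) :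
    lsIntegral (fun x => c * f x) g J = c * lsIntegral f g J :=
  VectorMeasure.integral_fun_smul _ _ c f

theorem lsIntegral_Ioc_one (hg : IsContBV g) {a b : Time T} (h : a ≤ b) :
    lsIntegral (fun _ => 1) g (Set.Ioc a b) = g b - g a := by
  rw [lsIntegral, VectorMeasure.integral_const]
  simp [VectorMeasure.restrict_apply, measurableSet_Ioc, stieltjes_Ioc hg h]

theorem lsIntegral_indicator (hJ : MeasurableSet J) (hJ' : MeasurableSet J') :
    lsIntegral (J'.indicator f) g J = lsIntegral f g (J ∩ J') :=
  VectorMeasure.setIntegral_indicator hJ hJ'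

theorem lsIntegral_congr_set (hg : IsContBV g) (hJ : MeasurableSet J) (hJ' : MeasurableSet J')
    (hN : N.Countable) (h : ∀ x ∉ N, x ∈ J ↔ x ∈ J') : lsIntegral f g J = lsIntegral f g J' := by
  refine VectorMeasure.setIntegral_congr_set hJ hJ' ?_
  filter_upwards [measure_eq_zero_iff_ae_notMem.1 (variation_stieltjes_countable hg hN)]
    with x hx using propext (h x hx)

theorem lsIntegral_Iic [Fact (0 ≤ T)] (hg : IsContBV g) (t : Time T) :
    lsIntegral f g (Set.Iic t) = lsIntegral f g (Set.Ioc ⊥ t) :=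
  lsIntegral_congr_set hg measurableSet_Iic measurableSet_Ioc (Set.countable_singleton ⊥)
    fun _ hu => ⟨fun h => ⟨bot_lt_iff_ne_bot.2 hu, h⟩, fun h => h.2⟩

theorem tendsto_lsIntegral {ι : Type*} {l : Filter ι} [l.IsCountablyGenerated]
    {φ : ι → Time T → ℝ} (hg : IsContBV g) (hJ : MeasurableSet J) (hN : N.Countable)
    (hφ : ∀ᶠ n in l, Measurable (J.indicator (φ n))) {C : ℝ}
    (hC : ∀ᶠ n in l, ∀ x ∈ J, |φ n x| ≤ C)
    (h : ∀ x ∈ J, x ∉ N → Tendsto (fun n => φ n x) l (𝓝 (f x))) :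
    Tendsto (fun n => lsIntegral (φ n) g J) l (𝓝 (lsIntegral f g J)) := by
  simp only [lsIntegral_eq_indicator _ g hJ]
  refine VectorMeasure.tendsto_integral_filter_of_norm_le_const
    (hφ.mono fun n hn => hn.aestronglyMeasurable)
    ⟨|C|, hC.mono fun n hn => Eventually.of_forall fun x => ?_⟩ ?_
  · by_cases hx : x ∈ J
    · simpa [hx] using (hn x hx).trans (le_abs_self C)
    · simp [hx]
  · filter_upwards [measure_eq_zero_iff_ae_notMem.1 (variation_stieltjes_countable hg hN)]
      with x hx
    by_cases hxJ : x ∈ J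
    · simpa [hxJ] using h x hxJ hx
    · simpa [hxJ] using tendsto_const_nhds

theorem continuous_lsIntegral_Iic {k : Time T → ℝ} (hg : IsContBV g)
    (hk : BddMeasOn k Set.univ) : Continuous fun b => lsIntegral k g (Set.Iic b) := by
  refine continuous_iff_continuousAt.2 fun b => ?_
  have hind : ∀ b, lsIntegral k g (Set.Iic b)
      = lsIntegral ((Set.Iic b).indicator k) g Set.univ := fun b => by
    rw [lsIntegral_indicator MeasurableSet.univ measurableSet_Iic, Set.univ_inter]
  have hb : ∀ b, BddMeasOn k (Set.Iic b) := fun b => hk.mono measurableSet_Iic (Set.subset_univ _)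
  obtain ⟨C, hC⟩ := hk.bdd
  simp only [ContinuousAt, hind]
  refine tendsto_lsIntegral hg MeasurableSet.univ (Set.countable_singleton b) (C := |C|)
    (Eventually.of_forall fun b => (hb b).indicator.meas)
    (Eventually.of_forall fun c x _ => ?_) fun x _ hx => tendsto_const_nhds.congr' ?_
  · by_cases hx : x ∈ Set.Iic c
    · simpa [Set.indicator_of_mem hx] using (hC x trivial).trans (le_abs_self C)
    · simp [Set.indicator_of_notMem hx]
  · rcases lt_or_gt_of_ne (Set.mem_singleton_iff.not.1 hx) with h | h
    · filter_upwards [lt_mem_nhds h] with c hc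
      simp [h.le, hc.le]
    · filter_upwards [gt_mem_nhds h] with c hc
      simp [h.not_ge, hc.not_ge]

section Indefinite

variable [Fact (0 ≤ T)] {ι : Type*} [Fintype ι] {h : Time T → ℝ} {k g : ι → Time T → ℝ}

theorem IsContBV.lsIntegral {k g : Time T → ℝ} (hg : IsContBV g) (hk : BddMeasOn k Set.univ) :
    IsContBV fun b => lsIntegral k g (Set.Iic b) := by
  have hki : (stieltjes g).Integrable k := by simpa using hk.integrable_indicator (stieltjes g)
  have hν : ∀ b, FunctionalIto.lsIntegral k g (Set.Iic b)
      = (stieltjes g).withDensity k (ContinuousLinearMap.lsmul ℝ ℝ) (Set.Iic b) := fun b => by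
    rw [VectorMeasure.withDensity_apply hki]; rfl
  refine ⟨continuous_lsIntegral_Iic hg hk, ?_⟩
  simp only [hν]
  exact boundedVariationOn_measure_Iic _

theorem IsContBV.of_sub_eq_sum_lsIntegral (hg : ∀ i, IsContBV (g i))
    (hk : ∀ i, BddMeasOn (k i) Set.univ)
    (h_int : ∀ b, h b - h ⊥ = ∑ i, FunctionalIto.lsIntegral (k i) (g i) (Set.Iic b)) :
    IsContBV h := by
  have hh : h = fun b => h ⊥ + ∑ i, FunctionalIto.lsIntegral (k i) (g i) (Set.Iic b) := by
    ext b; rw [← h_int]; ring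
  rw [hh]
  exact (IsContBV.const _).add (.sum _ fun i _ => (hg i).lsIntegral (hk i))

theorem lsIntegral_of_sub_eq_sum_lsIntegral (hg : ∀ i, IsContBV (g i))
    (hk : ∀ i, BddMeasOn (k i) Set.univ)
    (h_int : ∀ b, h b - h ⊥ = ∑ i, lsIntegral (k i) (g i) (Set.Iic b))
    (hJ : MeasurableSet J) (hf : BddMeasOn f J) :
    lsIntegral f h J = ∑ i, lsIntegral (fun x => f x * k i x) (g i) J := by
  have hki : ∀ i, (stieltjes (g i)).Integrable (k i) := fun i => by
    simpa using (hk i).integrable_indicator (stieltjes (g i))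
  have hstieltjes : stieltjes h = ∑ i,
      (stieltjes (g i)).withDensity (k i) (ContinuousLinearMap.lsmul ℝ ℝ) := by
    refine signedMeasure_ext_of_Iic fun b => ?_
    rw [stieltjes_Iic (.of_sub_eq_sum_lsIntegral hg hk h_int), h_int, FunLike.coe_sum,
      Finset.sum_apply]
    refine Finset.sum_congr rfl fun i _ => ?_
    rw [VectorMeasure.withDensity_apply (hki i)]; rfl
  obtain ⟨C, hC⟩ := hf.exists_abs_indicator_le
  rw [lsIntegral_eq_indicator _ _ hJ, hstieltjes, VectorMeasure.integral_finsetSum_vectorMeasure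
    (fun i _ => hf.integrable_indicator _)]
  refine Finset.sum_congr rfl fun i _ => ?_
  rw [integral_withDensity _ (hki i) hf.meas hC, lsIntegral_eq_indicator _ _ hJ]
  congr 1
  ext x
  by_cases hx : x ∈ J <;> simp [hx]

theorem lsIntegral_Iic_const {g : Time T → ℝ} (hg : IsContBV g) (c : ℝ) (b : Time T) :
    lsIntegral (fun _ => c) g (Set.Iic b) = c * (g b - g ⊥) := by
  rw [lsIntegral_Iic hg, ← lsIntegral_Ioc_one hg bot_le, ← lsIntegral_const_mul]
  simp only [mul_one]

theorem sub_eq_sum_lsIntegral_of_eq_sum_mul (hg : ∀ i, IsContBV (g i)) {c : ι → ℝ}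
    (hc : ∀ t, h t = ∑ i, c i * g i t) (b : Time T) :
    h b - h ⊥ = ∑ i, lsIntegral (fun _ => c i) (g i) (Set.Iic b) := by
  simp only [hc, lsIntegral_Iic_const (hg _), mul_sub, Finset.sum_sub_distrib]

theorem IsContBV.of_eq_sum_mul (hg : ∀ i, IsContBV (g i)) {c : ι → ℝ}
    (hc : ∀ t, h t = ∑ i, c i * g i t) : IsContBV h :=
  .of_sub_eq_sum_lsIntegral hg (fun i => .const .univ (c i))
    (sub_eq_sum_lsIntegral_of_eq_sum_mul hg hc)

theorem lsIntegral_of_eq_sum_mul (hg : ∀ i, IsContBV (g i)) {c : ι → ℝ}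
    (hc : ∀ t, h t = ∑ i, c i * g i t) (hJ : MeasurableSet J) (hf : BddMeasOn f J) :
    lsIntegral f h J = ∑ i, c i * lsIntegral f (g i) J := by
  rw [lsIntegral_of_sub_eq_sum_lsIntegral hg (fun i => .const .univ (c i))
    (sub_eq_sum_lsIntegral_of_eq_sum_mul hg hc) hJ hf]
  simp only [mul_comm (f _), lsIntegral_const_mul]

end Indefinite

theorem lsIntegral_zero_right [Fact (0 ≤ T)] (hJ : MeasurableSet J) (hf : BddMeasOn f J) :
    lsIntegral f (fun _ => 0) J = 0 := by
  rw [lsIntegral_of_sub_eq_sum_lsIntegral (ι := Empty) (k := fun _ _ => 0) (g := fun _ _ => 0)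
    (fun _ => .const 0) (fun _ => .const .univ 0) (by simp) hJ hf]
  simp

end Stieltjes

/-! ### Paths -/

section

variable {T : ℝ} {d m : ℕ}

theorem supNorm_le {X : PathFn T d} {C : ℝ} (hC : 0 ≤ C) (h : ∀ u, ‖X u‖ ≤ C) : supNorm X ≤ C :=
  Real.iSup_le h hC

theorem norm_le_supNorm {X : PathFn T d} {C : ℝ} (h : ∀ u, ‖X u‖ ≤ C) (u : Time T) :
    ‖X u‖ ≤ supNorm X :=
  le_ciSup (f := fun u => ‖X u‖) ⟨C, by rintro _ ⟨v, rfl⟩; exact h v⟩ u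

namespace IsCadlag

variable {U V : Set (E d)} {X Y : PathFn T d}

theorem mono (h : IsCadlag V X) (hVU : V ⊆ U) : IsCadlag U X :=
  ⟨fun t => hVU (h.mem t), h.right, fun t => (h.left t).imp fun _ hl => ⟨hVU hl.1, hl.2⟩⟩

theorem of_continuous (hX : Continuous X) (h : ∀ t, X t ∈ U) : IsCadlag U X :=
  ⟨h, fun _ => hX.continuousAt.continuousWithinAt, fun t =>
    ⟨X t, h t, hX.continuousAt.continuousWithinAt.tendsto⟩⟩

theorem const {x : E d} (h : x ∈ U) : IsCadlag (T := T) U (fun _ => x) :=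
  of_continuous continuous_const fun _ => h

theorem exists_tendsto_of_ultrafilter (h : IsCadlag U X) (𝓕 : Ultrafilter (Time T)) :
    ∃ x ∈ U, Tendsto X 𝓕 (𝓝 x) := by
  obtain ⟨t, -, ht⟩ := isCompact_univ.ultrafilter_le_nhds (X := Time T) 𝓕 (by simp)
  rw [← nhdsLT_sup_nhdsGE t, Ultrafilter.le_sup_iff] at ht
  rcases ht with ht | ht
  · obtain ⟨l, hl, hl'⟩ := h.left t
    exact ⟨l, hl, hl'.mono_left ht⟩
  · exact ⟨X t, h.mem t, (h.right t).tendsto.mono_left ht⟩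

theorem closure_range_subset (h : IsCadlag U X) : closure (Set.range X) ⊆ U := by
  intro x hx
  have hne : (comap X (𝓝 x)).NeBot :=
    comap_neBot_iff_frequently.2 (mem_closure_iff_frequently.1 hx)
  obtain ⟨y, hy, hXy⟩ := h.exists_tendsto_of_ultrafilter (Ultrafilter.of (comap X (𝓝 x)))
  exact tendsto_nhds_unique (tendsto_comap.mono_left (Ultrafilter.of_le _)) hXy ▸ hy

theorem isBounded_range (h : IsCadlag U X) : Bornology.IsBounded (Set.range X) := by
  rw [← Set.image_univ]
  refine isCompact_univ.induction_on (p := fun s => Bornology.IsBounded (X '' s)) (by simp)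
    (fun s t hst ht => ht.subset (Set.image_mono hst))
    (fun s t hs ht => Set.image_union X s t ▸ hs.union ht) fun t _ => ?_
  obtain ⟨l, -, hl⟩ := h.left t
  refine ⟨X ⁻¹' (Metric.ball l 1 ∪ Metric.ball (X t) 1), ?_,
    (Metric.isBounded_ball.union Metric.isBounded_ball).subset (Set.image_preimage_subset _ _)⟩
  rw [nhdsWithin_univ, ← nhdsLT_sup_nhdsGE t]
  exact ⟨mem_of_superset (hl (Metric.ball_mem_nhds l one_pos))
      (Set.preimage_mono Set.subset_union_left),
    mem_of_superset ((h.right t).tendsto (Metric.ball_mem_nhds (X t) one_pos))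
      (Set.preimage_mono Set.subset_union_right)⟩

theorem isCompact_closure_range (h : IsCadlag U X) : IsCompact (closure (Set.range X)) :=
  Metric.isCompact_of_isClosed_isBounded isClosed_closure h.isBounded_range.closure

theorem exists_compact (h : IsCadlag U X) : ∃ K ⊆ U, IsCompact K ∧ IsCadlag K X := by
  refine ⟨_, h.closure_range_subset, h.isCompact_closure_range, fun t => subset_closure ⟨t, rfl⟩,
    h.right, fun t => ?_⟩
  obtain ⟨l, -, hl⟩ := h.left t
  rcases (𝓝[<] t).eq_or_neBot with hb | hb
  · exact ⟨X t, subset_closure ⟨t, rfl⟩, by rw [hb]; exact tendsto_bot⟩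
  · exact ⟨l, mem_closure_of_tendsto hl (Eventually.of_forall fun u => ⟨u, rfl⟩), hl⟩

theorem exists_bound (h : IsCadlag U X) : ∃ C, ∀ u, ‖X u‖ ≤ C := by
  obtain ⟨C, hC⟩ := h.isBounded_range.exists_norm_le
  exact ⟨C, fun u => hC _ ⟨u, rfl⟩⟩

theorem ite_lt (hX : IsCadlag U X) (hY : IsCadlag U Y) (r : Time T) :
    IsCadlag U (fun u => if u < r then X u else Y u) where
  mem t := by split_ifs; exacts [hX.mem t, hY.mem t]
  right t := by
    by_cases ht : t < r
    · refine (hX.right t).congr_of_eventuallyEq ?_ (by simp [ht])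
      filter_upwards [mem_nhdsWithin_of_mem_nhds (Iio_mem_nhds ht)] with u hu
      simp [Set.mem_Iio.1 hu]
    · refine (hY.right t).congr (fun u hu => ?_) (by simp [ht])
      simp [not_lt.2 ((not_lt.1 ht).trans hu)]
  left t := by
    by_cases ht : t ≤ r
    · obtain ⟨l, hl, h⟩ := hX.left t
      refine ⟨l, hl, h.congr' ?_⟩
      filter_upwards [self_mem_nhdsWithin] with u hu
      simp [lt_of_lt_of_le hu ht]
    · obtain ⟨l, hl, h⟩ := hY.left t
      refine ⟨l, hl, h.congr' ?_⟩
      filter_upwards [mem_nhdsWithin_of_mem_nhds (Ioi_mem_nhds (not_le.1 ht))] with u hu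
      simp [not_lt.2 (Set.mem_Ioi.1 hu).le]

theorem stopped (h : IsCadlag U X) (t : Time T) : IsCadlag U (stopped X t) := by
  convert h.ite_lt (const (h.mem t)) t using 1
  ext u : 1
  by_cases hu : u < t
  · simp [FunctionalIto.stopped, hu, hu.le]
  · simp [FunctionalIto.stopped, hu, not_lt.1 hu]

theorem add_const (h : IsCadlag V X) (v : E d) (hU : ∀ x ∈ V, x + v ∈ U) :
    IsCadlag U (fun u => X u + v) :=
  ⟨fun t => hU _ (h.mem t), fun t => (h.right t).add continuousWithinAt_const, fun t =>
    let ⟨l, hl, hl'⟩ := h.left t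
    ⟨l + v, hU l hl, hl'.add_const v⟩⟩

theorem bump (h : IsCadlag V X) (t : Time T) (v : E d) (hVU : V ⊆ U) (hU : ∀ x ∈ V, x + v ∈ U) :
    IsCadlag U (bump X t v) := by
  convert (h.mono hVU).ite_lt (h.add_const v hU) t using 1
  ext u : 1
  by_cases hu : u < t
  · simp [FunctionalIto.bump, hu, hu.not_ge]
  · simp [FunctionalIto.bump, hu, not_lt.1 hu]

theorem bump_cthickening {δ : ℝ} (h : IsCadlag V X) (t : Time T) {v : E d} (hv : ‖v‖ ≤ δ) :
    IsCadlag (Metric.cthickening δ V) (FunctionalIto.bump X t v) :=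
  h.bump t v (Metric.self_subset_cthickening V) fun x hx =>
    Metric.mem_cthickening_of_dist_le (x + v) x δ V hx (by simpa using hv)

theorem exists_bump (hU : IsOpen U) (h : IsCadlag U X) (t : Time T) :
    ∃ δ > 0, ∀ v, ‖v‖ ≤ δ → IsCadlag U (FunctionalIto.bump X t v) := by
  obtain ⟨K, hKU, hK, hX⟩ := h.exists_compact
  obtain ⟨δ, hδ, hδU⟩ := hK.exists_cthickening_subset_open hU hKU
  exact ⟨δ, hδ, fun v hv => (hX.bump_cthickening t hv).mono hδU⟩

theorem eventually_bump (hU : IsOpen U) (h : IsCadlag U X) (t : Time T) :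
    ∀ᶠ v in 𝓝 (0 : E d), IsCadlag U (FunctionalIto.bump X t v) := by
  obtain ⟨δ, hδ, h⟩ := h.exists_bump hU t
  filter_upwards [Metric.ball_mem_nhds 0 hδ] with v hv
  exact h v (by simpa using (Metric.mem_ball.1 hv).le)

theorem norm_sub_le_supNorm (hX : IsCadlag U X) (hY : IsCadlag V Y) (u : Time T) :
    ‖X u - Y u‖ ≤ supNorm (X - Y) := by
  obtain ⟨C, hC⟩ := hX.exists_bound
  obtain ⟨C', hC'⟩ := hY.exists_bound
  exact norm_le_supNorm (X := X - Y) (C := C + C')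
    (fun u => (norm_sub_le _ _).trans (add_le_add (hC u) (hC' u))) u

end IsCadlag

theorem stopped_stopped (X : PathFn T d) (s t : Time T) :
    stopped (stopped X s) t = stopped X (min s t) := by
  ext u : 1
  simp [stopped, min_assoc]

theorem stopped_stopped_self (X : PathFn T d) (t : Time T) :
    stopped (stopped X t) t = stopped X t := by
  rw [stopped_stopped, min_self]

theorem stopped_bump (X : PathFn T d) (t : Time T) (v : E d) :
    stopped (bump X t v) t = bump (stopped X t) t v := by
  ext u : 1
  by_cases h : t ≤ u <;> simp [stopped, bump, h]

theorem bump_zero (X : PathFn T d) (t : Time T) : bump X t 0 = X := by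
  ext u : 1
  simp [bump]

theorem bump_bump (X : PathFn T d) (t : Time T) (v w : E d) :
    bump (bump X t v) t w = bump X t (v + w) := by
  ext u : 1
  by_cases h : t ≤ u <;> simp [bump, h, add_assoc]

theorem IsCBV.stopped {S : Set (E m)} {A : PathFn T m} (h : IsCBV S A) (t : Time T) :
    IsCBV S (stopped A t) where
  mem _ := h.mem _
  cont := h.cont.comp (continuous_const.min continuous_id)
  bv i := ne_top_of_le_ne_top (h.bv i) (eVariationOn.comp_le_of_monotoneOn (fun t => A t i)
    (fun u => min t u) (fun _ _ _ _ hab => min_le_min_left t hab) (fun _ _ => trivial))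

theorem IsCBV.isContBV_withTime [Fact (0 ≤ T)] {S : Set (E m)} {A : PathFn T m} (h : IsCBV S A)
    (i : Fin (m + 1)) : IsContBV (withTime A i) := by
  refine Fin.cases ?_ (fun j => ?_) i
  · exact IsContBV.of_monotone (fun _ _ hab => hab) continuous_subtype_val
  · exact ⟨(EuclideanSpace.proj (𝕜 := ℝ) j).continuous.comp h.cont, h.bv j⟩

/-! ### Partitions -/

/-- The finite set `P` is a partition of `[0,T]`, i.e. it contains both end points. -/
structure IsPartition [Fact (0 ≤ T)] (P : Finset (Time T)) : Prop where
  bot_mem : ⊥ ∈ P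
  top_mem : ⊤ ∈ P

theorem PartitionSeq.isPartition [Fact (0 ≤ T)] (P : PartitionSeq T) (n : ℕ) :
    IsPartition (P.pts n) := by
  obtain ⟨s, hs, hs0⟩ := P.zero_mem n
  obtain ⟨t, ht, htT⟩ := P.top_mem n
  have hsbot : s = ⊥ := Subtype.ext hs0
  have httop : t = ⊤ := Subtype.ext htT
  exact ⟨hsbot ▸ hs, httop ▸ ht⟩

/-- The largest point of `P` that is smaller than `t` (and `t` if there is none). -/
def prevPt (P : Finset (Time T)) (t : Time T) : Time T :=
  if h : (P.filter (· < t)).Nonempty then (P.filter (· < t)).max' h else t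

theorem le_succPt (P : Finset (Time T)) (u : Time T) : u ≤ succPt P u := by
  unfold succPt
  split_ifs with h
  · exact (Finset.mem_filter.1 (Finset.min'_mem _ h)).2.le
  · exact le_rfl

theorem succPt_le {P : Finset (Time T)} {u r : Time T} (hr : r ∈ P) (hur : u < r) :
    succPt P u ≤ r := by
  have hm : r ∈ P.filter (u < ·) := Finset.mem_filter.2 ⟨hr, hur⟩
  rw [succPt, dif_pos ⟨r, hm⟩]
  exact Finset.min'_le _ _ hm

theorem succPt_mem_and_lt {P : Finset (Time T)} {u r : Time T} (hr : r ∈ P) (hur : u < r) :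
    succPt P u ∈ P ∧ u < succPt P u := by
  have hm : r ∈ P.filter (u < ·) := Finset.mem_filter.2 ⟨hr, hur⟩
  rw [succPt, dif_pos ⟨r, hm⟩]
  exact Finset.mem_filter.1 (Finset.min'_mem _ _)

theorem prevPt_le (P : Finset (Time T)) (u : Time T) : prevPt P u ≤ u := by
  unfold prevPt
  split_ifs with h
  · exact (Finset.mem_filter.1 (Finset.max'_mem _ h)).2.le
  · exact le_rfl

theorem le_prevPt {P : Finset (Time T)} {u r : Time T} (hr : r ∈ P) (hur : r < u) :
    r ≤ prevPt P u := by
  have hm : r ∈ P.filter (· < u) := Finset.mem_filter.2 ⟨hr, hur⟩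
  rw [prevPt, dif_pos ⟨r, hm⟩]
  exact Finset.le_max' _ _ hm

theorem prevPt_mem_and_lt {P : Finset (Time T)} {u r : Time T} (hr : r ∈ P) (hur : r < u) :
    prevPt P u ∈ P ∧ prevPt P u < u := by
  have hm : r ∈ P.filter (· < u) := Finset.mem_filter.2 ⟨hr, hur⟩
  rw [prevPt, dif_pos ⟨r, hm⟩]
  exact Finset.mem_filter.1 (Finset.max'_mem _ _)

theorem succPt_eq {P : Finset (Time T)} {r u : Time T} (h₁ : r ≤ u) (h₂ : u < succPt P r) :
    succPt P u = succPt P r := by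
  obtain ⟨q, hq, hrq⟩ : ∃ q ∈ P, r < q := by
    by_contra! h
    have hne : ¬(P.filter (r < ·)).Nonempty := fun ⟨q, hq⟩ =>
      (h q (Finset.mem_filter.1 hq).1).not_gt (Finset.mem_filter.1 hq).2
    rw [succPt, dif_neg hne] at h₂
    exact h₁.not_gt h₂
  have hr := (succPt_mem_and_lt hq hrq).1
  have hu := succPt_mem_and_lt hr h₂
  exact le_antisymm (succPt_le hr h₂) (succPt_le hu.1 (h₁.trans_lt hu.2))

theorem prevPt_bot [Fact (0 ≤ T)] (P : Finset (Time T)) : prevPt P ⊥ = ⊥ :=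
  le_bot_iff.1 (prevPt_le P ⊥)

namespace IsPartition

variable [Fact (0 ≤ T)] {P : Finset (Time T)}

theorem succPt_mem (hP : IsPartition P) (u : Time T) : succPt P u ∈ P := by
  rcases eq_or_lt_of_le (le_top (a := u)) with h | h
  · have : succPt P u = u := le_antisymm (h ▸ le_top) (le_succPt P u)
    rw [this, h]; exact hP.top_mem
  · exact (succPt_mem_and_lt hP.top_mem h).1

theorem lt_succPt (hP : IsPartition P) {u : Time T} (h : u < ⊤) : u < succPt P u :=
  (succPt_mem_and_lt hP.top_mem h).2

theorem prevPt_mem (hP : IsPartition P) (u : Time T) : prevPt P u ∈ P := by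
  rcases eq_or_lt_of_le (bot_le (a := u)) with h | h
  · have : prevPt P u = u := le_antisymm (prevPt_le P u) (h ▸ bot_le)
    rw [this, ← h]; exact hP.bot_mem
  · exact (prevPt_mem_and_lt hP.bot_mem h).1

theorem prevPt_lt (hP : IsPartition P) {u : Time T} (h : ⊥ < u) : prevPt P u < u :=
  (prevPt_mem_and_lt hP.bot_mem h).2

theorem le_succPt_prevPt (hP : IsPartition P) (u : Time T) : u ≤ succPt P (prevPt P u) := by
  rcases eq_or_lt_of_le (bot_le (a := u)) with h | h
  · exact h ▸ bot_le
  · by_contra! hlt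
    have h1 := le_prevPt (hP.succPt_mem (prevPt P u)) hlt
    exact (hP.lt_succPt ((hP.prevPt_lt h).trans_le (le_top (a := u)))).not_ge h1

theorem prevPt_eq_iff (hP : IsPartition P) {r u : Time T} (hr : r ∈ P) :
    u ∈ Set.Ioc r (succPt P r) ↔ ⊥ < u ∧ prevPt P u = r := by
  constructor
  · rintro ⟨h1, h2⟩
    have hou : ⊥ < u := (bot_le (a := r)).trans_lt h1
    refine ⟨hou, le_antisymm ?_ (le_prevPt hr h1)⟩
    by_contra! h
    exact (hP.prevPt_lt hou).not_ge (h2.trans (succPt_le (hP.prevPt_mem u) h))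
  · rintro ⟨h1, rfl⟩
    exact ⟨hP.prevPt_lt h1, hP.le_succPt_prevPt u⟩

theorem indicator_piecewise (hP : IsPartition P) (F : Time T → Time T → ℝ) (u : Time T) :
    (Set.Ioi ⊥).indicator (fun u => F (prevPt P u) u) u
      = ∑ r ∈ P, (Set.Ioc r (succPt P r)).indicator (F r) u := by
  by_cases hu : ⊥ < u
  · rw [Finset.sum_eq_single (prevPt P u)]
    · rw [Set.indicator_of_mem (show u ∈ Set.Ioi ⊥ from hu),
        Set.indicator_of_mem ((hP.prevPt_eq_iff (hP.prevPt_mem u)).2 ⟨hu, rfl⟩)]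
    · intro r hr hne
      refine Set.indicator_of_notMem (fun h => hne ?_) _
      exact ((hP.prevPt_eq_iff hr).1 h).2.symm
    · exact fun h => absurd (hP.prevPt_mem u) h
  · rw [Set.indicator_of_notMem (by simpa using hu)]
    refine (Finset.sum_eq_zero fun r hr => Set.indicator_of_notMem (fun h => hu ?_) _).symm
    exact ((hP.prevPt_eq_iff hr).1 h).1

theorem measurable_piecewise (hP : IsPartition P) {F : Time T → Time T → ℝ}
    (h : ∀ r ∈ P, Measurable ((Set.Ioc r (succPt P r)).indicator (F r))) :
    Measurable ((Set.Ioi ⊥).indicator fun u => F (prevPt P u) u) := by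
  have : (Set.Ioi ⊥).indicator (fun u => F (prevPt P u) u)
      = fun u => ∑ r ∈ P, (Set.Ioc r (succPt P r)).indicator (F r) u :=
    funext fun u => hP.indicator_piecewise F u
  rw [this]
  exact Finset.measurable_fun_sum _ h

theorem lsIntegral_piecewise (hP : IsPartition P) {F : Time T → Time T → ℝ}
    (h : ∀ r ∈ P, BddMeasOn (F r) (Set.Ioc r (succPt P r))) (g : Time T → ℝ) :
    lsIntegral (fun u => F (prevPt P u) u) g (Set.Ioi ⊥)
      = ∑ r ∈ P, lsIntegral (F r) g (Set.Ioc r (succPt P r)) := by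
  rw [lsIntegral_eq_indicator _ _ measurableSet_Ioi,
    show (Set.Ioi ⊥).indicator (fun u => F (prevPt P u) u)
      = fun u => ∑ r ∈ P, (Set.Ioc r (succPt P r)).indicator (F r) u from
    funext fun u => hP.indicator_piecewise F u]
  rw [VectorMeasure.integral_finsetSum _ fun r hr => (h r hr).integrable_indicator _]
  exact Finset.sum_congr rfl fun r _ => (lsIntegral_eq_indicator _ _ measurableSet_Ioc).symm

theorem measurable_step (hP : IsPartition P) (φ : Time T → ℝ) :
    Measurable ((Set.Ioi ⊥).indicator fun u => φ (prevPt P u)) :=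
  hP.measurable_piecewise (F := fun r _ => φ r) fun _ _ =>
    measurable_const.indicator measurableSet_Ioc

theorem lsIntegral_step (hP : IsPartition P) (φ : Time T → ℝ) {g : Time T → ℝ}
    (hg : IsContBV g) :
    lsIntegral (fun u => φ (prevPt P u)) g (Set.Ioi ⊥)
      = ∑ r ∈ P, φ r * (g (succPt P r) - g r) := by
  rw [hP.lsIntegral_piecewise (F := fun r _ => φ r)
    (fun r _ => BddMeasOn.const measurableSet_Ioc _)]
  refine Finset.sum_congr rfl fun r _ => ?_
  rw [← lsIntegral_Ioc_one hg (le_succPt P r), ← lsIntegral_const_mul]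
  simp

end IsPartition

namespace PartitionSeq

variable [Fact (0 ≤ T)] (P : PartitionSeq T)

theorem eventually_mesh_lt {ε : ℝ} (hε : 0 < ε) : ∀ᶠ n in atTop, ∀ u : Time T,
    (succPt (P.pts n) u : ℝ) - u < ε ∧ (u : ℝ) - prevPt (P.pts n) u < ε := by
  filter_upwards [P.mesh ε hε] with n hn u
  have hP := P.isPartition n
  have hmesh := hn _ (hP.prevPt_mem u)
  have hprev : (prevPt (P.pts n) u : ℝ) ≤ u := prevPt_le _ u
  have hsucc : (u : ℝ) ≤ succPt (P.pts n) (prevPt (P.pts n) u) := hP.le_succPt_prevPt u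
  refine ⟨?_, by linarith⟩
  rcases (hP.le_succPt_prevPt u).eq_or_lt with hu | hu
  · exact hn u (hu ▸ hP.succPt_mem _)
  · rw [succPt_eq (prevPt_le _ u) hu]
    linarith

theorem tendsto_succPt (u : Time T) : Tendsto (fun n => succPt (P.pts n) u) atTop (𝓝 u) := by
  refine Metric.tendsto_nhds.2 fun ε hε => (P.eventually_mesh_lt hε).mono fun n hn => ?_
  rw [Subtype.dist_eq, Real.dist_eq, abs_of_nonneg
    (sub_nonneg.2 (Subtype.coe_le_coe.2 (le_succPt _ u)))]
  exact (hn u).1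

theorem tendsto_prevPt (u : Time T) : Tendsto (fun n => prevPt (P.pts n) u) atTop (𝓝 u) := by
  refine Metric.tendsto_nhds.2 fun ε hε => (P.eventually_mesh_lt hε).mono fun n hn => ?_
  rw [dist_comm, Subtype.dist_eq, Real.dist_eq, abs_of_nonneg
    (sub_nonneg.2 (Subtype.coe_le_coe.2 (prevPt_le _ u)))]
  exact (hn u).2

end PartitionSeq

theorem IsCadlag.approx [Fact (0 ≤ T)] {P : Finset (Time T)} (hP : IsPartition P)
    {U : Set (E d)} {X : PathFn T d} (h : ∀ t, X t ∈ U) : IsCadlag U (approx P X) where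
  mem t := h _
  right t := by
    rcases eq_or_lt_of_le (le_top (a := t)) with ht | ht
    · refine (continuousWithinAt_const (b := FunctionalIto.approx P X t)).congr (fun u hu => ?_) rfl
      have hut : u = t := le_antisymm (ht ▸ le_top (a := u)) hu
      rw [hut]
    · refine (continuousWithinAt_const (b := FunctionalIto.approx P X t)).congr_of_eventuallyEq ?_
        rfl
      filter_upwards [self_mem_nhdsWithin,
        mem_nhdsWithin_of_mem_nhds (Iio_mem_nhds (hP.lt_succPt ht))] with u hu hu'
      rw [FunctionalIto.approx, FunctionalIto.approx, succPt_eq hu hu']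
  left t := by
    rcases eq_or_lt_of_le (bot_le (a := t)) with ht | ht
    · refine ⟨X t, h t, ?_⟩
      have : 𝓝[<] t = ⊥ := by
        rw [← ht, Set.Iio_bot, nhdsWithin_empty]
      rw [this]; exact tendsto_bot
    · refine ⟨X (succPt P (prevPt P t)), h _, tendsto_const_nhds.congr' ?_⟩
      filter_upwards [self_mem_nhdsWithin,
        mem_nhdsWithin_of_mem_nhds (Ioi_mem_nhds (hP.prevPt_lt ht))] with u hu hu'
      rw [FunctionalIto.approx, succPt_eq (le_of_lt hu')
        (lt_of_lt_of_le hu (hP.le_succPt_prevPt t))]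

end

/-! ### Weighted sums along left-continuous integrands -/

section LeftUniformTendsto

variable {T : ℝ}

/-- The functions `f n` on the partition points converge to `f'`, uniformly from the left near every
time outside of `N`. This is the mode of convergence that left-continuous functionals provide along
the approximating paths. -/
def LeftUniformTendsto (P : PartitionSeq T) (N : Set (Time T)) (f : ℕ → Time T → ℝ)
    (f' : Time T → ℝ) : Prop :=
  ∀ t ∉ N, ∀ ε > (0 : ℝ), ∃ δ > (0 : ℝ), ∃ n₀, ∀ n ≥ n₀, ∀ r ∈ P.pts n, r ≤ t → (t : ℝ) - r < δ →
    |f n r - f' t| < ε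

namespace LeftUniformTendsto

variable {P : PartitionSeq T} {N : Set (Time T)} {f : ℕ → Time T → ℝ} {f' : Time T → ℝ}

theorem cutoff (h : LeftUniformTendsto P N f f') (t : Time T) :
    LeftUniformTendsto P N (fun n r => if r ≤ t then f n r else 0)
      (fun u => if u ≤ t then f' u else 0) := by
  intro u hu ε hε
  by_cases hut : u ≤ t
  · obtain ⟨δ, hδ, n₀, hn₀⟩ := h u hu ε hε
    refine ⟨δ, hδ, n₀, fun n hn r hr hru hd => ?_⟩
    simp only [hut, hru.trans hut, if_true]
    exact hn₀ n hn r hr hru hd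
  · refine ⟨u - t, sub_pos.2 (not_le.1 hut), 0, fun n _ r _ _ hd => ?_⟩
    have hrt : ¬ r ≤ t := fun hrt => by
      have : (r : ℝ) ≤ t := hrt
      linarith
    simp [hut, hrt, hε]

variable [Fact (0 ≤ T)]

theorem tendsto_prevPt (h : LeftUniformTendsto P N f f') {t : Time T} (ht : t ∉ N) :
    Tendsto (fun n => f n (prevPt (P.pts n) t)) atTop (𝓝 (f' t)) := by
  refine Metric.tendsto_nhds.2 fun ε hε => ?_
  obtain ⟨δ, hδ, n₀, hn₀⟩ := h t ht ε hε
  filter_upwards [P.eventually_mesh_lt hδ, eventually_ge_atTop n₀] with n hn hnn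
  exact hn₀ n hnn _ ((P.isPartition n).prevPt_mem t) (prevPt_le _ t) (hn t).2

theorem bddMeasOn (h : LeftUniformTendsto P N f f') {J : Set (Time T)} (hJ : MeasurableSet J)
    (hJN : ∀ u ∈ J, u ∉ N) (hJbot : ∀ u ∈ J, ⊥ < u) {C : ℝ}
    (hC : ∀ᶠ n in atTop, ∀ r ∈ P.pts n, |f n r| ≤ C) : BddMeasOn f' J := by
  refine ⟨?_, C, fun u hu => le_of_tendsto (h.tendsto_prevPt (hJN u hu)).abs
    (hC.mono fun n hn => hn _ ((P.isPartition n).prevPt_mem u))⟩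
  refine measurable_of_tendsto_metrizable (f := fun n => J.indicator fun u =>
    f n (prevPt (P.pts n) u)) (fun n => ?_) (tendsto_pi_nhds.2 fun u => ?_)
  · have := ((P.isPartition n).measurable_step (f n)).indicator hJ
    rwa [Set.indicator_indicator, Set.inter_eq_left.2 (show J ⊆ Set.Ioi ⊥ from hJbot)] at this
  · by_cases hu : u ∈ J
    · simpa [hu] using h.tendsto_prevPt (hJN u hu)
    · simp [hu]

theorem tendsto_lsIntegral_step (h : LeftUniformTendsto P N f f') (hN : N.Countable) {C : ℝ}
    (hC : ∀ᶠ n in atTop, ∀ r ∈ P.pts n, |f n r| ≤ C) {g : Time T → ℝ} (hg : IsContBV g) :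
    Tendsto (fun n => lsIntegral (fun u => f n (prevPt (P.pts n) u)) g (Set.Ioi ⊥)) atTop
      (𝓝 (lsIntegral f' g (Set.Ioi ⊥))) :=
  tendsto_lsIntegral hg measurableSet_Ioi hN
    (Eventually.of_forall fun n => (P.isPartition n).measurable_step (f n))
    (hC.mono fun n hn _ _ => hn _ ((P.isPartition n).prevPt_mem _))
    fun _ _ huN => h.tendsto_prevPt huN

theorem tendsto_sum_stieltjes (h : LeftUniformTendsto P N f f') (hN : N.Countable) {C : ℝ}
    (hC : ∀ᶠ n in atTop, ∀ r ∈ P.pts n, |f n r| ≤ C) {g : Time T → ℝ} (hg : IsContBV g) :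
    Tendsto (fun n => ∑ r ∈ P.pts n, f n r * (g (succPt (P.pts n) r) - g r)) atTop
      (𝓝 (lsIntegral f' g (Set.Ioi ⊥))) := by
  simp only [← fun n => (P.isPartition n).lsIntegral_step (f n) hg]
  exact h.tendsto_lsIntegral_step hN hC hg

end LeftUniformTendsto

end LeftUniformTendsto

section Weights

theorem tendsto_of_tendsto_of_eventually_dist_lt {V : Type*} [PseudoMetricSpace V] {a : ℕ → V}
    {c : ℕ → ℕ → V} {b : ℕ → V} {l : V} (hc : ∀ k, Tendsto (c k) atTop (𝓝 (b k)))
    (hb : Tendsto b atTop (𝓝 l))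
    (h : ∀ ε > (0 : ℝ), ∀ᶠ k in atTop, ∀ᶠ n in atTop, dist (a n) (c k n) < ε) :
    Tendsto a atTop (𝓝 l) := by
  refine Metric.tendsto_nhds.2 fun ε hε => ?_
  obtain ⟨k, hk, hbk⟩ := ((h (ε / 3) (by positivity)).and
    (Metric.tendsto_nhds.1 hb (ε / 3) (by positivity))).exists
  filter_upwards [hk, Metric.tendsto_nhds.1 (hc k) (ε / 3) (by positivity)] with n hn hcn
  linarith [dist_triangle4 (a n) (c k n) (b k) l]

variable {T : ℝ}

theorem countable_setOf_forall_lt_imp_le_sub {N : Set (Time T)} (hN : N.Countable)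
    {δ : Time T → ℝ} (hδ : ∀ t ∉ N, 0 < δ t) :
    {u : Time T | ∀ t ∉ N, u < t → δ t ≤ (t : ℝ) - u}.Countable := by
  set B := {u : Time T | ∀ t ∉ N, u < t → δ t ≤ (t : ℝ) - u}
  refine (hN.union (countable_setOfPred_isolated_left_within (s := B))).mono fun t ht => ?_
  refine or_iff_not_imp_left.2 fun htN => ⟨ht, ?_⟩
  have hnear : {u : Time T | (t : ℝ) - u < δ t} ∈ 𝓝 t :=
    (isOpen_lt (continuous_const.sub continuous_subtype_val) continuous_const).mem_nhds
      (by simpa using hδ t htN)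
  refine empty_mem_iff_bot.1 (mem_of_superset
    (inter_mem self_mem_nhdsWithin (mem_nhdsWithin_of_mem_nhds hnear)) ?_)
  rintro u ⟨⟨huB, hut⟩, hu⟩
  exact absurd (huB t htN hut) (not_le.2 hu)

variable [Fact (0 ≤ T)] {P : PartitionSeq T} {w : ℕ → Time T → ℝ} {q : Time T → ℝ}

theorem IsPartition.sum_step_mul {Q P : Finset (Time T)} (hQ : IsPartition Q)
    (φ w : Time T → ℝ) :
    ∑ r ∈ P, φ (prevPt Q r) * w r = φ ⊥ * (∑ r ∈ P with r ≤ ⊥, w r)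
      + ∑ s ∈ Q, φ s * ((∑ r ∈ P with r ≤ succPt Q s, w r) - ∑ r ∈ P with r ≤ s, w r) := by
  have hφ : ∀ r, φ (prevPt Q r) = (if r ≤ ⊥ then φ ⊥ else 0)
      + ∑ s ∈ Q, (Set.Ioc s (succPt Q s)).indicator (fun _ => φ s) r := by
    intro r
    rw [← hQ.indicator_piecewise (fun r _ => φ r) r]
    rcases eq_bot_or_bot_lt r with rfl | hr
    · simp [prevPt_bot]
    · simp [hr, hr.ne']
  have hw : ∀ s, (∑ r ∈ P with r ≤ succPt Q s, w r) - ∑ r ∈ P with r ≤ s, w r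
      = ∑ r ∈ P, (Set.Ioc s (succPt Q s)).indicator w r := by
    intro s
    rw [Finset.sum_filter, Finset.sum_filter, ← Finset.sum_sub_distrib]
    refine Finset.sum_congr rfl fun r _ => ?_
    by_cases hrs : r ≤ s
    · simp [hrs, hrs.trans (le_succPt Q s), hrs.not_gt]
    · by_cases hrs' : r ≤ succPt Q s <;> simp [hrs, hrs', not_le.1 hrs]
  simp only [hw, Finset.mul_sum, hφ, add_mul, Finset.sum_mul, Finset.sum_add_distrib]
  rw [Finset.sum_comm, Finset.sum_filter]
  congr 1
  · exact Finset.sum_congr rfl fun r _ => by split_ifs <;> simp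
  · refine Finset.sum_congr rfl fun s _ => Finset.sum_congr rfl fun r _ => ?_
    by_cases hr : r ∈ Set.Ioc s (succPt Q s)
    · simp only [Set.indicator_of_mem hr]
    · simp only [Set.indicator_of_notMem hr, zero_mul, mul_zero]

theorem tendsto_sum_step
    (hq : ∀ u, Tendsto (fun n => ∑ r ∈ P.pts n with r ≤ u, w n r) atTop (𝓝 (q u)))
    (hq0 : q ⊥ = 0) (hqc : IsContBV q) (k : ℕ) (φ : Time T → ℝ) :
    Tendsto (fun n => ∑ r ∈ P.pts n, φ (prevPt (P.pts k) r) * w n r) atTop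
      (𝓝 (lsIntegral (fun u => φ (prevPt (P.pts k) u)) q (Set.Ioi ⊥))) := by
  simp only [(P.isPartition k).sum_step_mul, (P.isPartition k).lsIntegral_step φ hqc]
  have := ((hq ⊥).const_mul (φ ⊥)).add (tendsto_finsetSum (P.pts k) fun s _ =>
    ((hq (succPt (P.pts k) s)).sub (hq s)).const_mul (φ s))
  rwa [hq0, mul_zero, zero_add] at this

namespace LeftUniformTendsto

variable {N : Set (Time T)} {f : ℕ → Time T → ℝ} {f' : Time T → ℝ}

theorem exists_countable_eventually_abs_sub_le (h : LeftUniformTendsto P N f f')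
    (hN : N.Countable) {ε : ℝ} (hε : 0 < ε) :
    ∃ M : Set (Time T), M.Countable ∧ ∀ u ∉ M, ∀ᶠ k in atTop, ∀ n ≥ k, ∀ r ∈ P.pts n,
      prevPt (P.pts k) r = prevPt (P.pts k) u → |f n r - f k (prevPt (P.pts k) u)| ≤ ε := by
  choose! δ hδ n₀ hn₀ using fun t (ht : t ∉ N) => h t ht (ε / 2) (half_pos hε)
  refine ⟨_, countable_setOf_forall_lt_imp_le_sub hN hδ, fun u hu => ?_⟩
  simp only [Set.mem_ofPred_eq, not_forall, not_le] at hu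
  obtain ⟨t, htN, hut, htu⟩ := hu
  -- For large `k` the whole interval of the `k`-th partition around `u` lies in `(t - δ t, t]`.
  filter_upwards [P.eventually_mesh_lt (sub_pos.2 htu), eventually_ge_atTop (n₀ t),
    (P.tendsto_succPt u).eventually (gt_mem_nhds hut)] with k hmesh hk hsucc n hnk r hr hru
  have hPk := P.isPartition k
  have hpu := prevPt_le (P.pts k) u
  have hpr : prevPt (P.pts k) u ≤ r := hru ▸ prevPt_le _ r
  have hpt : (t : ℝ) - prevPt (P.pts k) u < δ t := by linarith [(hmesh u).2]
  have hsucc_le : succPt (P.pts k) (prevPt (P.pts k) u) ≤ succPt (P.pts k) u := by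
    rcases lt_or_ge u (succPt (P.pts k) (prevPt (P.pts k) u)) with hlt | hge
    · rw [succPt_eq hpu hlt]
    · exact hge.trans (le_succPt _ _)
  have hrt : r ≤ t := (hPk.le_succPt_prevPt r).trans ((hru ▸ hsucc_le).trans hsucc.le)
  have hfn := hn₀ t htN n (hk.trans hnk) r hr hrt
    (by linarith [(Subtype.coe_le_coe.2 hpr : (prevPt (P.pts k) u : ℝ) ≤ r)])
  have hfk := hn₀ t htN k hk _ (hPk.prevPt_mem u) (hpu.trans hut.le) hpt
  have htri := abs_sub_le (f n r) (f' t) (f k (prevPt (P.pts k) u))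
  rw [abs_sub_comm (f' t)] at htri
  linarith

/-- The set of points `s` of the `k`-th partition such that `f` oscillates by more than `ε` over
the points following `s` in finer partitions. -/
def oscillationSet (P : PartitionSeq T) (f : ℕ → Time T → ℝ) (ε : ℝ) (k : ℕ) : Set (Time T) :=
  {s | ∃ n ≥ k, ∃ r ∈ P.pts n, prevPt (P.pts k) r = s ∧ ε < |f n r - f k s|}

theorem tendsto_lsIntegral_oscillationSet (h : LeftUniformTendsto P N f f') (hN : N.Countable)
    {ε : ℝ} (hε : 0 < ε) (hqc : IsContBV q) :
    Tendsto (fun k => lsIntegral (fun u => (oscillationSet P f ε k).indicator (fun _ => (1 : ℝ))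
      (prevPt (P.pts k) u)) q (Set.Ioi ⊥)) atTop (𝓝 0) := by
  obtain ⟨M, hM, hosc⟩ := h.exists_countable_eventually_abs_sub_le hN hε
  have hzero : lsIntegral (fun _ => 0) q (Set.Ioi ⊥) = 0 := VectorMeasure.integral_zero
  refine Tendsto.mono_right (y := 𝓝 (lsIntegral (fun _ => 0) q (Set.Ioi ⊥))) ?_ (by rw [hzero])
  refine tendsto_lsIntegral hqc measurableSet_Ioi hM (C := 1)
    (Eventually.of_forall fun k => (P.isPartition k).measurable_step _)
    (Eventually.of_forall fun k u _ => ?_) fun u _ hu => tendsto_const_nhds.congr' ?_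
  · by_cases hs : prevPt (P.pts k) u ∈ oscillationSet P f ε k <;> simp [hs]
  · filter_upwards [hosc u hu] with k hk
    refine (Set.indicator_of_notMem ?_ _).symm
    rintro ⟨n, hn, r, hr, hru, hlt⟩
    exact hlt.not_ge (hk n hn r hr hru)

theorem abs_sub_le_oscillation {k n₀ : ℕ} {C ε : ℝ} (hC : ∀ n ≥ n₀, ∀ r ∈ P.pts n, |f n r| ≤ C)
    (hk : n₀ ≤ k) {n : ℕ} (hn : k ≤ n) {r : Time T} (hr : r ∈ P.pts n) (hε : 0 ≤ ε) :
    |f n r - f k (prevPt (P.pts k) r)| ≤ ε + 2 * C *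
      (oscillationSet P f ε k).indicator (fun _ => (1 : ℝ)) (prevPt (P.pts k) r) := by
  by_cases hs : prevPt (P.pts k) r ∈ oscillationSet P f ε k
  · have hfn := hC n (hk.trans hn) r hr
    have hfk := hC k hk _ ((P.isPartition k).prevPt_mem r)
    rw [Set.indicator_of_mem hs]
    linarith [abs_sub (f n r) (f k (prevPt (P.pts k) r))]
  · rw [Set.indicator_of_notMem hs, mul_zero, add_zero]
    exact not_lt.1 fun hlt => hs ⟨n, hn, r, hr, rfl, hlt⟩

/-- The integrand is replaced by its values on a coarser partition; this costs little because the
oscillation is small off a set of small mass. -/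
theorem tendsto_sum_weights (h : LeftUniformTendsto P N f f') (hN : N.Countable) {C : ℝ}
    (hC : ∀ᶠ n in atTop, ∀ r ∈ P.pts n, |f n r| ≤ C) (hw : ∀ n r, 0 ≤ w n r)
    (hq : ∀ u, Tendsto (fun n => ∑ r ∈ P.pts n with r ≤ u, w n r) atTop (𝓝 (q u)))
    (hq0 : q ⊥ = 0) (hqc : IsContBV q) :
    Tendsto (fun n => ∑ r ∈ P.pts n, f n r * w n r) atTop
      (𝓝 (lsIntegral f' q (Set.Ioi ⊥))) := by
  refine tendsto_of_tendsto_of_eventually_dist_lt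
    (fun k => tendsto_sum_step hq hq0 hqc k (f k)) (h.tendsto_lsIntegral_step hN hC hqc)
    fun ε₀ hε₀ => ?_
  have hmass : Tendsto (fun n => ∑ r ∈ P.pts n, w n r) atTop (𝓝 (q ⊤)) := by
    simpa only [le_top, Finset.filter_true] using hq ⊤
  have hq_top : 0 ≤ q ⊤ := ge_of_tendsto' hmass fun n => Finset.sum_nonneg fun r _ => hw n r
  set ε := ε₀ / (2 * (q ⊤ + 1))
  have hε : 0 < ε := by positivity
  have hεq : ε * q ⊤ < ε₀ / 2 := by
    rw [div_mul_eq_mul_div, div_lt_div_iff₀ (by positivity) (by norm_num)]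
    nlinarith
  let b := fun k => (oscillationSet P f ε k).indicator fun _ => (1 : ℝ)
  have hb : Tendsto (fun k => 2 * C * lsIntegral (fun u => b k (prevPt (P.pts k) u)) q
      (Set.Ioi ⊥)) atTop (𝓝 0) := by
    simpa only [mul_zero] using (h.tendsto_lsIntegral_oscillationSet hN hε hqc).const_mul (2 * C)
  obtain ⟨n₀, hn₀⟩ := eventually_atTop.1 hC
  filter_upwards [hb.eventually (gt_mem_nhds (half_pos hε₀)), eventually_ge_atTop n₀] with k hk hkn
  have hlim := (hmass.const_mul ε).add ((tendsto_sum_step hq hq0 hqc k (b k)).const_mul (2 * C))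
  filter_upwards [hlim.eventually (gt_mem_nhds (show _ < ε₀ by linarith)),
    eventually_ge_atTop k] with n hn hnk
  refine lt_of_le_of_lt ?_ hn
  rw [Real.dist_eq, ← Finset.sum_sub_distrib, Finset.mul_sum, Finset.mul_sum,
    ← Finset.sum_add_distrib]
  refine (Finset.abs_sum_le_sum_abs _ _).trans (Finset.sum_le_sum fun r hr => ?_)
  rw [← sub_mul, abs_mul, abs_of_nonneg (hw n r), ← mul_assoc, ← add_mul]
  exact mul_le_mul_of_nonneg_right (abs_sub_le_oscillation hn₀ hkn hnk hr hε.le) (hw n r)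

end LeftUniformTendsto

end Weights

/-! ### Quadratic variation -/

section

variable {T : ℝ} {d : ℕ}

theorem continuous_coord {X : PathFn T d} (hX : Continuous X) (i : Fin d) :
    Continuous fun t => X t i :=
  (EuclideanSpace.proj (𝕜 := ℝ) i).continuous.comp hX

theorem HasCovariation.exists_polarization {P : PartitionSeq T} {X : PathFn T d}
    {Q : Fin d → Fin d → Time T → ℝ} (h : HasCovariation P X Q) (hX : Continuous X) (i j : Fin d) :
    ∃ (x q : Fin 3 → Time T → ℝ), x = ![fun t => X t i + X t j, fun t => X t i, fun t => X t j] ∧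
      (∀ k, Continuous (x k)) ∧ (∀ k, HasQV P (x k) (q k)) ∧
      ∀ t, Q i j t = ∑ k, ![1 / 2, -1 / 2, -1 / 2] k * q k t := by
  obtain ⟨q₂, q₁, h₂, h₁, hQ⟩ := h
  have hXi := continuous_coord hX i
  have hXj := continuous_coord hX j
  refine ⟨_, ![q₂ i j, q₁ i, q₁ j], rfl, fun k => ?_, fun k => ?_, fun t => ?_⟩
  · fin_cases k
    exacts [hXi.add hXj, hXi, hXj]
  · fin_cases k
    exacts [h₂ i j, h₁ i, h₁ j]
  · rw [hQ, Fin.sum_univ_three]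
    simp only [Matrix.cons_val]
    ring

variable [Fact (0 ≤ T)]

theorem IsPartition.sum_telescope {P : Finset (Time T)} (hP : IsPartition P) {s t : Time T}
    (hs : s ∈ P) (hst : s ≤ t) (a : Time T → ℝ) :
    ∑ r ∈ P with s ≤ r ∧ r ≤ t, (a (succPt P r) - a r) = a (succPt P t) - a s := by
  induction hn : (P.filter fun r => s ≤ r ∧ r ≤ t).card
    using Nat.strong_induction_on generalizing s with
  | _ n ih =>
  by_cases h : ∃ r ∈ P, s < r ∧ r ≤ t
  · obtain ⟨r, hr, hsr, hrt⟩ := h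
    obtain ⟨hsP, hlt⟩ := succPt_mem_and_lt hr hsr
    have hsplit : (P.filter fun r => s ≤ r ∧ r ≤ t)
        = insert s (P.filter fun r => succPt P s ≤ r ∧ r ≤ t) := by
      ext q
      simp only [Finset.mem_filter, Finset.mem_insert]
      constructor
      · rintro ⟨hq, hsq, hqt⟩
        exact hsq.eq_or_lt.imp Eq.symm fun hsq => ⟨hq, succPt_le hq hsq, hqt⟩
      · rintro (rfl | ⟨hq, hsq, hqt⟩)
        exacts [⟨hs, le_rfl, hst⟩, ⟨hq, hlt.le.trans hsq, hqt⟩]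
    have hnot : s ∉ (P.filter fun r => succPt P s ≤ r ∧ r ≤ t) := by simp [hlt]
    rw [hsplit, Finset.sum_insert hnot, ih _ ?_ hsP ((succPt_le hr hsr).trans hrt) rfl]
    · ring
    · rw [← hn, hsplit, Finset.card_insert_of_notMem hnot]
      exact Nat.lt_succ_self _
  · push Not at h
    have hsingle : (P.filter fun r => s ≤ r ∧ r ≤ t) = {s} := by
      ext q
      simp only [Finset.mem_filter, Finset.mem_singleton]
      constructor
      · rintro ⟨hq, hsq, hqt⟩
        exact hsq.eq_or_lt.elim Eq.symm fun hsq => absurd hqt (h q hq hsq).not_ge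
      · rintro rfl
        exact ⟨hs, le_rfl, hst⟩
    rw [hsingle, Finset.sum_singleton]
    rcases hst.eq_or_lt with rfl | hst'
    · rfl
    · rw [succPt_eq hst (h _ (hP.succPt_mem s) (hP.lt_succPt (hst'.trans_le le_top)))]

section QuadraticVariation

variable {P : PartitionSeq T}

namespace HasQV

variable {x q : Time T → ℝ}

theorem bot (h : HasQV P x q) : q ⊥ = 0 :=
  h.2.1 ⊥ rfl

theorem tendsto_sum (h : HasQV P x q) (hx : Continuous x) (u : Time T) :
    Tendsto (fun n => ∑ r ∈ P.pts n with r ≤ u, (x (succPt (P.pts n) r) - x r) ^ 2) atTop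
      (𝓝 (q u)) := by
  rcases eq_bot_or_bot_lt u with rfl | hu
  · have hsingle : ∀ n, (P.pts n).filter (· ≤ ⊥) = {⊥} := fun n => by
      ext r
      simpa using fun hr : r = ⊥ => hr ▸ (P.isPartition n).bot_mem
    simp only [hsingle, Finset.sum_singleton, h.bot]
    simpa using (((hx.tendsto ⊥).comp (P.tendsto_succPt ⊥)).sub_const (x ⊥)).pow 2
  · exact h.1 u hu

theorem isContBV (h : HasQV P x q) (hx : Continuous x) : IsContBV q := by
  refine .of_monotone (fun a b hab => ?_) h.2.2
  refine le_of_tendsto_of_tendsto' (h.tendsto_sum hx a) (h.tendsto_sum hx b) fun n => ?_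
  exact Finset.sum_le_sum_of_subset_of_nonneg
    (Finset.monotone_filter_right _ fun _ _ hr => hr.trans hab) fun _ _ _ => sq_nonneg _

theorem zero_of_isContBV (hx : IsContBV x) : HasQV P x fun _ => 0 := by
  refine ⟨fun t _ => ?_, fun _ _ => rfl, continuous_const⟩
  have huc := Metric.uniformContinuous_iff.1 (CompactSpace.uniformContinuous_of_continuous hx.cont)
  have hsmall : ∀ ε > 0, ∀ᶠ n in atTop, ∀ r ∈ P.pts n, |x (succPt (P.pts n) r) - x r| < ε := by
    intro ε hε
    obtain ⟨δ, hδ, hδε⟩ := huc ε hε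
    filter_upwards [P.eventually_mesh_lt hδ] with n hn r _
    refine hδε ?_
    rw [Subtype.dist_eq, Real.dist_eq,
      abs_of_nonneg (sub_nonneg.2 (Subtype.coe_le_coe.2 (le_succPt _ r)))]
    exact (hn r).1
  have hlim : LeftUniformTendsto P ∅ (fun n r => x (succPt (P.pts n) r) - x r) fun _ => 0 := by
    intro t _ ε hε
    obtain ⟨n₀, hn₀⟩ := eventually_atTop.1 (hsmall ε hε)
    exact ⟨1, one_pos, n₀, fun n hn r hr _ _ => by simpa using hn₀ n hn r hr⟩
  have hsum := hlim.tendsto_sum_stieltjes Set.countable_empty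
    ((hsmall 1 one_pos).mono fun n hn r hr => (hn r hr).le) hx
  rw [show lsIntegral (fun _ => 0) x (Set.Ioi ⊥) = 0 from VectorMeasure.integral_zero] at hsum
  refine squeeze_zero (fun n => Finset.sum_nonneg fun _ _ => sq_nonneg _) (fun n => ?_) hsum
  simp only [sq]
  exact Finset.sum_le_sum_of_subset_of_nonneg (Finset.filter_subset _ _)
    fun _ _ _ => mul_self_nonneg _

end HasQV

namespace HasCovariation

variable {X : PathFn T d} {Q : Fin d → Fin d → Time T → ℝ}

theorem isContBV (h : HasCovariation P X Q) (hX : Continuous X) (i j : Fin d) :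
    IsContBV (Q i j) := by
  obtain ⟨x, q, -, hx, hq, hQ⟩ := h.exists_polarization hX i j
  exact .of_eq_sum_mul (fun k => (hq k).isContBV (hx k)) hQ

theorem tendsto_sum (h : HasCovariation P X Q) (hX : Continuous X) {N : Set (Time T)}
    (hN : N.Countable) {f : ℕ → Time T → ℝ} {f' : Time T → ℝ} (hf : LeftUniformTendsto P N f f')
    {C : ℝ} (hC : ∀ᶠ n in atTop, ∀ r ∈ P.pts n, |f n r| ≤ C) (hf' : BddMeasOn f' (Set.Ioi ⊥))
    (i j : Fin d) :
    Tendsto (fun n => ∑ r ∈ P.pts n, f n r *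
      ((X (succPt (P.pts n) r) - X r) i * (X (succPt (P.pts n) r) - X r) j)) atTop
      (𝓝 (lsIntegral f' (Q i j) (Set.Ioi ⊥))) := by
  obtain ⟨x, q, hxX, hx, hq, hQ⟩ := h.exists_polarization hX i j
  have hqc := fun k => (hq k).isContBV (hx k)
  rw [lsIntegral_of_eq_sum_mul hqc hQ measurableSet_Ioi hf']
  refine (tendsto_finsetSum _ fun k _ => (hf.tendsto_sum_weights hN hC (fun _ _ => sq_nonneg _)
    ((hq k).tendsto_sum (hx k)) (hq k).bot (hqc k)).const_mul _).congr fun n => ?_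
  simp only [Fin.sum_univ_three, hxX, Matrix.cons_val, PiLp.sub_apply, Finset.mul_sum,
    ← Finset.sum_add_distrib]
  exact Finset.sum_congr rfl fun r _ => by ring

theorem zero_of_isContBV (hX : ∀ i, IsContBV fun t => X t i) :
    HasCovariation P X fun _ _ _ => 0 :=
  ⟨fun _ _ _ => 0, fun _ _ => 0, fun i j => .zero_of_isContBV ((hX i).add (hX j)),
    fun i => .zero_of_isContBV (hX i), fun _ _ _ => by simp⟩

end HasCovariation

end QuadraticVariation

end

/-! ### Vertical derivatives -/

section

variable {T : ℝ} {d m : ℕ} {U : Set (E d)} {S : Set (E m)}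

theorem NonAnticipative.stopped_right {F : Functional T d m} (hF : NonAnticipative U S F)
    {t : Time T} {X : PathFn T d} {A : PathFn T m} (hX : IsCadlag U X) (hA : IsCBV S A) :
    F t X (stopped A t) = F t X A := by
  rw [hF t X _ hX (hA.stopped t), stopped_stopped_self, ← hF t X A hX hA]

theorem NonAnticipative.congr {F : Functional T d m} (hF : NonAnticipative U S F)
    {t : Time T} {X Y : PathFn T d} {A : PathFn T m} (hX : IsCadlag U X) (hY : IsCadlag U Y)
    (hA : IsCBV S A) (h : stopped X t = stopped Y t) : F t X A = F t Y A := by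
  rw [hF t X A hX hA, hF t Y A hY hA, h]

theorem NonAnticipative.stopped_left {F : Functional T d m} (hF : NonAnticipative U S F)
    {t : Time T} {X : PathFn T d} {A : PathFn T m} (hX : IsCadlag U X) (hA : IsCBV S A) :
    F t (stopped X t) A = F t X A :=
  hF.congr (hX.stopped t) hX hA (stopped_stopped_self X t)

theorem vgrad_stopped_right (F : Functional T d m) (t : Time T) (X : PathFn T d)
    (A : PathFn T m) : vgrad F t X (stopped A t) = vgrad F t X A := by
  simp only [vgrad, stopped_stopped_self]

theorem vpartial_stopped_right (i : Fin d) (F : Functional T d m) (t : Time T) (X : PathFn T d)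
    (A : PathFn T m) : vpartial i F t X (stopped A t) = vpartial i F t X A := by
  simp only [vpartial, vgrad_stopped_right]

theorem inner_eq_sum (x y : E d) : inner ℝ x y = ∑ i, x i * y i := by
  simp [PiLp.inner_apply, mul_comm]

theorem NonAnticipative.vpartial (hU : IsOpen U) {F : Functional T d m}
    (hF : NonAnticipative U S F) (i : Fin d) : NonAnticipative U S (vpartial i F) := by
  intro t X A hX hA
  rw [vpartial_stopped_right]
  simp only [FunctionalIto.vpartial, vgrad]
  refine congrArg (fun g : E d => g i) (Filter.EventuallyEq.gradient_eq ?_)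
  filter_upwards [hX.eventually_bump hU t, (hX.stopped t).eventually_bump hU t] with v hv hv'
  refine hF.congr hv hv' (hA.stopped t) ?_
  rw [stopped_bump, stopped_bump, stopped_stopped_self]

theorem VerticallyDifferentiable.hasDerivAt {F : Functional T d m}
    (hF : VerticallyDifferentiable U S F) {t : Time T} {X : PathFn T d} {A : PathFn T m}
    (hA : IsCBV S A) (v : E d) (θ : ℝ) (hX : IsCadlag U (bump X t (θ • v))) :
    HasDerivAt (fun θ : ℝ => F t (bump X t (θ • v)) (stopped A t))
      (∑ i, vpartial i F t (bump X t (θ • v)) A * v i) θ := by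
  have hgrad : HasFDerivAt (fun w : E d => F t (bump (bump X t (θ • v)) t w) (stopped A t))
      (InnerProductSpace.toDual ℝ (E d) (vgrad F t (bump X t (θ • v)) A)) ((θ - θ) • v) := by
    rw [sub_self, zero_smul]
    exact (hF t _ A hX hA).hasGradientAt.hasFDerivAt
  have hlin : HasDerivAt (fun x : ℝ => (x - θ) • v) v θ := by
    simpa using ((hasDerivAt_id θ).sub_const θ).smul_const v
  have hcomp := hgrad.comp_hasDerivAt θ hlin
  rw [InnerProductSpace.toDual_apply_apply, inner_eq_sum] at hcomp
  refine hcomp.congr_of_eventuallyEq (Eventually.of_forall fun x => ?_)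
  simp only [Function.comp, bump_bump, ← add_smul, add_sub_cancel]

theorem exists_second_order_mean_value {φ φ' φ'' : ℝ → ℝ}
    (h : ∀ x ∈ Set.Icc (0 : ℝ) 1, HasDerivAt φ (φ' x) x)
    (h' : ∀ x ∈ Set.Icc (0 : ℝ) 1, HasDerivAt φ' (φ'' x) x) :
    ∃ θ ∈ Set.Ioo (0 : ℝ) 1, φ 1 - φ 0 = φ' 0 + (1 / 2) * φ'' θ := by
  set c := φ 1 - φ 0 - φ' 0 with hc
  have d1 : ∀ x ∈ Set.Icc (0 : ℝ) 1, HasDerivAt (fun x => φ x - φ' 0 * x - c * x ^ 2)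
      (φ' x - φ' 0 - c * (2 * x)) x := fun x hx => by
    simpa using ((h x hx).fun_sub ((hasDerivAt_id x).const_mul (φ' 0))).fun_sub
      ((hasDerivAt_pow 2 x).const_mul c)
  obtain ⟨x₁, hx₁, hx₁'⟩ := exists_hasDerivAt_eq_zero (zero_lt_one' ℝ)
    (fun x hx => (d1 x hx).continuousAt.continuousWithinAt)
    (by simp only [hc]; ring) (fun x hx => d1 x (Set.Ioo_subset_Icc_self hx))
  have hsub : ∀ x ∈ Set.Icc (0 : ℝ) x₁, x ∈ Set.Icc (0 : ℝ) 1 := fun x hx =>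
    ⟨hx.1, hx.2.trans hx₁.2.le⟩
  have d2 : ∀ x ∈ Set.Icc (0 : ℝ) x₁, HasDerivAt (fun x => φ' x - φ' 0 - c * (2 * x))
      (φ'' x - c * 2) x := fun x hx => by
    simpa using ((h' x (hsub x hx)).sub_const (φ' 0)).fun_sub
      (((hasDerivAt_id x).const_mul 2).const_mul c)
  obtain ⟨θ, hθ, hθ'⟩ := exists_hasDerivAt_eq_zero hx₁.1
    (fun x hx => (d2 x hx).continuousAt.continuousWithinAt)
    (by rw [hx₁']; ring) (fun x hx => d2 x (Set.Ioo_subset_Icc_self hx))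
  refine ⟨θ, ⟨hθ.1, hθ.2.trans hx₁.2⟩, ?_⟩
  linarith

theorem exists_vertical_taylor {F : Functional T d m} (hF : VerticallyDifferentiable U S F)
    (hF₂ : ∀ j, VerticallyDifferentiable U S (vpartial j F)) {t : Time T} {X : PathFn T d}
    {A : PathFn T m} (hA : IsCBV S A) (v : E d)
    (hX : ∀ θ ∈ Set.Icc (0 : ℝ) 1, IsCadlag U (bump X t (θ • v))) :
    ∃ θ ∈ Set.Ioo (0 : ℝ) 1, F t (bump X t v) (stopped A t) - F t X (stopped A t)
      = inner ℝ (vgrad F t X A) v + (1 / 2) * ∑ i, ∑ j,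
        vpartial i (vpartial j F) t (bump X t (θ • v)) A * (v i * v j) := by
  have d1 : ∀ x ∈ Set.Icc (0 : ℝ) 1, HasDerivAt
      (fun θ : ℝ => F t (bump X t (θ • v)) (stopped A t))
      (∑ i, vpartial i F t (bump X t (x • v)) A * v i) x := fun x hx =>
    hF.hasDerivAt hA v x (hX x hx)
  have d2 : ∀ x ∈ Set.Icc (0 : ℝ) 1, HasDerivAt
      (fun θ : ℝ => ∑ i, vpartial i F t (bump X t (θ • v)) A * v i)
      (∑ j, (∑ i, vpartial i (vpartial j F) t (bump X t (x • v)) A * v i) * v j) x := by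
    intro x hx
    refine HasDerivAt.fun_sum fun j _ => ?_
    have := (hF₂ j).hasDerivAt hA v x (hX x hx)
    simp only [vpartial_stopped_right] at this
    exact this.mul_const (v j)
  obtain ⟨θ, hθ, h⟩ := exists_second_order_mean_value d1 d2
  refine ⟨θ, hθ, ?_⟩
  simp only [one_smul, zero_smul, bump_zero] at h
  rw [h, inner_eq_sum, Finset.sum_comm]
  congr 2
  refine Finset.sum_congr rfl fun j _ => ?_
  rw [Finset.sum_mul]
  exact Finset.sum_congr rfl fun i _ => by ring

/-- The path that equals `Z` before `s₀` and the approximating path stopped before `r` from `s₀`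
on. Starting at `s₀ > 0` allows for paths that are continuous from `s₀` on only. -/
def approxFrom (s₀ : Time T) (P : Finset (Time T)) (Z : PathFn T d) (r : Time T) : PathFn T d :=
  fun u => if u < s₀ then Z u else approxLeft P Z r u

section ApproxFrom

variable {P : Finset (Time T)} {s₀ : Time T} {Z : PathFn T d}

theorem approxFrom_bot [Fact (0 ≤ T)] (P : Finset (Time T)) (Z : PathFn T d) (r : Time T) :
    approxFrom ⊥ P Z r = approxLeft P Z r := by
  ext u : 1
  simp [approxFrom]

theorem IsCadlag.approxLeft [Fact (0 ≤ T)] (hP : IsPartition P) {V : Set (E d)}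
    (hZ : ∀ t, Z t ∈ V) (r : Time T) : IsCadlag V (approxLeft P Z r) :=
  (IsCadlag.approx hP hZ).ite_lt (.const (hZ r)) r

theorem IsCadlag.approxFrom [Fact (0 ≤ T)] (hP : IsPartition P) {V : Set (E d)}
    (hZ : IsCadlag V Z) (r : Time T) : IsCadlag V (approxFrom s₀ P Z r) :=
  hZ.ite_lt (.approxLeft hP hZ.mem r) s₀

theorem approxFrom_succPt {r : Time T} (hr : s₀ ≤ r) :
    approxFrom s₀ P Z (succPt P r) = bump (approxFrom s₀ P Z r) r (Z (succPt P r) - Z r) := by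
  ext u : 1
  simp only [approxFrom, bump, approxLeft, approx]
  by_cases h1 : u < s₀
  · simp [h1, (h1.trans_le hr).not_ge]
  · by_cases h2 : u < r
    · simp [h1, h2, h2.not_ge, h2.trans_le (le_succPt P r)]
    · by_cases h3 : u < succPt P r
      · simp [h1, h2, h3, not_lt.1 h2, succPt_eq (not_lt.1 h2) h3]
      · simp [h1, h2, h3, not_lt.1 h2]

theorem stopped_approxFrom {r : Time T} (hr : s₀ ≤ r) :
    stopped (approxFrom s₀ P Z r) r = approxFrom s₀ P Z r := by
  ext u : 1
  rcases le_total r u with h | h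
  · simp [stopped, approxFrom, approxLeft, h, hr.not_gt, (hr.trans h).not_gt, h.not_gt]
  · simp [stopped, h]

theorem stopped_approxFrom_succPt {r : Time T} (hr : s₀ ≤ r) :
    stopped (approxFrom s₀ P Z (succPt P r)) r = approxFrom s₀ P Z (succPt P r) := by
  rw [approxFrom_succPt hr, stopped_bump, stopped_approxFrom hr]

theorem norm_stopped_sub_approxFrom_le {δ ε : ℝ} (hε : 0 ≤ ε)
    (hω : ∀ u v : Time T, s₀ ≤ u → s₀ ≤ v → |(u : ℝ) - v| < 2 * δ → ‖Z u - Z v‖ ≤ ε)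
    (hmesh : ∀ u, (succPt P u : ℝ) - u < δ) {t r : Time T} (ht : s₀ ≤ t) (hr : s₀ ≤ r)
    (htr : |(t : ℝ) - r| < δ) (u : Time T) :
    ‖stopped Z t u - approxFrom s₀ P Z r u‖ ≤ ε := by
  have hδ : 0 < δ := (abs_nonneg _).trans_lt htr
  have htr' := abs_lt.1 htr
  simp only [stopped, approxFrom, approxLeft, approx]
  by_cases h1 : u < s₀
  · simpa [h1, (h1.trans_le ht).le] using hε
  · have h1' := not_lt.1 h1
    simp only [h1, if_false]
    by_cases h2 : u < r
    · simp only [h2, if_true]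
      have h3 : (u : ℝ) ≤ succPt P u := le_succPt P u
      have h4 := hmesh u
      have h2' : (u : ℝ) < r := h2
      refine hω _ _ (le_min ht h1') (h1'.trans (le_succPt P u)) ?_
      rcases le_total t u with h | h
      · have h' : (t : ℝ) ≤ u := h
        rw [min_eq_left h, abs_lt]
        constructor <;> linarith
      · rw [min_eq_right h, abs_lt]
        constructor <;> linarith
    · simp only [h2, if_false]
      have h2' : (r : ℝ) ≤ u := not_lt.1 h2
      refine hω _ _ (le_min ht h1') hr ?_
      rcases le_total t u with h | h
      · rw [min_eq_left h, abs_lt]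
        constructor <;> linarith
      · have h' : (u : ℝ) ≤ t := h
        rw [min_eq_right h, abs_lt]
        constructor <;> linarith

theorem norm_stopped_sub_stopped_approxFrom_le {δ ε : ℝ} (hδ : 0 < δ) (hε : 0 ≤ ε)
    (hω : ∀ u v : Time T, s₀ ≤ u → s₀ ≤ v → |(u : ℝ) - v| < 2 * δ → ‖Z u - Z v‖ ≤ ε)
    (hmesh : ∀ u, (succPt P u : ℝ) - u < δ) {t r : Time T} (htr : t ≤ r) (u : Time T) :
    ‖stopped Z t u - stopped (approxFrom s₀ P Z r) t u‖ ≤ ε := by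
  simp only [stopped]
  have hv : min t u ≤ r := (min_le_left t u).trans htr
  generalize min t u = v at hv
  simp only [approxFrom, approxLeft, approx]
  by_cases h1 : v < s₀
  · simpa [h1] using hε
  · by_cases h2 : v < r
    · have h3 : (v : ℝ) ≤ succPt P v := le_succPt P v
      have h4 := hmesh v
      simp only [h1, h2, if_true, if_false]
      refine hω _ _ (not_lt.1 h1) ((not_lt.1 h1).trans (le_succPt P v)) ?_
      rw [abs_lt]
      constructor <;> linarith
    · simpa [h1, h2, le_antisymm hv (not_lt.1 h2)] using hε

theorem exists_modulus (hZ : Continuous fun u => Z (max s₀ u)) {ε : ℝ} (hε : 0 < ε) :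
    ∃ δ > 0, ∀ u v : Time T, s₀ ≤ u → s₀ ≤ v → |(u : ℝ) - v| < 2 * δ → ‖Z u - Z v‖ ≤ ε := by
  have huc := CompactSpace.uniformContinuous_of_continuous hZ
  rw [Metric.uniformContinuous_iff] at huc
  obtain ⟨δ, hδ, h⟩ := huc ε hε
  refine ⟨δ / 2, half_pos hδ, fun u v hu hv huv => ?_⟩
  have := h (a := u) (b := v) (by rw [Subtype.dist_eq, Real.dist_eq]; linarith)
  rw [max_eq_right hu, max_eq_right hv, dist_eq_norm] at this
  exact this.le

end ApproxFrom

end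

/-! ### The functional Itô formula -/

section

variable {T : ℝ} {d m : ℕ} {U : Set (E d)} {S : Set (E m)}

section Horizontal

variable {F : Functional T d m} {D : Fin (m + 1) → Functional T d m}
  {X : PathFn T d} {A : PathFn T m}

theorem measurable_indicator_of_Icc {f : Time T → ℝ} {a b : Time T}
    (h : Measurable fun r : Set.Icc a b => f r) : Measurable ((Set.Ioc a b).indicator f) := by
  have hIcc : Measurable ((Set.Icc a b).indicator f) :=
    measurable_of_restrict_of_restrict_compl (s := Set.Icc a b) measurableSet_Icc
      (by convert h using 1; ext x; simp)
      (by convert measurable_const (a := (0 : ℝ)) using 1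
          ext x
          exact Set.indicator_of_notMem x.2 _)
  have := hIcc.indicator (measurableSet_Ioc (a := a) (b := b))
  rwa [Set.indicator_indicator, Set.inter_eq_left.2 Set.Ioc_subset_Icc_self] at this

theorem IsHorizontalDeriv.sub_eq_sum_lsIntegral (hD : IsHorizontalDeriv U S F D)
    (hX : IsCadlag U X) (hA : IsCBV S A) {s t : Time T} (hst : s ≤ t) :
    F t (stopped X s) A - F s (stopped X s) A
      = ∑ i, lsIntegral (fun r => D i r (stopped X s) A) (withTime A i) (Set.Ioc s t) := by
  rcases hst.eq_or_lt with rfl | hlt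
  · simp only [sub_self, Set.Ioc_self, lsIntegral_empty, Finset.sum_const_zero]
  · exact hD.integral_eq s t X A hlt hX hA

theorem IsHorizontalDeriv.bddMeasOn_stopped (hD : IsHorizontalDeriv U S F D)
    (hX : IsCadlag U X) (hA : IsCBV S A) (i : Fin (m + 1)) (s t : Time T) :
    BddMeasOn (fun r => D i r (stopped X s) A) (Set.Ioc s t) := by
  obtain ⟨K, hKU, hK, hXK⟩ := (hX.stopped s).exists_compact
  obtain ⟨C, hC⟩ := hD.boundednessPreserving i A hA K hKU hK
  refine ⟨?_, C, fun r _ => hC r _ hXK⟩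
  rcases lt_or_ge s t with hst | hts
  · exact measurable_indicator_of_Icc (hD.measurable i s t X A hst hX hA)
  · simp only [Set.Ioc_eq_empty hts.not_gt, Set.indicator_empty, measurable_const]

variable [Fact (0 ≤ T)]

theorem IsHorizontalDeriv.tendsto_right (hD : IsHorizontalDeriv U S F D) (hX : IsCadlag U X)
    (hA : IsCBV S A) (t : Time T) :
    Tendsto (fun u => F u (stopped X t) A) (𝓝[≥] t) (𝓝 (F t (stopped X t) A)) := by
  set k : Fin (m + 1) → Time T → ℝ := fun i =>
    (Set.Ioc t ⊤).indicator fun r => D i r (stopped X t) A with hk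
  have hF : ∀ u ≥ t, F u (stopped X t) A = F t (stopped X t) A
      + ∑ i, lsIntegral (k i) (withTime A i) (Set.Iic u) := fun u hu => by
    have hIoc : Set.Iic u ∩ Set.Ioc t ⊤ = Set.Ioc t u := by
      ext r; simp [and_comm]
    simp only [hk, lsIntegral_indicator measurableSet_Iic measurableSet_Ioc, hIoc]
    rw [← hD.sub_eq_sum_lsIntegral hX hA hu, add_sub_cancel]
  have hcont : Continuous fun u => F t (stopped X t) A
      + ∑ i, lsIntegral (k i) (withTime A i) (Set.Iic u) :=
    continuous_const.add <| continuous_finsetSum _ fun i _ => continuous_lsIntegral_Iic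
      (hA.isContBV_withTime i) (hD.bddMeasOn_stopped hX hA i t ⊤).indicator
  have hright : ContinuousWithinAt (fun u => F u (stopped X t) A) (Set.Ici t) t :=
    hcont.continuousWithinAt.congr hF (hF t le_rfl)
  exact hright

end Horizontal

section Ito

variable [Fact (0 ≤ T)] {P : PartitionSeq T} {s₀ : Time T} {Z : PathFn T d} {B : PathFn T m}

/-- The segment `θ ∈ [0,1]` of paths from `approxFrom s₀ P Z r` to `approxFrom s₀ P Z r'`, along
which functionals are Taylor expanded. -/
def approxInterp (s₀ : Time T) (P : Finset (Time T)) (Z : PathFn T d) (r : Time T) (θ : ℝ) :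
    PathFn T d :=
  bump (approxFrom s₀ P Z r) r (θ • (Z (succPt P r) - Z r))

omit [Fact (0 ≤ T)] in
theorem approxInterp_zero (P : Finset (Time T)) (Z : PathFn T d) (r : Time T) :
    approxInterp s₀ P Z r 0 = approxFrom s₀ P Z r := by
  rw [approxInterp, zero_smul, bump_zero]

theorem eventually_norm_increment_le (hZc : Continuous fun u => Z (max s₀ u)) {ε : ℝ}
    (hε : 0 < ε) :
    ∀ᶠ n in atTop, ∀ r, s₀ ≤ r → ∀ θ ∈ Set.Icc (0 : ℝ) 1,
      ‖θ • (Z (succPt (P.pts n) r) - Z r)‖ ≤ ε := by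
  obtain ⟨δ, hδ, hω⟩ := exists_modulus hZc hε
  filter_upwards [P.eventually_mesh_lt hδ] with n hn r hr θ hθ
  have hle : (r : ℝ) ≤ succPt (P.pts n) r := le_succPt _ r
  have hinc : ‖Z (succPt (P.pts n) r) - Z r‖ ≤ ε := by
    refine hω _ _ (hr.trans (le_succPt _ r)) hr ?_
    rw [abs_of_nonneg (by linarith)]
    linarith [(hn r).1]
  rw [norm_smul, Real.norm_eq_abs, abs_of_nonneg hθ.1]
  exact (mul_le_of_le_one_left (norm_nonneg _) hθ.2).trans hinc

theorem exists_compact_approxInterp (hU : IsOpen U) (hZ : IsCadlag U Z)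
    (hZc : Continuous fun u => Z (max s₀ u)) :
    ∃ K ⊆ U, IsCompact K ∧ ∀ᶠ n in atTop, ∀ r, s₀ ≤ r → ∀ θ ∈ Set.Icc (0 : ℝ) 1,
      IsCadlag K (approxInterp s₀ (P.pts n) Z r θ) := by
  obtain ⟨K, hKU, hK, hZK⟩ := hZ.exists_compact
  obtain ⟨δ, hδ, hδU⟩ := hK.exists_cthickening_subset_open hU hKU
  refine ⟨Metric.cthickening δ K, hδU, hK.cthickening, ?_⟩
  filter_upwards [eventually_norm_increment_le (P := P) hZc hδ] with n hn r hr θ hθ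
  exact (IsCadlag.approxFrom (P.isPartition n) hZK r).bump_cthickening r (hn r hr θ hθ)

/-- The values of `Φ` at the partition points from `s₀` on, along the paths `approxInterp` with
parameters `θ`. -/
def sampleFrom (Φ : Functional T d m) (B : PathFn T m) (s₀ : Time T) (P : Finset (Time T))
    (Z : PathFn T d) (θ : Time T → ℝ) (r : Time T) : ℝ :=
  if s₀ ≤ r then Φ r (approxInterp s₀ P Z r (θ r)) B else 0

section Sample

variable {Φ : Functional T d m} {θ : ℕ → Time T → ℝ}

omit [Fact (0 ≤ T)] in
theorem norm_stopped_sub_stopped_approxInterp_le {n : ℕ} {δ ε θ : ℝ} (hε : 0 ≤ ε)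
    (hω : ∀ u v : Time T, s₀ ≤ u → s₀ ≤ v → |(u : ℝ) - v| < 2 * δ → ‖Z u - Z v‖ ≤ ε)
    (hmesh : ∀ u, (succPt (P.pts n) u : ℝ) - u < δ) {t r : Time T} (ht : s₀ ≤ t) (hr : s₀ ≤ r)
    (htr : |(t : ℝ) - r| < δ) (hθ : ‖θ • (Z (succPt (P.pts n) r) - Z r)‖ ≤ ε) (u : Time T) :
    ‖(stopped Z t - stopped (approxInterp s₀ (P.pts n) Z r θ) r) u‖ ≤ ε + ε := by
  rw [approxInterp, stopped_bump, stopped_approxFrom hr]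
  simp only [Pi.sub_apply, bump, ← sub_sub]
  refine (norm_sub_le _ _).trans
    (add_le_add (norm_stopped_sub_approxFrom_le hε hω hmesh ht hr htr u) ?_)
  split_ifs
  · exact hθ
  · rwa [norm_zero]

theorem LeftContinuous.leftUniformTendsto (hΦ : LeftContinuous U S Φ) (hU : IsOpen U)
    (hZ : IsCadlag U Z) (hZc : Continuous fun u => Z (max s₀ u)) (hB : IsCBV S B)
    (hθ : ∀ n r, θ n r ∈ Set.Icc (0 : ℝ) 1) :
    LeftUniformTendsto P {s₀} (fun n => sampleFrom Φ B s₀ (P.pts n) Z (θ n))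
      ((Set.Ioi s₀).indicator fun u => Φ u Z B) := by
  intro t ht ε hε
  rcases lt_or_gt_of_ne (show t ≠ s₀ from ht) with hlt | hgt
  · refine ⟨1, one_pos, 0, fun n _ r _ hrt _ => ?_⟩
    simp [sampleFrom, (hrt.trans_lt hlt).not_ge, hlt.le, hε]
  · have hgt' : (s₀ : ℝ) < t := hgt
    obtain ⟨δ₁, hδ₁, hcont⟩ := hΦ t (s₀.2.1.trans_lt hgt) ε hε Z B hZ hB
    have hδ3 : 0 < δ₁ / 3 := by positivity
    obtain ⟨δ₂, hδ₂, hω⟩ := exists_modulus hZc hδ3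
    obtain ⟨K, hKU, -, hK⟩ := exists_compact_approxInterp (P := P) hU hZ hZc
    obtain ⟨n₀, hn₀⟩ := eventually_atTop.1 ((hK.and
      (eventually_norm_increment_le (P := P) hZc hδ3)).and (P.eventually_mesh_lt hδ₂))
    refine ⟨min (min δ₁ δ₂) (t - s₀), lt_min (lt_min hδ₁ hδ₂) (sub_pos.2 hgt'), n₀,
      fun n hn r _ hrt hd => ?_⟩
    obtain ⟨⟨hK', hinc⟩, hmesh⟩ := hn₀ n hn
    obtain ⟨⟨hd1, hd2⟩, hd3⟩ := (lt_min_iff.1 hd).imp_left lt_min_iff.1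
    have hsr : s₀ ≤ r := Subtype.coe_le_coe.1 (by linarith)
    have hrt' : (r : ℝ) ≤ t := hrt
    beta_reduce
    rw [sampleFrom, if_pos hsr, Set.indicator_of_mem (show t ∈ Set.Ioi s₀ from hgt), abs_sub_comm]
    refine hcont r hrt hd1 _ ((hK' r hsr _ (hθ n r)).mono hKU) ?_
    refine (supNorm_le (C := δ₁ / 3 + δ₁ / 3) (by positivity) fun u => ?_).trans_lt (by linarith)
    exact norm_stopped_sub_stopped_approxInterp_le hδ3.le hω (fun u => (hmesh u).1) hgt.le hsr
      (by rwa [abs_of_nonneg (by linarith)]) (hinc r hsr _ (hθ n r)) u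

theorem BoundednessPreserving.exists_abs_sampleFrom_le (hΦ : BoundednessPreserving U S Φ)
    (hU : IsOpen U) (hZ : IsCadlag U Z) (hZc : Continuous fun u => Z (max s₀ u))
    (hB : IsCBV S B) (hθ : ∀ n r, θ n r ∈ Set.Icc (0 : ℝ) 1) :
    ∃ C, ∀ᶠ n in atTop, ∀ r ∈ P.pts n, |sampleFrom Φ B s₀ (P.pts n) Z (θ n) r| ≤ C := by
  obtain ⟨K, hKU, hKc, hK⟩ := exists_compact_approxInterp (P := P) hU hZ hZc
  obtain ⟨C, hC⟩ := hΦ B hB K hKU hKc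
  refine ⟨max C 0, ?_⟩
  filter_upwards [hK] with n hn r _
  unfold sampleFrom
  split_ifs with hr
  · exact (hC r _ (hn r hr _ (hθ n r))).trans (le_max_left _ _)
  · simp only [abs_zero, le_max_right]

theorem LeftContinuous.bddMeasOn (hΦ : LeftContinuous U S Φ) (hΦb : BoundednessPreserving U S Φ)
    (P : PartitionSeq T) (hU : IsOpen U) (hZ : IsCadlag U Z)
    (hZc : Continuous fun u => Z (max s₀ u)) (hB : IsCBV S B) :
    BddMeasOn (fun u => Φ u Z B) (Set.Ioi s₀) := by
  have hθ : ∀ (_ : ℕ) (_ : Time T), (0 : ℝ) ∈ Set.Icc (0 : ℝ) 1 := fun _ _ => by simp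
  obtain ⟨C, hC⟩ := hΦb.exists_abs_sampleFrom_le (P := P) hU hZ hZc hB hθ
  exact ((hΦ.leftUniformTendsto (P := P) hU hZ hZc hB hθ).bddMeasOn measurableSet_Ioi
    (fun u hu => ne_of_gt hu) (fun u hu => bot_le.trans_lt hu) hC).congr
    fun u hu => Set.indicator_of_mem hu _

omit [Fact (0 ≤ T)] in
theorem sum_filter_le_eq_sum_filter_Icc (P : Finset (Time T)) (t : Time T) {g : Time T → ℝ}
    (hg : ∀ r < s₀, g r = 0) :
    ∑ r ∈ P with r ≤ t, g r = ∑ r ∈ P with s₀ ≤ r ∧ r ≤ t, g r := by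
  rw [Finset.sum_filter, Finset.sum_filter]
  refine Finset.sum_congr rfl fun r _ => ?_
  by_cases h : s₀ ≤ r
  · simp [h]
  · simp [h, hg r (not_le.1 h)]

omit [Fact (0 ≤ T)] in
theorem increment_max_eq_zero {P : Finset (Time T)} (hs₀ : s₀ ∈ P) (Z : PathFn T d) {r : Time T}
    (hr : r < s₀) : Z (max s₀ (succPt P r)) - Z (max s₀ r) = 0 := by
  rw [max_eq_left hr.le, max_eq_left (succPt_le hs₀ hr), sub_self]

omit [Fact (0 ≤ T)] in
theorem increment_max (P : Finset (Time T)) (Z : PathFn T d) {r : Time T} (hr : s₀ ≤ r) :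
    Z (max s₀ (succPt P r)) - Z (max s₀ r) = Z (succPt P r) - Z r := by
  rw [max_eq_right hr, max_eq_right (hr.trans (le_succPt P r))]

theorem HasCovariation.tendsto_sum_approxInterp {Q : Fin d → Fin d → Time T → ℝ}
    (hQ : HasCovariation P (fun u => Z (max s₀ u)) Q) (hΦ : LeftContinuous U S Φ)
    (hΦb : BoundednessPreserving U S Φ) (hU : IsOpen U) (hs₀ : ∀ n, s₀ ∈ P.pts n)
    (hZ : IsCadlag U Z) (hZc : Continuous fun u => Z (max s₀ u)) (hB : IsCBV S B)
    (hθ : ∀ n r, θ n r ∈ Set.Icc (0 : ℝ) 1) (t : Time T) (i j : Fin d) :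
    Tendsto (fun n => ∑ r ∈ P.pts n with s₀ ≤ r ∧ r ≤ t,
      Φ r (approxInterp s₀ (P.pts n) Z r (θ n r)) B
        * ((Z (succPt (P.pts n) r) - Z r) i * (Z (succPt (P.pts n) r) - Z r) j)) atTop
      (𝓝 (lsIntegral (fun u => Φ u Z B) (Q i j) (Set.Ioc s₀ t))) := by
  have hind : (fun u => if u ≤ t then (Set.Ioi s₀).indicator (fun u => Φ u Z B) u else 0)
      = (Set.Ioc s₀ t).indicator fun u => Φ u Z B := by
    ext u
    by_cases h1 : u ≤ t <;> by_cases h2 : s₀ < u <;> simp [h1, h2]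
  have hsub : Set.Ioi ⊥ ∩ Set.Ioc s₀ t = Set.Ioc s₀ t :=
    Set.inter_eq_right.2 fun u hu => bot_le.trans_lt hu.1
  have hlu := (hΦ.leftUniformTendsto (P := P) hU hZ hZc hB hθ).cutoff t
  rw [hind] at hlu
  obtain ⟨C, hC⟩ := hΦb.exists_abs_sampleFrom_le (P := P) hU hZ hZc hB hθ
  have hC' : ∀ᶠ n in atTop, ∀ r ∈ P.pts n,
      |if r ≤ t then sampleFrom Φ B s₀ (P.pts n) Z (θ n) r else 0| ≤ max C 0 := by
    filter_upwards [hC] with n hn r hr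
    split_ifs
    · exact (hn r hr).trans (le_max_left _ _)
    · simp only [abs_zero, le_max_right]
  have hbm := ((hΦ.bddMeasOn hΦb P hU hZ hZc hB).mono (measurableSet_Ioc (b := t))
    Set.Ioc_subset_Ioi_self).indicator.mono (measurableSet_Ioi (a := ⊥)) (Set.subset_univ _)
  have hlim := hQ.tendsto_sum hZc (Set.countable_singleton s₀) hlu hC' hbm i j
  rw [lsIntegral_indicator measurableSet_Ioi measurableSet_Ioc, hsub] at hlim
  refine hlim.congr fun n => ?_
  rw [Finset.sum_filter]
  refine Finset.sum_congr rfl fun r _ => ?_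
  by_cases hr : s₀ ≤ r
  · simp only [increment_max _ Z hr, sampleFrom, hr, if_true, true_and, ite_mul, zero_mul]
  · simp [hr, increment_max_eq_zero (hs₀ n) Z (not_le.1 hr)]

end Sample

/-- The integrand of the horizontal increments of a functional with horizontal derivative `Φ`
along the paths `approxFrom`, on the interval `(r, r']`, for `r` between `s₀` and `t`. -/
def horizontalStep (Φ : Functional T d m) (B : PathFn T m) (s₀ t : Time T) (P : Finset (Time T))
    (Z : PathFn T d) (r u : Time T) : ℝ :=
  if s₀ ≤ r ∧ r ≤ t then Φ u (approxFrom s₀ P Z (succPt P r)) B else 0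

section HorizontalStep

variable {F : Functional T d m} {D : Fin (m + 1) → Functional T d m} {Φ : Functional T d m}

theorem BoundednessPreserving.exists_abs_horizontalStep_le (hΦ : BoundednessPreserving U S Φ)
    (hZ : IsCadlag U Z) (hB : IsCBV S B) (s₀ t : Time T) :
    ∃ C, ∀ P : Finset (Time T), IsPartition P → ∀ r u, |horizontalStep Φ B s₀ t P Z r u| ≤ C := by
  obtain ⟨K, hKU, hK, hZK⟩ := hZ.exists_compact
  obtain ⟨C, hC⟩ := hΦ B hB K hKU hK
  refine ⟨max C 0, fun P hP r u => ?_⟩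
  unfold horizontalStep
  split_ifs
  · exact (hC u _ (.approxFrom hP hZK _)).trans (le_max_left _ _)
  · simp only [abs_zero, le_max_right]

theorem IsHorizontalDeriv.bddMeasOn_horizontalStep (hD : IsHorizontalDeriv U S F D)
    (hZ : IsCadlag U Z) (hB : IsCBV S B) {P : Finset (Time T)} (hP : IsPartition P)
    (i : Fin (m + 1)) (s₀ t r : Time T) :
    BddMeasOn (horizontalStep (D i) B s₀ t P Z r) (Set.Ioc r (succPt P r)) := by
  by_cases hr : s₀ ≤ r ∧ r ≤ t
  · have hstep : horizontalStep (D i) B s₀ t P Z r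
        = fun u => D i u (stopped (approxFrom s₀ P Z (succPt P r)) r) B := by
      ext u
      rw [horizontalStep, if_pos hr, stopped_approxFrom_succPt hr.1]
    rw [hstep]
    exact hD.bddMeasOn_stopped (.approxFrom hP hZ _) hB i r _
  · have hstep : horizontalStep (D i) B s₀ t P Z r = fun _ => 0 := by
      ext u
      rw [horizontalStep, if_neg hr]
    rw [hstep]
    exact .const measurableSet_Ioc 0

theorem IsHorizontalDeriv.lsIntegral_horizontalStep (hD : IsHorizontalDeriv U S F D)
    (hZ : IsCadlag U Z) (hB : IsCBV S B) {P : Finset (Time T)} (hP : IsPartition P)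
    (i : Fin (m + 1)) (s₀ t : Time T) (g : Time T → ℝ) :
    lsIntegral (fun u => horizontalStep (D i) B s₀ t P Z (prevPt P u) u) g (Set.Ioi ⊥)
      = ∑ r ∈ P with s₀ ≤ r ∧ r ≤ t, lsIntegral
        (fun u => D i u (approxFrom s₀ P Z (succPt P r)) B) g (Set.Ioc r (succPt P r)) := by
  rw [hP.lsIntegral_piecewise (fun r _ => hD.bddMeasOn_horizontalStep hZ hB hP i s₀ t r),
    Finset.sum_filter]
  refine Finset.sum_congr rfl fun r _ => ?_
  unfold horizontalStep
  split_ifs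
  · rfl
  · exact VectorMeasure.integral_zero

theorem ContinuousAtFixedTimes.tendsto_horizontalStep (hΦ : ContinuousAtFixedTimes U S Φ)
    (hs₀ : ∀ n, s₀ ∈ P.pts n) (hZ : IsCadlag U Z) (hZc : Continuous fun u => Z (max s₀ u))
    (hB : IsCBV S B) (t : Time T) {u : Time T} (hu : ⊥ < u) :
    Tendsto (fun n => horizontalStep Φ B s₀ t (P.pts n) Z (prevPt (P.pts n) u) u) atTop
      (𝓝 ((Set.Ioc s₀ t).indicator (fun u => Φ u Z B) u)) := by
  have hP := P.isPartition
  rcases le_or_gt u s₀ with hus | hus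
  · refine tendsto_const_nhds.congr fun n => ?_
    have hprev := ((hP n).prevPt_lt hu).trans_le hus
    simp [horizontalStep, hprev.not_ge, hus.not_gt]
  rcases lt_or_ge t u with htu | hut
  · refine tendsto_const_nhds.congr' ?_
    filter_upwards [(P.tendsto_prevPt u).eventually (lt_mem_nhds htu)] with n hn
    simp [horizontalStep, hn.not_ge, htu.not_ge]
  rw [Set.indicator_of_mem (show u ∈ Set.Ioc s₀ t from ⟨hus, hut⟩), Metric.tendsto_nhds]
  intro ε hε
  obtain ⟨δ₁, hδ₁, hcont⟩ := hΦ ε hε u Z B hZ hB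
  obtain ⟨δ₂, hδ₂, hω⟩ := exists_modulus hZc (half_pos hδ₁)
  filter_upwards [P.eventually_mesh_lt hδ₂] with n hn
  rw [horizontalStep, if_pos ⟨le_prevPt (hs₀ n) hus, (prevPt_le _ u).trans hut⟩, dist_comm,
    Real.dist_eq]
  refine hcont _ (.approxFrom (hP n) hZ _) ?_
  refine (supNorm_le (half_pos hδ₁).le fun v => ?_).trans_lt (half_lt_self hδ₁)
  exact norm_stopped_sub_stopped_approxFrom_le hδ₂ (half_pos hδ₁).le hω
    (fun u => (hn u).1) ((hP n).le_succPt_prevPt u) v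

theorem IsHorizontalDeriv.bddMeasOn (hD : IsHorizontalDeriv U S F D)
    (hDc : ∀ i, ContinuousAtFixedTimes U S (D i)) (hs₀ : ∀ n, s₀ ∈ P.pts n)
    (hZ : IsCadlag U Z) (hZc : Continuous fun u => Z (max s₀ u)) (hB : IsCBV S B)
    (i : Fin (m + 1)) (t : Time T) : BddMeasOn (fun u => D i u Z B) (Set.Ioc s₀ t) := by
  obtain ⟨K, hKU, hK, hZK⟩ := hZ.exists_compact
  obtain ⟨C, hC⟩ := hD.boundednessPreserving i B hB K hKU hK
  refine ⟨?_, C, fun u _ => hC u Z hZK⟩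
  refine measurable_of_tendsto_metrizable (fun n => (P.isPartition n).measurable_piecewise
    fun r _ => (hD.bddMeasOn_horizontalStep hZ hB (P.isPartition n) i s₀ t r).meas)
    (tendsto_pi_nhds.2 fun u => ?_)
  by_cases hu : u ∈ Set.Ioi ⊥
  · simpa only [Set.indicator_of_mem hu] using
      (hDc i).tendsto_horizontalStep hs₀ hZ hZc hB t hu
  · have hu' : u ∉ Set.Ioc s₀ t := fun h => hu (bot_le.trans_lt h.1)
    simp only [Set.indicator_of_notMem hu, Set.indicator_of_notMem hu']
    exact tendsto_const_nhds

theorem IsHorizontalDeriv.tendsto_sum_approxFrom (hD : IsHorizontalDeriv U S F D)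
    (hDc : ∀ i, ContinuousAtFixedTimes U S (D i)) (hs₀ : ∀ n, s₀ ∈ P.pts n)
    (hZ : IsCadlag U Z) (hZc : Continuous fun u => Z (max s₀ u)) (hB : IsCBV S B)
    (i : Fin (m + 1)) (t : Time T) :
    Tendsto (fun n => ∑ r ∈ P.pts n with s₀ ≤ r ∧ r ≤ t,
      lsIntegral (fun u => D i u (approxFrom s₀ (P.pts n) Z (succPt (P.pts n) r)) B)
        (withTime B i) (Set.Ioc r (succPt (P.pts n) r))) atTop
      (𝓝 (lsIntegral (fun u => D i u Z B) (withTime B i) (Set.Ioc s₀ t))) := by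
  have hP := P.isPartition
  have hsub : Set.Ioi ⊥ ∩ Set.Ioc s₀ t = Set.Ioc s₀ t :=
    Set.inter_eq_right.2 fun u hu => bot_le.trans_lt hu.1
  simp only [← fun n => hD.lsIntegral_horizontalStep hZ hB (hP n) i s₀ t (withTime B i)]
  rw [← hsub, ← lsIntegral_indicator measurableSet_Ioi measurableSet_Ioc]
  obtain ⟨C, hC⟩ := (hD.boundednessPreserving i).exists_abs_horizontalStep_le hZ hB s₀ t
  exact tendsto_lsIntegral (hB.isContBV_withTime i) measurableSet_Ioi Set.countable_empty
    (Eventually.of_forall fun n => (hP n).measurable_piecewise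
      fun r _ => (hD.bddMeasOn_horizontalStep hZ hB (hP n) i s₀ t r).meas)
    (Eventually.of_forall fun n u _ => hC _ (hP n) _ u)
    fun u hu _ => (hDc i).tendsto_horizontalStep hs₀ hZ hZc hB t hu

theorem tendsto_approxFrom_endpoint (hF : NonAnticipative U S F)
    (hFc : ContinuousLocallyUniformly U S F) (hD : IsHorizontalDeriv U S F D)
    (hZ : IsCadlag U Z) (hZc : Continuous fun u => Z (max s₀ u)) (hB : IsCBV S B) {t : Time T}
    (hst : s₀ ≤ t) :
    Tendsto (fun n => F (succPt (P.pts n) t)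
      (approxFrom s₀ (P.pts n) Z (succPt (P.pts n) t)) B) atTop (𝓝 (F t Z B)) := by
  have hstopped : Tendsto (fun n => F (succPt (P.pts n) t) (stopped Z t) B) atTop
      (𝓝 (F t Z B)) := by
    rw [← hF.stopped_left hZ hB]
    exact (hD.tendsto_right hZ hB t).comp (tendsto_nhdsWithin_of_tendsto_nhds_of_eventually_within
      _ (P.tendsto_succPt t) (Eventually.of_forall fun n => le_succPt _ t))
  have hdiff : Tendsto (fun n => F (succPt (P.pts n) t) (stopped Z t) B
      - F (succPt (P.pts n) t) (approxFrom s₀ (P.pts n) Z (succPt (P.pts n) t)) B) atTop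
      (𝓝 0) := by
    rw [Metric.tendsto_nhds]
    intro ε hε
    obtain ⟨δ₁, hδ₁, h⟩ := hFc ε hε t (stopped Z t) B (hZ.stopped t) hB
    obtain ⟨δ₂, hδ₂, hω⟩ := exists_modulus hZc (half_pos hδ₁)
    filter_upwards [P.eventually_mesh_lt hδ₁, P.eventually_mesh_lt hδ₂] with n hn1 hn2
    rw [Real.dist_eq, sub_zero]
    have hle : (t : ℝ) ≤ succPt (P.pts n) t := le_succPt _ t
    have habs : |(t : ℝ) - succPt (P.pts n) t| = succPt (P.pts n) t - t := by
      rw [abs_sub_comm, abs_of_nonneg (by linarith)]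
    refine h _ _ (.approxFrom (P.isPartition n) hZ _) ?_ (habs ▸ (hn1 t).1)
    refine (supNorm_le (half_pos hδ₁).le fun v => ?_).trans_lt (half_lt_self hδ₁)
    exact norm_stopped_sub_approxFrom_le (half_pos hδ₁).le hω (fun u => (hn2 u).1) hst
      (hst.trans (le_succPt _ t)) (habs ▸ (hn2 t).1) v
  simpa using hstopped.sub hdiff

end HorizontalStep

section Formula

variable {F : Functional T d m} {D : Fin (m + 1) → Functional T d m}

theorem NonAnticipative.approxFrom_start (hF : NonAnticipative U S F) {P : Finset (Time T)}
    (hP : IsPartition P) (hZ : IsCadlag U Z) (hB : IsCBV S B) :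
    F s₀ (approxFrom s₀ P Z s₀) B = F s₀ Z B := by
  refine hF.congr (.approxFrom hP hZ _) hZ hB (funext fun u => ?_)
  rcases lt_or_ge u s₀ with h | h
  · simp [stopped, approxFrom, h, h.le]
  · simp [stopped, approxFrom, approxLeft, h]

omit [Fact (0 ≤ T)] in
theorem exists_taylor_approxInterp (hF : MemC12c U S F) (hB : IsCBV S B) {P : Finset (Time T)}
    {r : Time T} (hr : s₀ ≤ r)
    (hseg : ∀ θ ∈ Set.Icc (0 : ℝ) 1, IsCadlag U (approxInterp s₀ P Z r θ)) :
    ∃ θ ∈ Set.Icc (0 : ℝ) 1,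
      F r (approxFrom s₀ P Z (succPt P r)) B - F r (approxFrom s₀ P Z r) B
        = inner ℝ (vgrad F r (approxFrom s₀ P Z r) B) (Z (succPt P r) - Z r)
          + (1 / 2) * ∑ i, ∑ j, vpartial i (vpartial j F) r (approxInterp s₀ P Z r θ) B
            * ((Z (succPt P r) - Z r) i * (Z (succPt P r) - Z r) j) := by
  obtain ⟨θ, hθ, htaylor⟩ := exists_vertical_taylor hF.vertical hF.vertical₂ hB
    (Z (succPt P r) - Z r) hseg
  have hstart := hseg 0 (by simp)
  have hend := hseg 1 (by simp)
  rw [approxInterp_zero] at hstart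
  rw [approxInterp, one_smul] at hend
  rw [hF.nonAnticipative.stopped_right hend hB, hF.nonAnticipative.stopped_right hstart hB,
    ← approxFrom_succPt hr] at htaylor
  exact ⟨θ, Set.Ioo_subset_Icc_self hθ, htaylor⟩

theorem IsHorizontalDeriv.sub_approxFrom_succPt (hD : IsHorizontalDeriv U S F D)
    (hZ : IsCadlag U Z) (hB : IsCBV S B) {P : Finset (Time T)} (hP : IsPartition P) {r : Time T}
    (hr : s₀ ≤ r) :
    F (succPt P r) (approxFrom s₀ P Z (succPt P r)) B - F r (approxFrom s₀ P Z (succPt P r)) B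
      = ∑ i, lsIntegral (fun u => D i u (approxFrom s₀ P Z (succPt P r)) B) (withTime B i)
          (Set.Ioc r (succPt P r)) := by
  have := hD.sub_eq_sum_lsIntegral (IsCadlag.approxFrom (s₀ := s₀) hP hZ (succPt P r)) hB
    (le_succPt P r)
  rwa [stopped_approxFrom_succPt hr] at this

theorem exists_increment_decomposition (hF : MemC12c U S F) (hD : IsHorizontalDeriv U S F D)
    (hU : IsOpen U) (hZ : IsCadlag U Z) (hZc : Continuous fun u => Z (max s₀ u))
    (hB : IsCBV S B) :
    ∃ θ : ℕ → Time T → ℝ, (∀ n r, θ n r ∈ Set.Icc (0 : ℝ) 1) ∧ ∀ᶠ n in atTop, ∀ r, s₀ ≤ r →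
      F (succPt (P.pts n) r) (approxFrom s₀ (P.pts n) Z (succPt (P.pts n) r)) B
          - F r (approxFrom s₀ (P.pts n) Z r) B
        = ∑ i, lsIntegral (fun u => D i u (approxFrom s₀ (P.pts n) Z (succPt (P.pts n) r)) B)
            (withTime B i) (Set.Ioc r (succPt (P.pts n) r))
          + inner ℝ (vgrad F r (approxFrom s₀ (P.pts n) Z r) B) (Z (succPt (P.pts n) r) - Z r)
          + (1 / 2) * ∑ i, ∑ j,
            vpartial i (vpartial j F) r (approxInterp s₀ (P.pts n) Z r (θ n r)) B
              * ((Z (succPt (P.pts n) r) - Z r) i * (Z (succPt (P.pts n) r) - Z r) j) := by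
  have htaylor : ∀ n r, ∃ θ ∈ Set.Icc (0 : ℝ) 1, s₀ ≤ r →
      (∀ θ ∈ Set.Icc (0 : ℝ) 1, IsCadlag U (approxInterp s₀ (P.pts n) Z r θ)) → _ := fun n r => by
    by_cases h : s₀ ≤ r ∧ ∀ θ ∈ Set.Icc (0 : ℝ) 1, IsCadlag U (approxInterp s₀ (P.pts n) Z r θ)
    · exact (exists_taylor_approxInterp hF hB h.1 h.2).imp fun θ hθ => ⟨hθ.1, fun _ _ => hθ.2⟩
    · exact ⟨0, by simp, fun hr hseg => (h ⟨hr, hseg⟩).elim⟩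
  choose θ hθ htaylor using htaylor
  obtain ⟨K, hKU, -, hK⟩ := exists_compact_approxInterp (P := P) hU hZ hZc
  refine ⟨θ, hθ, hK.mono fun n hn r hr => ?_⟩
  have hvertical := htaylor n r hr fun θ hθ => (hn r hr θ hθ).mono hKU
  have hhorizontal := hD.sub_approxFrom_succPt hZ hB (P.isPartition n) hr
  linarith

theorem ito_formula (hF : MemC12c U S F) (hD : IsHorizontalDeriv U S F D)
    (hDc : ∀ i, ContinuousAtFixedTimes U S (D i)) (hU : IsOpen U) (hs₀ : ∀ n, s₀ ∈ P.pts n)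
    (hZ : IsCadlag U Z) (hZc : Continuous fun u => Z (max s₀ u)) (hB : IsCBV S B)
    {Q : Fin d → Fin d → Time T → ℝ} (hQ : HasCovariation P (fun u => Z (max s₀ u)) Q)
    {t : Time T} (hst : s₀ ≤ t) :
    Tendsto (fun n => ∑ r ∈ P.pts n with r ≤ t,
      inner ℝ (vgrad F r (approxFrom s₀ (P.pts n) Z r) B)
        (Z (max s₀ (succPt (P.pts n) r)) - Z (max s₀ r))) atTop
      (𝓝 (F t Z B - F s₀ Z B
        - ∑ i, lsIntegral (fun u => D i u Z B) (withTime B i) (Set.Ioc s₀ t)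
        - (1 / 2) * ∑ i, ∑ j, lsIntegral (fun u => vpartial i (vpartial j F) u Z B) (Q i j)
          (Set.Ioc s₀ t))) := by
  obtain ⟨θ, hθ, hdecomp⟩ := exists_increment_decomposition (P := P) hF hD hU hZ hZc hB
  have hhorizontal := tendsto_finsetSum Finset.univ fun i _ =>
    hD.tendsto_sum_approxFrom hDc hs₀ hZ hZc hB i t
  have hsecond := tendsto_finsetSum Finset.univ fun i _ => tendsto_finsetSum Finset.univ
    fun j _ => hQ.tendsto_sum_approxInterp (hF.vpartial₂_leftContinuous i j)
      (hF.vpartial₂_boundednessPreserving i j) hU hs₀ hZ hZc hB hθ t i j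
  have hend := tendsto_approxFrom_endpoint (P := P) hF.nonAnticipative
    hF.continuousLocallyUniformly hD hZ hZc hB hst
  refine (((hend.sub_const (F s₀ Z B)).sub hhorizontal).sub
    (hsecond.const_mul (1 / 2))).congr' (hdecomp.mono fun n hn => ?_)
  have hP := P.isPartition n
  beta_reduce
  rw [sum_filter_le_eq_sum_filter_Icc (s₀ := s₀) _ _ fun r hr => by
      rw [increment_max_eq_zero (hs₀ n) Z hr, inner_zero_right],
    ← hF.nonAnticipative.approxFrom_start hP hZ hB, ← hP.sum_telescope (hs₀ n) hst
      fun r => F r (approxFrom s₀ (P.pts n) Z r) B, Finset.sum_comm,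
    Finset.sum_congr rfl fun i _ => Finset.sum_comm, Finset.sum_comm (s := Finset.univ),
    Finset.mul_sum, ← Finset.sum_sub_distrib, ← Finset.sum_sub_distrib]
  refine Finset.sum_congr rfl fun r hr => ?_
  have hsr : s₀ ≤ r := (Finset.mem_filter.1 hr).2.1
  rw [increment_max _ Z hsr, hn r hsr]
  ring

end Formula

end Ito

end

/-! ### Regular functionals and their image paths -/

section

variable {T : ℝ} {d m ν : ℕ} {U : Set (E d)} {S : Set (E m)}

/-- Non-anticipative and boundedness-preserving functionals: the regularity that a horizontal
derivative and the vertical derivatives of a functional in `ℂ^{1,2}_c` have in common. -/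
structure Tame (U : Set (E d)) (S : Set (E m)) (Φ : Functional T d m) : Prop where
  nonAnticipative : NonAnticipative U S Φ
  boundednessPreserving : BoundednessPreserving U S Φ

theorem MemC12c.tame {F : Functional T d m} (hF : MemC12c U S F) : Tame U S F :=
  ⟨hF.nonAnticipative, hF.boundednessPreserving⟩

theorem MemC12c.tame_vpartial {F : Functional T d m} (hF : MemC12c U S F) (hU : IsOpen U)
    (i : Fin d) : Tame U S (vpartial i F) :=
  ⟨hF.nonAnticipative.vpartial hU i, hF.vpartial_boundednessPreserving i⟩

theorem MemC12c.tame_vpartial₂ {F : Functional T d m} (hF : MemC12c U S F) (hU : IsOpen U)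
    (i j : Fin d) : Tame U S (vpartial i (vpartial j F)) :=
  ⟨(hF.nonAnticipative.vpartial hU j).vpartial hU i, hF.vpartial₂_boundednessPreserving i j⟩

theorem IsHorizontalDeriv.tame {F : Functional T d m} {D : Fin (m + 1) → Functional T d m}
    (hD : IsHorizontalDeriv U S F D) (i : Fin (m + 1)) : Tame U S (D i) :=
  ⟨hD.nonAnticipative i, hD.boundednessPreserving i⟩

/-- The filter of pairs `(s, Y)` with `s ↑ t` and `Y^s → X^t`, along which left-continuous
functionals converge at `(t, X)`. -/
def leftFilter (U : Set (E d)) (t : Time T) (X : PathFn T d) : Filter (Time T × PathFn T d) :=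
  ⨅ δ ∈ Set.Ioi (0 : ℝ), 𝓟 {q | q.1 ≤ t ∧ (t : ℝ) - q.1 < δ ∧ IsCadlag U q.2 ∧
    supNorm (stopped X t - stopped q.2 q.1) < δ}

/-- The filter of paths `Y` with `Y^t → X^t`, along which functionals that are continuous at fixed
times converge at `(t, X)`. -/
def fixedFilter (U : Set (E d)) (t : Time T) (X : PathFn T d) : Filter (PathFn T d) :=
  ⨅ δ ∈ Set.Ioi (0 : ℝ), 𝓟 {Y | IsCadlag U Y ∧ supNorm (stopped X t - stopped Y t) < δ}

theorem leftFilter_hasBasis (U : Set (E d)) (t : Time T) (X : PathFn T d) :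
    (leftFilter U t X).HasBasis (fun δ : ℝ => δ ∈ Set.Ioi (0 : ℝ)) fun δ =>
      {q | q.1 ≤ t ∧ (t : ℝ) - q.1 < δ ∧ IsCadlag U q.2 ∧
        supNorm (stopped X t - stopped q.2 q.1) < δ} := by
  refine hasBasis_biInf_principal' (fun δ hδ δ' hδ' =>
    ⟨min δ δ', Set.mem_Ioi.2 (lt_min hδ hδ'), ?_, ?_⟩) ⟨1, Set.mem_Ioi.2 one_pos⟩
  · exact fun q hq => ⟨hq.1, hq.2.1.trans_le (min_le_left _ _), hq.2.2.1,
      hq.2.2.2.trans_le (min_le_left _ _)⟩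
  · exact fun q hq => ⟨hq.1, hq.2.1.trans_le (min_le_right _ _), hq.2.2.1,
      hq.2.2.2.trans_le (min_le_right _ _)⟩

theorem fixedFilter_hasBasis (U : Set (E d)) (t : Time T) (X : PathFn T d) :
    (fixedFilter U t X).HasBasis (fun δ : ℝ => δ ∈ Set.Ioi (0 : ℝ)) fun δ =>
      {Y | IsCadlag U Y ∧ supNorm (stopped X t - stopped Y t) < δ} := by
  refine hasBasis_biInf_principal' (fun δ hδ δ' hδ' =>
    ⟨min δ δ', Set.mem_Ioi.2 (lt_min hδ hδ'), ?_, ?_⟩) ⟨1, Set.mem_Ioi.2 one_pos⟩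
  · exact fun q hq => ⟨hq.1, hq.2.trans_le (min_le_left _ _)⟩
  · exact fun q hq => ⟨hq.1, hq.2.trans_le (min_le_right _ _)⟩

theorem leftContinuous_iff {Φ : Functional T d m} : LeftContinuous U S Φ ↔
    ∀ (t : Time T) X A, (0 : ℝ) < t → IsCadlag U X → IsCBV S A →
      Tendsto (fun q : Time T × PathFn T d => Φ q.1 q.2 A) (leftFilter U t X) (𝓝 (Φ t X A)) := by
  constructor
  · intro h t X A ht hX hA
    refine ((leftFilter_hasBasis U t X).tendsto_iff Metric.nhds_basis_ball).2 fun ε hε => ?_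
    obtain ⟨δ, hδ, h⟩ := h t ht ε hε X A hX hA
    refine ⟨δ, hδ, fun q hq => ?_⟩
    rw [Metric.mem_ball, dist_comm, Real.dist_eq]
    exact h q.1 hq.1 hq.2.1 q.2 hq.2.2.1 hq.2.2.2
  · intro h t ht ε hε X A hX hA
    obtain ⟨δ, hδ, h⟩ := ((leftFilter_hasBasis U t X).tendsto_iff Metric.nhds_basis_ball).1
      (h t X A ht hX hA) ε hε
    refine ⟨δ, hδ, fun s hs hs' Y hY hXY => ?_⟩
    have := h (s, Y) ⟨hs, hs', hY, hXY⟩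
    rwa [Metric.mem_ball, dist_comm, Real.dist_eq] at this

theorem continuousAtFixedTimes_iff {Φ : Functional T d m} : ContinuousAtFixedTimes U S Φ ↔
    ∀ (t : Time T) X A, IsCadlag U X → IsCBV S A →
      Tendsto (fun Y : PathFn T d => Φ t Y A) (fixedFilter U t X) (𝓝 (Φ t X A)) := by
  constructor
  · intro h t X A hX hA
    refine ((fixedFilter_hasBasis U t X).tendsto_iff Metric.nhds_basis_ball).2 fun ε hε => ?_
    obtain ⟨δ, hδ, h⟩ := h ε hε t X A hX hA
    refine ⟨δ, hδ, fun Y hY => ?_⟩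
    rw [Metric.mem_ball, dist_comm, Real.dist_eq]
    exact h Y hY.1 hY.2
  · intro h ε hε t X A hX hA
    obtain ⟨δ, hδ, h⟩ := ((fixedFilter_hasBasis U t X).tendsto_iff Metric.nhds_basis_ball).1
      (h t X A hX hA) ε hε
    refine ⟨δ, hδ, fun Y hY hXY => ?_⟩
    have := h Y ⟨hY, hXY⟩
    rwa [Metric.mem_ball, dist_comm, Real.dist_eq] at this

theorem eventually_leftFilter_forall_Icc {t : Time T} {X : PathFn T d} (hX : IsCadlag U X)
    {p : Time T × PathFn T d → Prop} (hp : ∀ᶠ q in leftFilter U t X, p q) :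
    ∀ᶠ q in leftFilter U t X, ∀ v ∈ Set.Icc q.1 t, p (v, X) := by
  obtain ⟨δ, hδ : 0 < δ, h⟩ := (leftFilter_hasBasis U t X).eventually_iff.1 hp
  refine (leftFilter_hasBasis U t X).eventually_iff.2
    ⟨δ / 3, show 0 < δ / 3 by linarith, fun q ⟨_, hq, hY, hXY⟩ v ⟨hqv, hvt⟩ => h ⟨hvt, ?_, hX, ?_⟩⟩
  · have hqv' : (q.1 : ℝ) ≤ v := hqv
    linarith
  have hnear : ∀ w, q.1 ≤ w → w ≤ t → ‖X w - q.2 q.1‖ ≤ δ / 3 := fun w hqw hwt => by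
    simpa [stopped, min_eq_right hwt, min_eq_left hqw] using
      ((hX.stopped t).norm_sub_le_supNorm (hY.stopped q.1) w).trans hXY.le
  refine (supNorm_le (C := δ / 3 + δ / 3) (by linarith) fun w => ?_).trans_lt (by linarith)
  simp only [Pi.sub_apply, stopped]
  rcases le_total w v with hwv | hvw
  · rw [min_eq_right hwv, min_eq_right (hwv.trans hvt), sub_self, norm_zero]
    linarith
  · rw [min_eq_left hvw, ← sub_sub_sub_cancel_right _ _ (q.2 q.1)]
    exact (norm_sub_le _ _).trans (add_le_add
      (hnear _ (le_min (hqv.trans hvt) (hqv.trans hvw)) (min_le_left _ _)) (hnear v hqv hvt))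

section Algebra

variable {Φ Ψ : Functional T d m}

theorem NonAnticipative.sum_mul {ι : Type*} (s : Finset ι) {Φ Ψ : ι → Functional T d m}
    (hΦ : ∀ l ∈ s, NonAnticipative U S (Φ l)) (hΨ : ∀ l ∈ s, NonAnticipative U S (Ψ l)) :
    NonAnticipative U S fun t X A => ∑ l ∈ s, Φ l t X A * Ψ l t X A :=
  fun t X A hX hA => Finset.sum_congr rfl fun l hl => by
    rw [← hΦ l hl t X A hX hA, ← hΨ l hl t X A hX hA]

theorem NonAnticipative.add (hΦ : NonAnticipative U S Φ) (hΨ : NonAnticipative U S Ψ) :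
    NonAnticipative U S fun t X A => Φ t X A + Ψ t X A :=
  fun t X A hX hA => congrArg₂ (· + ·) (hΦ t X A hX hA) (hΨ t X A hX hA)

theorem BoundednessPreserving.sum_mul {ι : Type*} (s : Finset ι) {Φ Ψ : ι → Functional T d m}
    (hΦ : ∀ l ∈ s, BoundednessPreserving U S (Φ l))
    (hΨ : ∀ l ∈ s, BoundednessPreserving U S (Ψ l)) :
    BoundednessPreserving U S fun t X A => ∑ l ∈ s, Φ l t X A * Ψ l t X A := by
  intro A hA K hK hKc
  choose! C hC using fun l hl => hΦ l hl A hA K hK hKc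
  choose! C' hC' using fun l hl => hΨ l hl A hA K hK hKc
  refine ⟨∑ l ∈ s, C l * C' l, fun t X hX => (Finset.abs_sum_le_sum_abs _ _).trans
    (Finset.sum_le_sum fun l hl => ?_)⟩
  rw [abs_mul]
  exact mul_le_mul (hC l hl t X hX) (hC' l hl t X hX) (abs_nonneg _)
    ((abs_nonneg _).trans (hC l hl t X hX))

theorem BoundednessPreserving.add (hΦ : BoundednessPreserving U S Φ)
    (hΨ : BoundednessPreserving U S Ψ) :
    BoundednessPreserving U S fun t X A => Φ t X A + Ψ t X A := by
  intro A hA K hK hKc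
  obtain ⟨C, hC⟩ := hΦ A hA K hK hKc
  obtain ⟨C', hC'⟩ := hΨ A hA K hK hKc
  exact ⟨C + C', fun t X hX => (abs_add_le _ _).trans (add_le_add (hC t X hX) (hC' t X hX))⟩

theorem BoundednessPreserving.congr (hΦ : BoundednessPreserving U S Φ)
    (h : ∀ t X A, IsCadlag U X → IsCBV S A → Ψ t X A = Φ t X A) : BoundednessPreserving U S Ψ := by
  intro A hA K hK hKc
  obtain ⟨C, hC⟩ := hΦ A hA K hK hKc
  exact ⟨C, fun t X hX => by rw [h t X A (hX.mono hK) hA]; exact hC t X hX⟩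

theorem Tame.sum_mul {ι : Type*} (s : Finset ι) {Φ Ψ : ι → Functional T d m}
    (hΦ : ∀ l ∈ s, Tame U S (Φ l)) (hΨ : ∀ l ∈ s, Tame U S (Ψ l)) :
    Tame U S fun t X A => ∑ l ∈ s, Φ l t X A * Ψ l t X A :=
  ⟨.sum_mul s (fun l hl => (hΦ l hl).1) fun l hl => (hΨ l hl).1,
    .sum_mul s (fun l hl => (hΦ l hl).2) fun l hl => (hΨ l hl).2⟩

theorem Tame.add (hΦ : Tame U S Φ) (hΨ : Tame U S Ψ) :
    Tame U S fun t X A => Φ t X A + Ψ t X A :=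
  ⟨hΦ.1.add hΨ.1, hΦ.2.add hΨ.2⟩

theorem LeftContinuous.sum_mul {ι : Type*} (s : Finset ι) {Φ Ψ : ι → Functional T d m}
    (hΦ : ∀ l ∈ s, LeftContinuous U S (Φ l)) (hΨ : ∀ l ∈ s, LeftContinuous U S (Ψ l)) :
    LeftContinuous U S fun t X A => ∑ l ∈ s, Φ l t X A * Ψ l t X A :=
  leftContinuous_iff.2 fun t X A ht hX hA => tendsto_finsetSum _ fun l hl =>
    (leftContinuous_iff.1 (hΦ l hl) t X A ht hX hA).mul
      (leftContinuous_iff.1 (hΨ l hl) t X A ht hX hA)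

theorem LeftContinuous.add (hΦ : LeftContinuous U S Φ) (hΨ : LeftContinuous U S Ψ) :
    LeftContinuous U S fun t X A => Φ t X A + Ψ t X A :=
  leftContinuous_iff.2 fun t X A ht hX hA =>
    (leftContinuous_iff.1 hΦ t X A ht hX hA).add (leftContinuous_iff.1 hΨ t X A ht hX hA)

theorem LeftContinuous.congr (hΦ : LeftContinuous U S Φ)
    (h : ∀ t X A, IsCadlag U X → IsCBV S A → Ψ t X A = Φ t X A) : LeftContinuous U S Ψ := by
  intro t ht ε hε X A hX hA
  obtain ⟨δ, hδ, H⟩ := hΦ t ht ε hε X A hX hA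
  refine ⟨δ, hδ, fun s hs hs' Y hY hXY => ?_⟩
  rw [h t X A hX hA, h s Y A hY hA]
  exact H s hs hs' Y hY hXY

theorem ContinuousAtFixedTimes.sum_mul {ι : Type*} (s : Finset ι) {Φ Ψ : ι → Functional T d m}
    (hΦ : ∀ l ∈ s, ContinuousAtFixedTimes U S (Φ l))
    (hΨ : ∀ l ∈ s, ContinuousAtFixedTimes U S (Ψ l)) :
    ContinuousAtFixedTimes U S fun t X A => ∑ l ∈ s, Φ l t X A * Ψ l t X A :=
  continuousAtFixedTimes_iff.2 fun t X A hX hA => tendsto_finsetSum _ fun l hl =>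
    (continuousAtFixedTimes_iff.1 (hΦ l hl) t X A hX hA).mul
      (continuousAtFixedTimes_iff.1 (hΨ l hl) t X A hX hA)

theorem ContinuousAtFixedTimes.add (hΦ : ContinuousAtFixedTimes U S Φ)
    (hΨ : ContinuousAtFixedTimes U S Ψ) :
    ContinuousAtFixedTimes U S fun t X A => Φ t X A + Ψ t X A :=
  continuousAtFixedTimes_iff.2 fun t X A hX hA =>
    (continuousAtFixedTimes_iff.1 hΦ t X A hX hA).add
      (continuousAtFixedTimes_iff.1 hΨ t X A hX hA)

/-- At time `0`, where left-continuity says nothing, a path stopped at `0` is constant, so that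
vertical differentiability gives the continuity. -/
theorem LeftContinuous.continuousAtFixedTimes (hΦ : LeftContinuous U S Φ)
    (hΦn : NonAnticipative U S Φ) (hΦv : VerticallyDifferentiable U S Φ) :
    ContinuousAtFixedTimes U S Φ := by
  intro ε hε t X A hX hA
  rcases eq_or_lt_of_le t.2.1 with ht | ht
  · have hbot : ∀ u : Time T, t ≤ u := fun u => by
      rw [← Subtype.coe_le_coe, ← ht]; exact u.2.1
    have hc := (hΦv t (stopped X t) A (hX.stopped t) hA).continuousAt
    obtain ⟨δ, hδ, hc⟩ := Metric.continuousAt_iff.1 hc ε hε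
    refine ⟨δ, hδ, fun Y hY hXY => ?_⟩
    have h0 := (hX.stopped t).norm_sub_le_supNorm (hY.stopped t) t
    have h1 := @hc (Y t - X t) (by
      rw [dist_zero_right, norm_sub_rev]
      simpa [stopped] using h0.trans_lt hXY)
    have h2 : bump (stopped X t) t (Y t - X t) = stopped Y t := by
      ext u : 1
      simp [bump, stopped, hbot u]
    rw [h2, bump_zero, dist_comm, Real.dist_eq, ← hΦn t X A hX hA, ← hΦn t Y A hY hA] at h1
    exact h1
  · obtain ⟨δ, hδ, h⟩ := hΦ t ht ε hε X A hX hA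
    exact ⟨δ, hδ, fun Y hY hXY => h t le_rfl (by simpa using hδ) Y hY hXY⟩

end Algebra

section PathLimits

variable {F : Functional T d m} {X : PathFn T d} {A : PathFn T m} {t : Time T}

theorem tendsto_nhdsLT_leftFilter (hX : IsCadlag U X) (ht : (0 : ℝ) < t) {x : E d}
    (hx : Tendsto X (𝓝[<] t) (𝓝 x)) :
    Tendsto (fun s => (s, X)) (𝓝[<] t) (leftFilter U t fun u => if u < t then X u else x) := by
  refine (leftFilter_hasBasis U t _).tendsto_right_iff.2 fun δ (hδ : 0 < δ) => ?_
  have hnear : ∀ᶠ s in 𝓝[<] t, dist (X s) x < δ / 4 := Metric.tendsto_nhds.1 hx _ (by linarith)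
  have ht0 : (⟨0, le_rfl, t.2.1.trans t.2.2⟩ : Time T) < t := ht
  obtain ⟨a, ha, hax⟩ := (mem_nhdsLT_iff_exists_Ioo_subset' ht0).1 hnear
  filter_upwards [nhdsWithin_le_nhds (Metric.ball_mem_nhds t hδ), Ioo_mem_nhdsLT ha]
    with s hs ⟨has, hst⟩
  have hdist : (t : ℝ) - s < δ := by
    rw [Metric.mem_ball', Subtype.dist_eq, Real.dist_eq] at hs
    exact (le_abs_self _).trans_lt hs
  refine ⟨hst.le, hdist, hX, ?_⟩
  refine (supNorm_le (C := δ / 2) (by linarith) fun u => ?_).trans_lt (by linarith)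
  have hs' : dist (X s) x < δ / 4 := hax ⟨has, hst⟩
  simp only [Pi.sub_apply, stopped]
  rcases le_or_gt u s with hus | hus
  · have hut : u < t := hus.trans_lt hst
    simp only [min_eq_right hut.le, min_eq_right hus, hut, if_true, sub_self, norm_zero]
    linarith
  · rw [min_eq_left hus.le]
    rcases lt_or_ge u t with hut | hut
    · have hu' : dist (X u) x < δ / 4 := hax ⟨has.trans hus, hut⟩
      rw [min_eq_right hut.le, if_pos hut, ← dist_eq_norm]
      linarith [dist_triangle_right (X u) (X s) x]
    · rw [min_eq_left hut, if_neg (lt_irrefl t), ← dist_eq_norm, dist_comm]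
      linarith

theorem LeftContinuous.tendsto_left (hF : LeftContinuous U S F) (hX : IsCadlag U X)
    (hA : IsCBV S A) (ht : (0 : ℝ) < t) {x : E d} (hx : x ∈ U) (hl : Tendsto X (𝓝[<] t) (𝓝 x)) :
    Tendsto (fun s => F s X A) (𝓝[<] t) (𝓝 (F t (fun u => if u < t then X u else x) A)) :=
  (leftContinuous_iff.1 hF t _ A ht (hX.ite_lt (.const hx) t) hA).comp
    (tendsto_nhdsLT_leftFilter hX ht hl)

theorem eventually_supNorm_stopped_sub_lt (hX : IsCadlag U X) (t : Time T) {δ : ℝ}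
    (hδ : 0 < δ) : ∀ᶠ u in 𝓝[≥] t, supNorm (stopped X t - stopped X u) < δ := by
  have hnear : ∀ᶠ u in 𝓝[≥] t, dist (X u) (X t) < δ / 2 :=
    Metric.tendsto_nhds.1 (hX.right t) _ (half_pos hδ)
  have hIcc : Tendsto (fun u => Set.Icc t u) (𝓝[≥] t) (𝓝[≥] t).smallSets :=
    (tendsto_const_nhdsWithin Set.self_mem_Ici).Icc tendsto_id
  filter_upwards [hIcc.eventually (eventually_smallSets_forall.2 hnear), self_mem_nhdsWithin]
    with u hu (htu : t ≤ u)
  refine (supNorm_le (half_pos hδ).le fun v => ?_).trans_lt (half_lt_self hδ)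
  simp only [Pi.sub_apply, stopped]
  rcases le_total v t with hvt | hvt
  · rw [min_eq_right hvt, min_eq_right (hvt.trans htu), sub_self, norm_zero]
    exact (half_pos hδ).le
  · rw [min_eq_left hvt, ← dist_eq_norm, dist_comm]
    exact (hu _ ⟨le_min htu hvt, min_le_left u v⟩).le

theorem MemC12c.tendsto_right [Fact (0 ≤ T)] (hF : MemC12c U S F) (hX : IsCadlag U X)
    (hA : IsCBV S A) (t : Time T) : Tendsto (fun u => F u X A) (𝓝[≥] t) (𝓝 (F t X A)) := by
  obtain ⟨D, hD, -⟩ := hF.horizontal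
  have hfrozen := hD.tendsto_right hX hA t
  rw [hF.nonAnticipative.stopped_left hX hA] at hfrozen
  suffices Tendsto (fun u => F u (stopped X t) A - F u X A) (𝓝[≥] t) (𝓝 0) by
    simpa using hfrozen.sub this
  refine Metric.tendsto_nhds.2 fun ε hε => ?_
  obtain ⟨δ, hδ, h⟩ := hF.continuousLocallyUniformly ε hε t _ A (hX.stopped t) hA
  filter_upwards [eventually_supNorm_stopped_sub_lt hX t hδ,
    nhdsWithin_le_nhds (Metric.ball_mem_nhds t hδ)] with u hXu hu
  rw [dist_zero_right, Real.norm_eq_abs, ← hF.nonAnticipative.stopped_left hX hA (t := u)]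
  rw [Metric.mem_ball', Subtype.dist_eq, Real.dist_eq] at hu
  exact h u _ (hX.stopped u) hXu hu

theorem nhdsLT_eq_bot_of_zero (ht : (t : ℝ) = 0) : 𝓝[<] t = ⊥ := by
  have : Set.Iio t = ∅ := Set.eq_empty_of_forall_notMem fun u (hu : u < t) =>
    (show (u : ℝ) < t from hu).not_ge (ht.trans_le u.2.1)
  rw [this, nhdsWithin_empty]

theorem ContinuousLocallyUniformly.eventually_forall (hF : ContinuousLocallyUniformly U S F)
    (hX : IsCadlag U X) (hA : IsCBV S A) {ε : ℝ} (hε : 0 < ε) :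
    ∀ᶠ δ in 𝓝[>] (0 : ℝ), ∀ Z, IsCadlag U Z → supNorm (X - Z) < δ →
      ∀ u, |F u X A - F u Z A| < ε := by
  have hunif : ∀ᶠ δ in 𝓝 (0 : ℝ), ∀ u ∈ Set.univ, ∀ Z, IsCadlag U Z → supNorm (X - Z) < δ →
      |F u X A - F u Z A| < ε := by
    refine isCompact_univ.eventually_forall_of_forall_eventually fun t _ => ?_
    obtain ⟨δ₀, hδ₀, h⟩ := hF ε hε t X A hX hA
    filter_upwards [prod_mem_nhds (Iio_mem_nhds hδ₀) (Metric.ball_mem_nhds t hδ₀)]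
      with ⟨δ, u⟩ ⟨hδ, hu⟩ Z hZ hXZ
    rw [Metric.mem_ball', Subtype.dist_eq, Real.dist_eq] at hu
    exact h u Z hZ (hXZ.trans hδ) hu
  exact (hunif.filter_mono nhdsWithin_le_nhds).mono fun δ h Z hZ hXZ u => h u trivial Z hZ hXZ

theorem NonAnticipative.stopped_left_of_le (hF : NonAnticipative U S F) (hX : IsCadlag U X)
    (hA : IsCBV S A) {s : Time T} (hst : s ≤ t) : F s (stopped X t) A = F s X A :=
  hF.congr (hX.stopped t) hX hA (by rw [stopped_stopped, min_eq_right hst])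

theorem MemC12c.eventually_fixedFilter_forall_abs_sub_lt (hF : MemC12c U S F)
    (hX : IsCadlag U X) (hA : IsCBV S A) (t : Time T) {ε : ℝ} (hε : 0 < ε) :
    ∀ᶠ Z in fixedFilter U t X, ∀ u, |F (min t u) X A - F (min t u) Z A| < ε := by
  obtain ⟨δ, h, hδ⟩ := ((hF.continuousLocallyUniformly.eventually_forall (hX.stopped t) hA hε).and
    self_mem_nhdsWithin).exists
  refine (fixedFilter_hasBasis U t X).eventually_iff.2 ⟨δ, hδ, fun Z ⟨hZ, hXZ⟩ u => ?_⟩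
  rw [← hF.nonAnticipative.stopped_left_of_le hX hA (min_le_left t u),
    ← hF.nonAnticipative.stopped_left_of_le hZ hA (min_le_left t u)]
  exact h _ (hZ.stopped t) hXZ _

theorem MemC12c.eventually_leftFilter_forall_abs_sub_lt (hF : MemC12c U S F)
    (hX : IsCadlag U X) (hA : IsCBV S A) (ht : (0 : ℝ) < t) {ε : ℝ} (hε : 0 < ε) :
    ∀ᶠ q in leftFilter U t X, ∀ u, |F (min t u) X A - F (min q.1 u) q.2 A| < ε := by
  obtain ⟨δ, h, hδ⟩ := ((hF.continuousLocallyUniformly.eventually_forall (hX.stopped t) hA hε).and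
    self_mem_nhdsWithin).exists
  have hclose : ∀ᶠ q in leftFilter U t X, |F t X A - F q.1 q.2 A| < ε / 2 := by
    filter_upwards [Metric.tendsto_nhds.1
      (leftContinuous_iff.1 hF.leftContinuous t X A ht hX hA) _ (half_pos hε)] with q hq
    rwa [dist_comm, Real.dist_eq] at hq
  filter_upwards [(leftFilter_hasBasis U t X).mem_of_mem hδ, hclose,
    eventually_leftFilter_forall_Icc hX hclose] with q ⟨hqt, _, hZ, hXZ⟩ hq hosc u
  rcases le_total u q.1 with hu | hu
  · rw [min_eq_right hu, min_eq_right (hu.trans hqt),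
      ← hF.nonAnticipative.stopped_left_of_le hX hA (hu.trans hqt),
      ← hF.nonAnticipative.stopped_left_of_le hZ hA hu]
    exact h _ (hZ.stopped q.1) hXZ u
  · have hmin := hosc (min t u) ⟨le_min hqt hu, min_le_left t u⟩
    rw [min_eq_left hu]
    rw [abs_lt] at hq hmin ⊢
    constructor <;> linarith

end PathLimits

section Image

variable {F : Fin ν → Functional T d m} {X : PathFn T d} {A : PathFn T m}

@[simp]
theorem imagePath_apply (F : Fin ν → Functional T d m) (X : PathFn T d) (A : PathFn T m)
    (t : Time T) (l : Fin ν) : imagePath F X A t l = F l t X A := rfl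

theorem exists_norm_lt_of_forall_abs_lt {ε : ℝ} (hε : 0 < ε) :
    ∃ ε' > 0, ∀ x : E ν, (∀ i, |x i| < ε') → ‖x‖ < ε := by
  have hc := (PiLp.continuous_toLp 2 (fun _ : Fin ν => ℝ)).continuousAt (x := 0)
  obtain ⟨ε', hε', h⟩ := Metric.continuousAt_iff.1 hc ε hε
  refine ⟨ε', hε', fun x hx => ?_⟩
  have := @h x.ofLp ((dist_pi_lt_iff hε').2 fun i => by simpa using hx i)
  simpa using this

theorem tendsto_imagePath {f : Filter (Time T)} {y : Fin ν → ℝ}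
    (h : ∀ l, Tendsto (fun u => F l u X A) f (𝓝 (y l))) :
    Tendsto (imagePath F X A) f (𝓝 (WithLp.toLp 2 y)) :=
  ((PiLp.continuous_toLp 2 (fun _ : Fin ν => ℝ)).tendsto y).comp (tendsto_pi_nhds.2 h)

theorem isCadlag_imagePath [Fact (0 ≤ T)] (hF : ∀ l, MemC12c U S (F l)) (hX : IsCadlag U X)
    (hA : IsCBV S A) : IsCadlag Set.univ (imagePath F X A) := by
  refine ⟨fun _ => Set.mem_univ _, fun t => tendsto_imagePath fun l =>
    (hF l).tendsto_right hX hA t, fun t => ?_⟩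
  rcases t.2.1.eq_or_lt with ht | ht
  · exact ⟨0, Set.mem_univ _, by rw [nhdsLT_eq_bot_of_zero ht.symm]; exact tendsto_bot⟩
  · obtain ⟨x, hx, hl⟩ := hX.left t
    exact ⟨_, Set.mem_univ _, tendsto_imagePath fun l =>
      (hF l).leftContinuous.tendsto_left hX hA ht hx hl⟩

theorem continuous_imagePath [Fact (0 ≤ T)] (hF : ∀ l, MemC12c U S (F l)) (hXc : Continuous X)
    (hXU : ∀ t, X t ∈ U) (hA : IsCBV S A) : Continuous (imagePath F X A) := by
  have hX := IsCadlag.of_continuous hXc hXU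
  refine continuous_iff_continuousAt.2 fun t => ?_
  rw [ContinuousAt, ← nhdsLT_sup_nhdsGE t, tendsto_sup]
  refine ⟨?_, (isCadlag_imagePath hF hX hA).right t⟩
  rcases t.2.1.eq_or_lt with ht | ht
  · rw [nhdsLT_eq_bot_of_zero ht.symm]
    exact tendsto_bot
  · refine tendsto_imagePath fun l => ?_
    have h := (hF l).leftContinuous.tendsto_left hX hA ht (hXU t)
      ((hXc.tendsto t).mono_left nhdsWithin_le_nhds)
    have hpath : (fun u => if u < t then X u else X t) = stopped X t := by
      ext u : 1
      rcases lt_or_ge u t with hu | hu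
      · simp [stopped, hu, hu.le]
      · simp [stopped, hu, hu.not_gt]
    rwa [hpath, (hF l).nonAnticipative.stopped_left hX hA] at h

theorem IsCadlag.of_isClosed {K : Set (E d)} (hK : IsClosed K) (hX : IsCadlag U X)
    (h : ∀ u, X u ∈ K) : IsCadlag K X := by
  refine ⟨h, hX.right, fun t => ?_⟩
  rcases (𝓝[<] t).eq_or_neBot with hb | hb
  · exact ⟨X t, h t, by rw [hb]; exact tendsto_bot⟩
  · obtain ⟨l, -, hl⟩ := hX.left t
    exact ⟨l, hK.mem_of_tendsto hl (Eventually.of_forall h), hl⟩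

theorem exists_compact_imagePath [Fact (0 ≤ T)] (hF : ∀ l, MemC12c U S (F l)) (hA : IsCBV S A)
    {K : Set (E d)} (hK : K ⊆ U) (hKc : IsCompact K) :
    ∃ K' : Set (E ν), IsCompact K' ∧ ∀ X, IsCadlag K X → IsCadlag K' (imagePath F X A) := by
  choose C hC using fun l => (hF l).boundednessPreserving A hA K hK hKc
  have hK' : IsCompact ((WithLp.toLp 2 : (Fin ν → ℝ) → E ν) ''
      Set.univ.pi fun l => Set.Icc (-C l) (C l)) :=
    (isCompact_univ_pi fun l => isCompact_Icc).image (PiLp.continuous_toLp 2 _)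
  exact ⟨_, hK', fun X hX => (isCadlag_imagePath hF (hX.mono hK) hA).of_isClosed hK'.isClosed
    fun u => ⟨_, fun l _ => abs_le.1 (hC l u X hX), rfl⟩⟩

theorem stopped_imagePath (hF : ∀ l, NonAnticipative U S (F l)) (hX : IsCadlag U X)
    (hA : IsCBV S A) {Y : PathFn T d} (hY : IsCadlag U Y) {B : PathFn T m} (hB : IsCBV S B)
    {t : Time T} (hXY : stopped X t = stopped Y t) (hAB : stopped A t = stopped B t) :
    stopped (imagePath F X A) t = stopped (imagePath F Y B) t := by
  ext u l
  simp only [stopped, imagePath_apply]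
  have hmin : ∀ {n : ℕ} {x y : PathFn T n}, stopped x t = stopped y t →
      stopped x (min t u) = stopped y (min t u) := fun {n x y} hxy => by
    simpa [stopped_stopped, ← min_assoc] using congrArg (fun z => stopped z (min t u)) hxy
  rw [hF l _ X A hX hA, hF l _ Y B hY hB, hmin hXY, hmin hAB]

variable [Fact (0 ≤ T)]

theorem tendsto_imagePath_fixedFilter (hF : ∀ l, MemC12c U S (F l)) (hX : IsCadlag U X)
    (hA : IsCBV S A) (t : Time T) :
    Tendsto (fun Z => imagePath F Z A) (fixedFilter U t X)
      (fixedFilter Set.univ t (imagePath F X A)) := by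
  refine (fixedFilter_hasBasis _ t _).tendsto_right_iff.2 fun ε (hε : 0 < ε) => ?_
  obtain ⟨ε', hε', hnorm⟩ := exists_norm_lt_of_forall_abs_lt (ν := ν) (half_pos hε)
  filter_upwards [(fixedFilter_hasBasis U t X).mem_of_mem (Set.mem_Ioi.2 one_pos),
    eventually_all.2 fun l => (hF l).eventually_fixedFilter_forall_abs_sub_lt hX hA t hε']
    with Z ⟨hZ, _⟩ hclose
  exact ⟨isCadlag_imagePath hF hZ hA, (supNorm_le (half_pos hε).le fun u =>
    (hnorm _ fun l => hclose l u).le).trans_lt (half_lt_self hε)⟩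

theorem tendsto_imagePath_leftFilter (hF : ∀ l, MemC12c U S (F l)) (hX : IsCadlag U X)
    (hA : IsCBV S A) {t : Time T} (ht : (0 : ℝ) < t) :
    Tendsto (fun q : Time T × PathFn T d => (q.1, imagePath F q.2 A)) (leftFilter U t X)
      (leftFilter Set.univ t (imagePath F X A)) := by
  refine (leftFilter_hasBasis _ t _).tendsto_right_iff.2 fun ε (hε : 0 < ε) => ?_
  obtain ⟨ε', hε', hnorm⟩ := exists_norm_lt_of_forall_abs_lt (ν := ν) (half_pos hε)
  filter_upwards [(leftFilter_hasBasis U t X).mem_of_mem (Set.mem_Ioi.2 hε),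
    eventually_all.2 fun l => (hF l).eventually_leftFilter_forall_abs_sub_lt hX hA ht hε']
    with q ⟨hqt, hqε, hZ, _⟩ hclose
  exact ⟨hqt, hqε, isCadlag_imagePath hF hZ hA, (supNorm_le (half_pos hε).le fun u =>
    (hnorm _ fun l => hclose l u).le).trans_lt (half_lt_self hε)⟩

omit [Fact (0 ≤ T)] in
theorem exists_supNorm_imagePath_sub_lt (hF : ∀ l, MemC12c U S (F l)) (hX : IsCadlag U X)
    (hA : IsCBV S A) {ε : ℝ} (hε : 0 < ε) :
    ∃ δ > 0, ∀ Z, IsCadlag U Z → supNorm (X - Z) < δ →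
      supNorm (imagePath F X A - imagePath F Z A) < ε := by
  obtain ⟨ε', hε', hnorm⟩ := exists_norm_lt_of_forall_abs_lt (ν := ν) (half_pos hε)
  obtain ⟨δ, h, hδ⟩ := ((eventually_all.2 fun l =>
    (hF l).continuousLocallyUniformly.eventually_forall hX hA hε').and self_mem_nhdsWithin).exists
  exact ⟨δ, hδ, fun Z hZ hXZ => (supNorm_le (half_pos hε).le fun u =>
    (hnorm _ fun l => h l Z hZ hXZ u).le).trans_lt (half_lt_self hε)⟩

end Image

end

/-! ### Composition of functionals -/

section

variable {T : ℝ} {d m ν p : ℕ} {U : Set (E d)} {S : Set (E m)} {W : Set (E p)}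

/-- The first `m` coordinates of a vector in `ℝ^(m+p)`. -/
def fstPart (c : E (m + p)) : E m := WithLp.toLp 2 fun i => c (Fin.castAdd p i)

/-- The last `p` coordinates of a vector in `ℝ^(m+p)`. -/
def sndPart (c : E (m + p)) : E p := WithLp.toLp 2 fun j => c (Fin.natAdd m j)

/-- The vector in `ℝ^(m+p)` with parts `a` and `b`. -/
def pairVec (a : E m) (b : E p) : E (m + p) := WithLp.toLp 2 (Fin.append a b)

@[simp]
theorem fstPart_apply (c : E (m + p)) (i : Fin m) : fstPart c i = c (Fin.castAdd p i) := rfl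

@[simp]
theorem sndPart_apply (c : E (m + p)) (j : Fin p) : sndPart c j = c (Fin.natAdd m j) := rfl

@[simp]
theorem fstPart_pairVec (a : E m) (b : E p) : fstPart (pairVec a b) = a := by
  ext i; simp [pairVec]

@[simp]
theorem sndPart_pairVec (a : E m) (b : E p) : sndPart (pairVec a b) = b := by
  ext i; simp [pairVec]

theorem continuous_fstPart : Continuous (fstPart : E (m + p) → E m) :=
  (PiLp.continuous_toLp 2 _).comp (continuous_pi fun i => by fun_prop)

theorem continuous_sndPart : Continuous (sndPart : E (m + p) → E p) :=
  (PiLp.continuous_toLp 2 _).comp (continuous_pi fun i => by fun_prop)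

/-- The product of `S` and `W` as a subset of `ℝ^(m+p)`. -/
def pairSet (S : Set (E m)) (W : Set (E p)) : Set (E (m + p)) :=
  {c | fstPart c ∈ S ∧ sndPart c ∈ W}

theorem isOpen_pairSet (hS : IsOpen S) (hW : IsOpen W) : IsOpen (pairSet S W) :=
  (hS.preimage continuous_fstPart).inter (hW.preimage continuous_sndPart)

theorem IsCBV.fstPart {C : PathFn T (m + p)} (hC : IsCBV (pairSet S W) C) :
    IsCBV S fun u => fstPart (C u) :=
  ⟨fun t => (hC.mem t).1, continuous_fstPart.comp hC.cont, fun _ => hC.bv _⟩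

theorem IsCBV.sndPart {C : PathFn T (m + p)} (hC : IsCBV (pairSet S W) C) :
    IsCBV W fun u => sndPart (C u) :=
  ⟨fun t => (hC.mem t).2, continuous_sndPart.comp hC.cont, fun _ => hC.bv _⟩

theorem IsCBV.pairVec {A : PathFn T m} {B : PathFn T p} (hA : IsCBV S A) (hB : IsCBV W B) :
    IsCBV (pairSet S W) fun u => pairVec (A u) (B u) := by
  refine ⟨fun t => ⟨by simpa using hA.mem t, by simpa using hB.mem t⟩,
    (PiLp.continuous_toLp 2 _).comp (continuous_pi fun i => ?_), fun i => ?_⟩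
  · refine Fin.addCases (fun i => ?_) (fun j => ?_) i
    · simpa using continuous_coord hA.cont i
    · simpa using continuous_coord hB.cont j
  · refine Fin.addCases (fun i => ?_) (fun j => ?_) i
    · simpa [FunctionalIto.pairVec] using hA.bv i
    · simpa [FunctionalIto.pairVec] using hB.bv j

/-- A functional of `(t, X, A)` regarded as a functional of `(t, X, (A, B))`. -/
def liftFunctional (p : ℕ) (Φ : Functional T d m) : Functional T d (m + p) :=
  fun t X C => Φ t X fun u => fstPart (C u)

/-- The functional `(t, X, (A, B)) ↦ Φ(t, F(·, X, A), B)`. -/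
def compFunctional (Φ : Functional T ν p) (F : Fin ν → Functional T d m) :
    Functional T d (m + p) :=
  fun t X C => Φ t (imagePath F X fun u => fstPart (C u)) fun u => sndPart (C u)

section Lift

variable {Φ : Functional T d m}

theorem Tame.lift (h : Tame U S Φ) (W : Set (E p)) : Tame U (pairSet S W) (liftFunctional p Φ) :=
  ⟨fun t X _ hX hC => h.1 t X _ hX hC.fstPart, fun _ hC => h.2 _ hC.fstPart⟩

theorem LeftContinuous.lift (h : LeftContinuous U S Φ) (W : Set (E p)) :
    LeftContinuous U (pairSet S W) (liftFunctional p Φ) :=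
  fun t ht ε hε X _ hX hC => h t ht ε hε X _ hX hC.fstPart

theorem ContinuousAtFixedTimes.lift (h : ContinuousAtFixedTimes U S Φ) (W : Set (E p)) :
    ContinuousAtFixedTimes U (pairSet S W) (liftFunctional p Φ) :=
  fun ε hε t X _ hX hC => h ε hε t X _ hX hC.fstPart

theorem VerticallyDifferentiable.lift (h : VerticallyDifferentiable U S Φ) (W : Set (E p)) :
    VerticallyDifferentiable U (pairSet S W) (liftFunctional p Φ) :=
  fun t X _ hX hC => h t X _ hX hC.fstPart

end Lift

section Comp

variable [Fact (0 ≤ T)] {Φ : Functional T ν p} {F : Fin ν → Functional T d m}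

theorem Tame.comp (h : Tame Set.univ W Φ) (hF : ∀ l, MemC12c U S (F l)) :
    Tame U (pairSet S W) (compFunctional Φ F) := by
  refine ⟨fun t X C hX hC => ?_, fun C hC K hK hKc => ?_⟩
  · have h1 := isCadlag_imagePath hF hX hC.fstPart
    have h2 := isCadlag_imagePath hF (hX.stopped t) (hC.stopped t).fstPart
    have h3 := stopped_imagePath (fun l => (hF l).nonAnticipative) hX hC.fstPart (hX.stopped t)
      (hC.stopped t).fstPart (t := t) (stopped_stopped_self X t).symm
      (stopped_stopped_self (fun u => FunctionalIto.fstPart (C u)) t).symm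
    change Φ t _ _ = Φ t _ (stopped (fun u => FunctionalIto.sndPart (C u)) t)
    rw [h.1.stopped_right h2 hC.sndPart]
    exact h.1.congr h1 h2 hC.sndPart h3
  · obtain ⟨K', hK', hKK'⟩ := exists_compact_imagePath hF hC.fstPart hK hKc
    obtain ⟨M, hM⟩ := h.2 _ hC.sndPart K' (Set.subset_univ _) hK'
    exact ⟨M, fun t X hX => hM t _ (hKK' X hX)⟩

theorem LeftContinuous.comp (h : LeftContinuous Set.univ W Φ) (hF : ∀ l, MemC12c U S (F l)) :
    LeftContinuous U (pairSet S W) (compFunctional Φ F) :=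
  leftContinuous_iff.2 fun t _ _ ht hX hC =>
    (leftContinuous_iff.1 h t _ _ ht (isCadlag_imagePath hF hX hC.fstPart) hC.sndPart).comp
      (tendsto_imagePath_leftFilter hF hX hC.fstPart ht)

theorem ContinuousAtFixedTimes.comp (h : ContinuousAtFixedTimes Set.univ W Φ)
    (hF : ∀ l, MemC12c U S (F l)) :
    ContinuousAtFixedTimes U (pairSet S W) (compFunctional Φ F) :=
  continuousAtFixedTimes_iff.2 fun t _ _ hX hC =>
    (continuousAtFixedTimes_iff.1 h t _ _ (isCadlag_imagePath hF hX hC.fstPart) hC.sndPart).comp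
      (tendsto_imagePath_fixedFilter hF hX hC.fstPart t)

theorem ContinuousLocallyUniformly.comp
    (h : ContinuousLocallyUniformly Set.univ W Φ) (hF : ∀ l, MemC12c U S (F l)) :
    ContinuousLocallyUniformly U (pairSet S W) (compFunctional Φ F) := by
  intro ε hε t X C hX hC
  obtain ⟨δ, hδ, h⟩ := h ε hε t _ _ (isCadlag_imagePath hF hX hC.fstPart) hC.sndPart
  obtain ⟨δ', hδ', h'⟩ := exists_supNorm_imagePath_sub_lt hF hX hC.fstPart hδ
  exact ⟨min δ δ', lt_min hδ hδ', fun u Y hY hXY htu => h u _ (isCadlag_imagePath hF hY hC.fstPart)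
    (h' Y hY (hXY.trans_le (min_le_right _ _))) (htu.trans_le (min_le_left _ _))⟩

theorem hasGradientAt_comp_sub {g : E ν → ℝ} {f : Fin ν → E d → ℝ} (hg : DifferentiableAt ℝ g 0)
    (hf : ∀ l, DifferentiableAt ℝ (f l) 0) :
    HasGradientAt (fun v => g (WithLp.toLp 2 fun l => f l v - f l 0))
      (∑ l, gradient g 0 l • gradient (f l) 0) 0 := by
  have h1 : HasFDerivAt (fun v => fun l => f l v - f l 0)
      (ContinuousLinearMap.pi fun l => InnerProductSpace.toDual ℝ (E d) (gradient (f l) 0)) 0 :=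
    hasFDerivAt_pi.2 fun l => (hf l).hasGradientAt.hasFDerivAt.sub_const _
  have h2 := (PiLp.hasFDerivAt_toLp 2 (𝕜 := ℝ) (fun l => f l 0 - f l 0)).comp
    (0 : E d) h1
  have h3 : HasFDerivAt g (InnerProductSpace.toDual ℝ (E ν) (gradient g 0))
      (WithLp.toLp 2 fun l => f l 0 - f l 0) := by
    have h0 : (WithLp.toLp 2 fun l => f l 0 - f l 0 : E ν) = 0 := by ext l; simp
    rw [h0]
    exact hg.hasGradientAt.hasFDerivAt
  have h4 := h3.comp (0 : E d) h2
  rw [hasGradientAt_iff_hasFDerivAt]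
  refine HasFDerivAt.congr_fderiv h4 (ContinuousLinearMap.ext fun v => ?_)
  have hgv : ∀ w, fderiv ℝ g 0 w = inner ℝ (gradient g 0) w := fun w => by simp
  simp [hgv, inner_eq_sum (gradient g 0)]

theorem hasGradientAt_sum_mul {f g : Fin ν → E d → ℝ} (hf : ∀ l, DifferentiableAt ℝ (f l) 0)
    (hg : ∀ l, DifferentiableAt ℝ (g l) 0) :
    HasGradientAt (fun v => ∑ l, f l v * g l v)
      (∑ l, (f l 0 • gradient (g l) 0 + g l 0 • gradient (f l) 0)) 0 := by
  have h := HasFDerivAt.fun_sum (u := Finset.univ) fun l _ =>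
    (hf l).hasGradientAt.hasFDerivAt.mul (hg l).hasGradientAt.hasFDerivAt
  rw [hasGradientAt_iff_hasFDerivAt]
  refine HasFDerivAt.congr_fderiv h (ContinuousLinearMap.ext fun v => ?_)
  simp

omit [Fact (0 ≤ T)] in
theorem stopped_imagePath_bump (hF : ∀ l, NonAnticipative U S (F l)) {t : Time T} {X : PathFn T d}
    {A : PathFn T m} {v : E d} (hX : IsCadlag U X) (hv : IsCadlag U (bump X t v))
    (hA : IsCBV S A) :
    stopped (imagePath F (bump X t v) (stopped A t)) t
      = stopped (bump (imagePath F X A) t (WithLp.toLp 2 fun l =>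
          F l t (bump X t v) (stopped A t) - F l t (bump X t 0) (stopped A t))) t := by
  ext u l
  simp only [stopped, bump_zero, imagePath_apply]
  rcases lt_or_ge u t with hu | hu
  · simp only [min_eq_right hu.le, bump, hu.not_ge, if_false, add_zero, imagePath_apply]
    have hpath : stopped (bump X t v) u = stopped X u := by
      ext w : 1
      simp [stopped, bump, hu]
    rw [hF l u _ _ hv (hA.stopped t), hF l u X A hX hA, hpath, stopped_stopped,
      min_eq_right hu.le]
  · simp only [min_eq_left hu, bump, le_refl, if_true, PiLp.add_apply, imagePath_apply]
    change F l t (bump X t v) (stopped A t) = F l t X A +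
      (F l t (bump X t v) (stopped A t) - F l t X (stopped A t))
    rw [(hF l).stopped_right hX hA]
    ring

theorem hasGradientAt_compFunctional (hU : IsOpen U) (hΦ : NonAnticipative Set.univ W Φ)
    (hΦv : VerticallyDifferentiable Set.univ W Φ) (hF : ∀ l, MemC12c U S (F l)) {t : Time T}
    {X : PathFn T d} {C : PathFn T (m + p)} (hX : IsCadlag U X) (hC : IsCBV (pairSet S W) C) :
    HasGradientAt (fun v => compFunctional Φ F t (bump X t v) (stopped C t))
      (∑ l, compFunctional (vpartial l Φ) F t X C •
        vgrad (F l) t X fun u => fstPart (C u)) 0 := by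
  have hY := isCadlag_imagePath hF hX hC.fstPart
  refine (hasGradientAt_comp_sub (hΦv t _ _ hY hC.sndPart)
    fun l => (hF l).vertical t X _ hX hC.fstPart).congr_of_eventuallyEq ?_
  filter_upwards [hX.eventually_bump hU t] with v hv
  exact hΦ.congr (isCadlag_imagePath hF hv (hC.stopped t).fstPart)
    (hY.bump (U := Set.univ) t _ (Set.subset_univ _) fun _ _ => Set.mem_univ _)
    (hC.stopped t).sndPart
    (stopped_imagePath_bump (fun l => (hF l).nonAnticipative) hX hv hC.fstPart)

theorem VerticallyDifferentiable.comp (hU : IsOpen U) (hΦ : NonAnticipative Set.univ W Φ)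
    (hΦv : VerticallyDifferentiable Set.univ W Φ) (hF : ∀ l, MemC12c U S (F l)) :
    VerticallyDifferentiable U (pairSet S W) (compFunctional Φ F) :=
  fun _ _ _ hX hC => (hasGradientAt_compFunctional hU hΦ hΦv hF hX hC).differentiableAt

theorem vgrad_compFunctional (hU : IsOpen U) (hΦ : NonAnticipative Set.univ W Φ)
    (hΦv : VerticallyDifferentiable Set.univ W Φ) (hF : ∀ l, MemC12c U S (F l)) {t : Time T}
    {X : PathFn T d} {C : PathFn T (m + p)} (hX : IsCadlag U X) (hC : IsCBV (pairSet S W) C) :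
    vgrad (compFunctional Φ F) t X C
      = ∑ l, compFunctional (vpartial l Φ) F t X C • vgrad (F l) t X fun u => fstPart (C u) :=
  (hasGradientAt_compFunctional hU hΦ hΦv hF hX hC).gradient

theorem vpartial_compFunctional (hU : IsOpen U) (hΦ : NonAnticipative Set.univ W Φ)
    (hΦv : VerticallyDifferentiable Set.univ W Φ) (hF : ∀ l, MemC12c U S (F l)) (k : Fin d)
    {t : Time T} {X : PathFn T d} {C : PathFn T (m + p)} (hX : IsCadlag U X)
    (hC : IsCBV (pairSet S W) C) :
    vpartial k (compFunctional Φ F) t X C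
      = ∑ l, compFunctional (vpartial l Φ) F t X C * liftFunctional p (vpartial k (F l)) t X C := by
  simp only [vpartial, vgrad_compFunctional hU hΦ hΦv hF hX hC]
  simp [liftFunctional, compFunctional, vpartial]

end Comp

section SecondOrder

variable {Φ Ψ : Functional T d m}

theorem hasGradientAt_congr (hU : IsOpen U)
    (h : ∀ t X A, IsCadlag U X → IsCBV S A → Φ t X A = Ψ t X A) {t : Time T}
    {X : PathFn T d} {A : PathFn T m} (hX : IsCadlag U X) (hA : IsCBV S A) {g : E d}
    (hg : HasGradientAt (fun v => Ψ t (bump X t v) (stopped A t)) g 0) :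
    HasGradientAt (fun v => Φ t (bump X t v) (stopped A t)) g 0 := by
  refine hg.congr_of_eventuallyEq ?_
  filter_upwards [hX.eventually_bump hU t] with v hv
  exact h t _ _ hv (hA.stopped t)

variable [Fact (0 ≤ T)] {G : Functional T ν p} {F : Fin ν → Functional T d m}

theorem hasGradientAt_vpartial_compFunctional (hU : IsOpen U) (hG : MemC12c Set.univ W G)
    (hF : ∀ l, MemC12c U S (F l)) (j : Fin d) {t : Time T} {X : PathFn T d}
    {C : PathFn T (m + p)} (hX : IsCadlag U X) (hC : IsCBV (pairSet S W) C) :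
    HasGradientAt (fun v => vpartial j (compFunctional G F) t (bump X t v) (stopped C t))
      (∑ l, (compFunctional (vpartial l G) F t X C •
          vgrad (vpartial j (F l)) t X (fun u => fstPart (C u))
        + liftFunctional p (vpartial j (F l)) t X C •
          ∑ k, compFunctional (vpartial k (vpartial l G)) F t X C •
            vgrad (F k) t X fun u => fstPart (C u))) 0 := by
  have hGn := fun l => hG.nonAnticipative.vpartial isOpen_univ l
  refine hasGradientAt_congr hU (Ψ := fun t X C => ∑ l, compFunctional (vpartial l G) F t X C *
    liftFunctional p (vpartial j (F l)) t X C)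
    (fun t X C hX hC => vpartial_compFunctional hU hG.nonAnticipative hG.vertical hF j hX hC)
    hX hC ?_
  have h := hasGradientAt_sum_mul
    (fun l => VerticallyDifferentiable.comp hU (hGn l) (hG.vertical₂ l) hF t X C hX hC)
    (fun l => ((hF l).vertical₂ j).lift W t X C hX hC)
  convert h using 1
  refine Finset.sum_congr rfl fun l _ => ?_
  rw [bump_zero, ((hG.tame_vpartial isOpen_univ l).comp hF).1.stopped_right hX hC,
    (((hF l).tame_vpartial hU j).lift W).1.stopped_right hX hC]
  congr 2
  exact (vgrad_compFunctional hU (hGn l) (hG.vertical₂ l) hF hX hC).symm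

theorem vpartial_vpartial_compFunctional (hU : IsOpen U) (hG : MemC12c Set.univ W G)
    (hF : ∀ l, MemC12c U S (F l)) (i j : Fin d) {t : Time T} {X : PathFn T d}
    {C : PathFn T (m + p)} (hX : IsCadlag U X) (hC : IsCBV (pairSet S W) C) :
    vpartial i (vpartial j (compFunctional G F)) t X C
      = (∑ l, compFunctional (vpartial l G) F t X C *
          liftFunctional p (vpartial i (vpartial j (F l))) t X C)
        + ∑ l, liftFunctional p (vpartial j (F l)) t X C *
          ∑ k, compFunctional (vpartial k (vpartial l G)) F t X C *
            liftFunctional p (vpartial i (F k)) t X C := by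
  rw [vpartial, vgrad, (hasGradientAt_vpartial_compFunctional hU hG hF j hX hC).gradient,
    ← Finset.sum_add_distrib]
  simp [liftFunctional, compFunctional, vpartial]

end SecondOrder

end

/-! ### The horizontal derivative of a composition -/

section

section InsertPt

variable {T : ℝ} [Fact (0 ≤ T)]

/-- The sequence of partitions with the point `s` added. -/
def PartitionSeq.insertPt (P : PartitionSeq T) (s : Time T) : PartitionSeq T where
  pts n := insert s (P.pts n)
  zero_mem n := (P.zero_mem n).imp fun _ h => ⟨Finset.mem_insert_of_mem h.1, h.2⟩
  top_mem n := (P.top_mem n).imp fun _ h => ⟨Finset.mem_insert_of_mem h.1, h.2⟩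
  mono _ _ h := Finset.insert_subset_insert s (P.mono h)
  mesh ε hε := by
    filter_upwards [P.eventually_mesh_lt hε] with n hn r _
    refine lt_of_le_of_lt (sub_le_sub_right (Subtype.coe_le_coe.2 ?_) _) (hn r).1
    have hP := P.isPartition n
    rcases (le_top (a := r)).lt_or_eq with hr | rfl
    · exact succPt_le (Finset.mem_insert_of_mem (hP.succPt_mem r)) (hP.lt_succPt hr)
    · exact le_top.trans (le_succPt _ _)

theorem PartitionSeq.mem_insertPt (P : PartitionSeq T) (s : Time T) (n : ℕ) :
    s ∈ (P.insertPt s).pts n := Finset.mem_insert_self _ _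

end InsertPt

section BoundedVariation

variable {T : ℝ} {d m : ℕ} {U : Set (E d)} {S : Set (E m)} {Φ F : Functional T d m}
  {D : Fin (m + 1) → Functional T d m} {Z : PathFn T d} {B : PathFn T m} {s t : Time T}

theorem sum_inner_vgrad_eq_sum_sampleFrom {P : Finset (Time T)} (hs : s ∈ P) :
    ∑ r ∈ P with r ≤ t, inner ℝ (vgrad F r (approxFrom s P Z r) B)
        (Z (max s (succPt P r)) - Z (max s r))
      = ∑ l, ∑ r ∈ P with r ≤ t, sampleFrom (vpartial l F) B s P Z (fun _ => 0) r
          * (Z (max s (succPt P r)) l - Z (max s r) l) := by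
  rw [Finset.sum_comm]
  refine Finset.sum_congr rfl fun r _ => ?_
  rcases le_or_gt s r with hsr | hrs
  · simp only [sampleFrom, if_pos hsr, approxInterp_zero, inner_eq_sum]
    rfl
  · rw [max_eq_left (succPt_le hs hrs), max_eq_left hrs.le]
    simp

variable [Fact (0 ≤ T)] {P : PartitionSeq T}

theorem LeftContinuous.tendsto_sum_sampleFrom (hΦ : LeftContinuous U S Φ)
    (hΦb : BoundednessPreserving U S Φ) (hU : IsOpen U) (hZ : IsCadlag U Z)
    (hZc : Continuous fun u => Z (max s u)) (hB : IsCBV S B) {g : Time T → ℝ}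
    (hg : IsContBV g) :
    Tendsto (fun n => ∑ r ∈ P.pts n with r ≤ t,
      sampleFrom Φ B s (P.pts n) Z (fun _ => 0) r * (g (succPt (P.pts n) r) - g r)) atTop
      (𝓝 (lsIntegral (fun u => Φ u Z B) g (Set.Ioc s t))) := by
  have hθ : ∀ (_ : ℕ) (_ : Time T), (0 : ℝ) ∈ Set.Icc (0 : ℝ) 1 := fun _ _ => by simp
  obtain ⟨C, hC⟩ := hΦb.exists_abs_sampleFrom_le (P := P) hU hZ hZc hB hθ
  have hlim := ((hΦ.leftUniformTendsto (P := P) hU hZ hZc hB hθ).cutoff t).tendsto_sum_stieltjes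
    (Set.countable_singleton s) (C := C) (by
      filter_upwards [hC] with n hn r hr
      split_ifs
      · exact hn r hr
      · exact abs_zero.trans_le ((abs_nonneg _).trans (hn r hr))) hg
  have hind : (fun u => if u ≤ t then (Set.Ioi s).indicator (fun u => Φ u Z B) u else 0)
      = (Set.Ioc s t).indicator fun u => Φ u Z B := by
    rw [← Set.Iic_inter_Ioi, ← Set.indicator_indicator]
    rfl
  rw [hind, lsIntegral_indicator measurableSet_Ioi measurableSet_Ioc, Set.inter_eq_right.2
    (Set.Ioc_subset_Ioi_self.trans (Set.Ioi_subset_Ioi bot_le))] at hlim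
  simpa only [Finset.sum_filter, ite_mul, zero_mul] using hlim

/-- Itô's formula; its second order terms vanish because the integrators `[Z_i,Z_j]` do. -/
theorem MemC12c.sub_eq_sum_lsIntegral_of_isContBV (P : PartitionSeq T) (hF : MemC12c U S F)
    (hD : IsHorizontalDeriv U S F D) (hDc : ∀ i, ContinuousAtFixedTimes U S (D i))
    (hU : IsOpen U) (hZ : IsCadlag U Z) (hZbv : ∀ l, IsContBV fun u => Z (max s u) l)
    (hB : IsCBV S B) (hst : s ≤ t) :
    F t Z B - F s Z B
      = (∑ l, lsIntegral (fun u => vpartial l F u Z B) (fun u => Z (max s u) l) (Set.Ioc s t))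
        + ∑ i, lsIntegral (fun u => D i u Z B) (withTime B i) (Set.Ioc s t) := by
  have hZc : Continuous fun u => Z (max s u) :=
    (PiLp.continuous_toLp 2 _).comp (continuous_pi fun l => (hZbv l).cont)
  have hito := ito_formula hF hD hDc hU (P.mem_insertPt s) hZ hZc hB (.zero_of_isContBV hZbv) hst
  have hsum := tendsto_finsetSum Finset.univ fun l _ =>
    (hF.vpartial_leftContinuous l).tendsto_sum_sampleFrom (P := P.insertPt s) (t := t)
      (hF.vpartial_boundednessPreserving l) hU hZ hZc hB (hZbv l)
  have heq := tendsto_nhds_unique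
    (hito.congr fun n => sum_inner_vgrad_eq_sum_sampleFrom (P.mem_insertPt s n)) hsum
  have hzero : ∀ i j, lsIntegral (fun u => vpartial i (vpartial j F) u Z B) (fun _ => 0)
      (Set.Ioc s t) = 0 := fun i j =>
    lsIntegral_zero_right measurableSet_Ioc
      (((hF.vpartial₂_leftContinuous i j).bddMeasOn (hF.vpartial₂_boundednessPreserving i j) P hU
        hZ hZc hB).mono measurableSet_Ioc Set.Ioc_subset_Ioi_self)
  simp only [hzero, Finset.sum_const_zero, mul_zero, sub_zero] at heq
  linarith

end BoundedVariation

variable {T : ℝ} [Fact (0 ≤ T)] {d m ν p : ℕ} {U : Set (E d)} {S : Set (E m)} {W : Set (E p)}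

section Frozen

variable {F : Functional T d m} {D : Fin (m + 1) → Functional T d m}
  {X : PathFn T d} {A : PathFn T m} {s t : Time T}

theorem IsHorizontalDeriv.bddMeasOn_indicator_stopped (hD : IsHorizontalDeriv U S F D)
    (hX : IsCadlag U X) (hA : IsCBV S A) (s : Time T) (i : Fin (m + 1)) :
    BddMeasOn ((Set.Ioi s).indicator fun r => D i r (FunctionalIto.stopped X s) A) Set.univ :=
  ((hD.bddMeasOn_stopped hX hA i s ⊤).mono measurableSet_Ioi (Set.Ioc_top (a := s)).ge).indicator

theorem IsHorizontalDeriv.frozen_sub_eq (hD : IsHorizontalDeriv U S F D) (hX : IsCadlag U X)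
    (hA : IsCBV S A) (s b : Time T) :
    F (max s b) (FunctionalIto.stopped X s) A - F (max s ⊥) (FunctionalIto.stopped X s) A
      = ∑ i, FunctionalIto.lsIntegral
          ((Set.Ioi s).indicator fun r => D i r (FunctionalIto.stopped X s) A)
          (withTime A i) (Set.Iic b) := by
  simp only [lsIntegral_indicator measurableSet_Iic measurableSet_Ioi, Set.Iic_inter_Ioi,
    max_bot_right]
  rcases le_total s b with hb | hb
  · rw [max_eq_right hb, hD.sub_eq_sum_lsIntegral hX hA hb]
  · simp [max_eq_left hb, Set.Ioc_eq_empty hb.not_gt, lsIntegral_empty]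

theorem IsHorizontalDeriv.isContBV_frozen (hD : IsHorizontalDeriv U S F D) (hX : IsCadlag U X)
    (hA : IsCBV S A) (s : Time T) :
    IsContBV fun u => F (max s u) (FunctionalIto.stopped X s) A :=
  .of_sub_eq_sum_lsIntegral (fun i => hA.isContBV_withTime i)
    (fun i => hD.bddMeasOn_indicator_stopped hX hA s i) fun b => hD.frozen_sub_eq hX hA s b

theorem IsHorizontalDeriv.lsIntegral_frozen (hD : IsHorizontalDeriv U S F D) (hX : IsCadlag U X)
    (hA : IsCBV S A) {f : Time T → ℝ} (hf : BddMeasOn f (Set.Ioc s t)) :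
    FunctionalIto.lsIntegral f (fun u => F (max s u) (FunctionalIto.stopped X s) A) (Set.Ioc s t)
      = ∑ i, FunctionalIto.lsIntegral (fun u => f u * D i u (FunctionalIto.stopped X s) A)
          (withTime A i) (Set.Ioc s t) := by
  rw [lsIntegral_of_sub_eq_sum_lsIntegral (fun i => hA.isContBV_withTime i)
    (fun i => hD.bddMeasOn_indicator_stopped hX hA s i) (fun b => hD.frozen_sub_eq hX hA s b)
    measurableSet_Ioc hf]
  refine Finset.sum_congr rfl fun i _ => lsIntegral_congr _ fun u hu => ?_
  simp only [Set.indicator_of_mem (Set.mem_Ioi.2 hu.1)]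

end Frozen

/-- The horizontal derivative of `(t, X, (A, B)) ↦ G(t, F(·, X, A), B)`, its components ordered as
time, `A`, `B`. -/
def compDeriv (G : Functional T ν p) (DG : Fin (p + 1) → Functional T ν p)
    (F : Fin ν → Functional T d m) (D : Fin ν → Fin (m + 1) → Functional T d m) :
    Fin (m + p + 1) → Functional T d (m + p) :=
  Fin.cons
    (fun t X C => (∑ l, compFunctional (vpartial l G) F t X C * liftFunctional p (D l 0) t X C)
      + compFunctional (DG 0) F t X C)
    (Fin.addCases
      (fun i t X C => ∑ l, compFunctional (vpartial l G) F t X C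
        * liftFunctional p (D l i.succ) t X C)
      fun j => compFunctional (DG j.succ) F)

section CompDeriv

variable {G : Functional T ν p} {DG : Fin (p + 1) → Functional T ν p}
  {F : Fin ν → Functional T d m} {D : Fin ν → Fin (m + 1) → Functional T d m}
  {s t : Time T} {X : PathFn T d} {C : PathFn T (m + p)}

omit [Fact (0 ≤ T)] in
theorem compDeriv_cases {motive : Functional T d (m + p) → Prop}
    (left : ∀ i, motive fun t X C => ∑ l, compFunctional (vpartial l G) F t X C
      * liftFunctional p (D l i) t X C)
    (right : ∀ j, motive (compFunctional (DG j) F))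
    (add : ∀ Φ Ψ : Functional T d (m + p), motive Φ → motive Ψ →
      motive fun t X C => Φ t X C + Ψ t X C) (i : Fin (m + p + 1)) :
    motive (compDeriv G DG F D i) := by
  refine Fin.cases (add _ _ (left 0) (right 0)) (Fin.addCases (fun i => ?_) fun j => ?_) i
  · simpa [compDeriv] using left i.succ
  · simpa [compDeriv] using right j.succ

omit [Fact (0 ≤ T)] in
theorem sum_lsIntegral_compDeriv {J : Set (Time T)} (hJ : MeasurableSet J)
    (hG : ∀ l, BddMeasOn (fun u => compFunctional (vpartial l G) F u X C) J)
    (hD : ∀ l i, BddMeasOn (fun u => liftFunctional p (D l i) u X C) J)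
    (hDG : ∀ j, BddMeasOn (fun u => compFunctional (DG j) F u X C) J) :
    ∑ i, lsIntegral (fun u => compDeriv G DG F D i u X C) (withTime C i) J
      = (∑ l, ∑ i, lsIntegral (fun u => compFunctional (vpartial l G) F u X C
          * liftFunctional p (D l i) u X C) (withTime (fun u => fstPart (C u)) i) J)
        + ∑ j, lsIntegral (fun u => compFunctional (DG j) F u X C)
          (withTime (fun u => sndPart (C u)) j) J := by
  have hmul : ∀ i, ∀ l ∈ Finset.univ, BddMeasOn (fun u => compFunctional (vpartial l G) F u X C
      * liftFunctional p (D l i) u X C) J := fun i l _ => (hG l).mul (hD l i)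
  rw [Finset.sum_comm, Finset.sum_congr rfl fun i _ =>
    (lsIntegral_sum Finset.univ (withTime (fun u => fstPart (C u)) i) hJ (hmul i)).symm,
    Fin.sum_univ_succ, Fin.sum_univ_add, Fin.sum_univ_succ (n := m), Fin.sum_univ_succ (n := p)]
  simp only [compDeriv, withTime, Fin.cons_zero, Fin.cons_succ, Fin.addCases_left,
    Fin.addCases_right, fstPart_apply, sndPart_apply]
  rw [lsIntegral_add _ hJ (.sum _ hJ (hmul 0)) (hDG 0)]
  ring

theorem isContBV_imagePath_frozen (hD : ∀ l, IsHorizontalDeriv U S (F l) (D l))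
    (hX : IsCadlag U X) {A : PathFn T m} (hA : IsCBV S A) (l : Fin ν) :
    IsContBV fun u => imagePath F (stopped X s) A (max s u) l :=
  (hD l).isContBV_frozen hX hA s

theorem continuous_imagePath_frozen (hD : ∀ l, IsHorizontalDeriv U S (F l) (D l))
    (hX : IsCadlag U X) {A : PathFn T m} (hA : IsCBV S A) :
    Continuous fun u => imagePath F (stopped X s) A (max s u) :=
  (PiLp.continuous_toLp 2 _).comp
    (continuous_pi fun l => (isContBV_imagePath_frozen hD hX hA l).cont)

theorem bddMeasOn_vpartial_frozen (P : PartitionSeq T) (hG : MemC12c Set.univ W G)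
    (hF : ∀ l, MemC12c U S (F l)) (hD : ∀ l, IsHorizontalDeriv U S (F l) (D l))
    (hX : IsCadlag U X) (hC : IsCBV (pairSet S W) C) (s t : Time T) (l : Fin ν) :
    BddMeasOn (fun u => compFunctional (vpartial l G) F u (stopped X s) C) (Set.Ioc s t) :=
  ((hG.vpartial_leftContinuous l).bddMeasOn (hG.vpartial_boundednessPreserving l) P isOpen_univ
    (isCadlag_imagePath hF (hX.stopped s) hC.fstPart) (continuous_imagePath_frozen hD hX hC.fstPart)
    hC.sndPart).mono measurableSet_Ioc Set.Ioc_subset_Ioi_self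

theorem bddMeasOn_horizontal_frozen (P : PartitionSeq T) (hDG : IsHorizontalDeriv Set.univ W G DG)
    (hDGc : ∀ i, ContinuousAtFixedTimes Set.univ W (DG i)) (hF : ∀ l, MemC12c U S (F l))
    (hD : ∀ l, IsHorizontalDeriv U S (F l) (D l)) (hX : IsCadlag U X)
    (hC : IsCBV (pairSet S W) C) (s t : Time T) (j : Fin (p + 1)) :
    BddMeasOn (fun u => compFunctional (DG j) F u (stopped X s) C) (Set.Ioc s t) :=
  hDG.bddMeasOn hDGc (P.mem_insertPt s) (isCadlag_imagePath hF (hX.stopped s) hC.fstPart)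
    (continuous_imagePath_frozen hD hX hC.fstPart) hC.sndPart j t

theorem tame_compDeriv (hG : MemC12c Set.univ W G) (hDG : IsHorizontalDeriv Set.univ W G DG)
    (hF : ∀ l, MemC12c U S (F l)) (hD : ∀ l, IsHorizontalDeriv U S (F l) (D l)) :
    ∀ i, Tame U (pairSet S W) (compDeriv G DG F D i) :=
  compDeriv_cases
    (fun i => .sum_mul _ (fun l _ => (hG.tame_vpartial isOpen_univ l).comp hF)
      fun l _ => ((hD l).tame i).lift W)
    (fun j => (hDG.tame j).comp hF) fun _ _ => .add

/-- The path `u ↦ F(u, X^s, A)` is continuous of bounded variation on `[s, T]`, so the ordinary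
change of variables formula applies to `G` along it. -/
theorem isHorizontalDeriv_compDeriv (P : PartitionSeq T) (hG : MemC12c Set.univ W G)
    (hDG : IsHorizontalDeriv Set.univ W G DG)
    (hDGc : ∀ i, ContinuousAtFixedTimes Set.univ W (DG i)) (hF : ∀ l, MemC12c U S (F l))
    (hD : ∀ l, IsHorizontalDeriv U S (F l) (D l)) :
    IsHorizontalDeriv U (pairSet S W) (compFunctional G F) (compDeriv G DG F D) where
  nonAnticipative i := (tame_compDeriv hG hDG hF hD i).1
  boundednessPreserving i := (tame_compDeriv hG hDG hF hD i).2
  measurable i s t X C _ hX hC := by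
    have hmeas : BddMeasOn (fun u => compDeriv G DG F D i u (stopped X s) C) (Set.Ioc s t) :=
      compDeriv_cases (motive := fun Φ => BddMeasOn (fun u => Φ u (stopped X s) C) (Set.Ioc s t))
        (fun i => .sum _ measurableSet_Ioc fun l _ =>
          (bddMeasOn_vpartial_frozen P hG hF hD hX hC s t l).mul
            ((hD l).bddMeasOn_stopped hX hC.fstPart i s t))
        (bddMeasOn_horizontal_frozen P hDG hDGc hF hD hX hC s t) (fun _ _ => .add) i
    refine (hmeas.insert s).measurable_comp_subtypeVal fun u hu => ?_
    exact (eq_or_lt_of_le hu.1).imp Eq.symm fun h => ⟨h, hu.2⟩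
  integral_eq s t X C hst hX hC := by
    have hGm := bddMeasOn_vpartial_frozen P hG hF hD hX hC s t
    rw [sum_lsIntegral_compDeriv measurableSet_Ioc hGm
      (fun l i => (hD l).bddMeasOn_stopped hX hC.fstPart i s t)
      (bddMeasOn_horizontal_frozen P hDG hDGc hF hD hX hC s t)]
    refine (hG.sub_eq_sum_lsIntegral_of_isContBV P hDG hDGc isOpen_univ
      (isCadlag_imagePath hF (hX.stopped s) hC.fstPart)
      (isContBV_imagePath_frozen hD hX hC.fstPart) hC.sndPart hst.le).trans
      (congrArg (· + _) (Finset.sum_congr rfl fun l _ => ?_))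
    exact (hD l).lsIntegral_frozen hX hC.fstPart (hGm l)

theorem continuousAtFixedTimes_compDeriv (hG : MemC12c Set.univ W G)
    (hDGc : ∀ i, ContinuousAtFixedTimes Set.univ W (DG i)) (hF : ∀ l, MemC12c U S (F l))
    (hDc : ∀ l i, ContinuousAtFixedTimes U S (D l i)) :
    ∀ i, ContinuousAtFixedTimes U (pairSet S W) (compDeriv G DG F D i) :=
  compDeriv_cases
    (fun i => .sum_mul _
      (fun l _ => ((hG.vpartial_leftContinuous l).continuousAtFixedTimes
        (hG.nonAnticipative.vpartial isOpen_univ l) (hG.vertical₂ l)).comp hF)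
      fun l _ => (hDc l i).lift W)
    (fun j => (hDGc j).comp hF) fun _ _ => .add

theorem leftContinuous_vpartial_compFunctional (hU : IsOpen U) (hG : MemC12c Set.univ W G)
    (hF : ∀ l, MemC12c U S (F l)) (i : Fin d) :
    LeftContinuous U (pairSet S W) (vpartial i (compFunctional G F)) :=
  (LeftContinuous.sum_mul Finset.univ (fun l _ => (hG.vpartial_leftContinuous l).comp hF)
    fun l _ => ((hF l).vpartial_leftContinuous i).lift W).congr
    fun _ _ _ => vpartial_compFunctional hU hG.nonAnticipative hG.vertical hF i

theorem boundednessPreserving_vpartial_compFunctional (hU : IsOpen U)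
    (hG : MemC12c Set.univ W G) (hF : ∀ l, MemC12c U S (F l)) (i : Fin d) :
    BoundednessPreserving U (pairSet S W) (vpartial i (compFunctional G F)) :=
  (Tame.sum_mul Finset.univ (fun l _ => (hG.tame_vpartial isOpen_univ l).comp hF)
    fun l _ => ((hF l).tame_vpartial hU i).lift W).2.congr
    fun _ _ _ => vpartial_compFunctional hU hG.nonAnticipative hG.vertical hF i

theorem leftContinuous_vpartial₂_compFunctional (hU : IsOpen U) (hG : MemC12c Set.univ W G)
    (hF : ∀ l, MemC12c U S (F l)) (i j : Fin d) :
    LeftContinuous U (pairSet S W) (vpartial i (vpartial j (compFunctional G F))) :=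
  ((LeftContinuous.sum_mul Finset.univ (fun l _ => (hG.vpartial_leftContinuous l).comp hF)
    fun l _ => ((hF l).vpartial₂_leftContinuous i j).lift W).add
    (.sum_mul Finset.univ (fun l _ => ((hF l).vpartial_leftContinuous j).lift W)
      fun l _ => .sum_mul Finset.univ (fun k _ => (hG.vpartial₂_leftContinuous k l).comp hF)
        fun k _ => ((hF k).vpartial_leftContinuous i).lift W)).congr
    fun _ _ _ => vpartial_vpartial_compFunctional hU hG hF i j

theorem boundednessPreserving_vpartial₂_compFunctional (hU : IsOpen U)
    (hG : MemC12c Set.univ W G) (hF : ∀ l, MemC12c U S (F l)) (i j : Fin d) :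
    BoundednessPreserving U (pairSet S W) (vpartial i (vpartial j (compFunctional G F))) :=
  ((Tame.sum_mul Finset.univ (fun l _ => (hG.tame_vpartial isOpen_univ l).comp hF)
    fun l _ => ((hF l).tame_vpartial₂ hU i j).lift W).add
    (.sum_mul Finset.univ (fun l _ => ((hF l).tame_vpartial hU j).lift W)
      fun l _ => .sum_mul Finset.univ (fun k _ => (hG.tame_vpartial₂ isOpen_univ k l).comp hF)
        fun k _ => ((hF k).tame_vpartial hU i).lift W)).2.congr
    fun _ _ _ => vpartial_vpartial_compFunctional hU hG hF i j

theorem MemC12c.comp (P : PartitionSeq T) (hU : IsOpen U) (hG : MemC12c Set.univ W G)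
    (hF : ∀ l, MemC12c U S (F l)) : MemC12c U (pairSet S W) (compFunctional G F) := by
  obtain ⟨DG, hDG, hDGc⟩ := hG.horizontal
  choose D hD hDc using fun l => (hF l).horizontal
  exact
    { nonAnticipative := (hG.tame.comp hF).1
      leftContinuous := hG.leftContinuous.comp hF
      horizontal := ⟨_, isHorizontalDeriv_compDeriv P hG hDG hDGc hF hD,
        continuousAtFixedTimes_compDeriv hG hDGc hF hDc⟩
      vertical := .comp hU hG.nonAnticipative hG.vertical hF
      vertical₂ := fun j _ _ _ hX hC =>
        (hasGradientAt_vpartial_compFunctional hU hG hF j hX hC).differentiableAt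
      vpartial_leftContinuous := leftContinuous_vpartial_compFunctional hU hG hF
      vpartial_boundednessPreserving := boundednessPreserving_vpartial_compFunctional hU hG hF
      vpartial₂_leftContinuous := leftContinuous_vpartial₂_compFunctional hU hG hF
      vpartial₂_boundednessPreserving := boundednessPreserving_vpartial₂_compFunctional hU hG hF
      continuousLocallyUniformly := hG.continuousLocallyUniformly.comp hF
      boundednessPreserving := (hG.tame.comp hF).2 }

end CompDeriv

end

/-! ### The Itô formula from time zero and the drift of a composition -/

section

variable {T : ℝ} [Fact (0 ≤ T)] {d m ν p : ℕ} {U : Set (E d)} {S : Set (E m)} {W : Set (E p)}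
  {X : PathFn T d} {A : PathFn T m} {Q : Fin d → Fin d → Time T → ℝ} {J : Set (Time T)}

section FromZero

variable {F : Functional T d m} {D : Fin (m + 1) → Functional T d m}

theorem BddMeasOn.of_Ioi_bot {f : Time T → ℝ} (h : BddMeasOn f (Set.Ioi ⊥))
    (hJ : MeasurableSet J) : BddMeasOn f J :=
  (h.insert ⊥).mono hJ fun _ _ => (eq_or_lt_of_le bot_le).imp Eq.symm id

theorem LeftContinuous.bddMeasOn_of_continuous (hF : LeftContinuous U S F)
    (hFb : BoundednessPreserving U S F) (P : PartitionSeq T) (hU : IsOpen U) (hX : Continuous X)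
    (hXU : ∀ t, X t ∈ U) (hA : IsCBV S A) (hJ : MeasurableSet J) :
    BddMeasOn (fun u => F u X A) J :=
  (hF.bddMeasOn hFb P hU (.of_continuous hX hXU) (s₀ := ⊥) (by simpa using hX) hA).of_Ioi_bot hJ

theorem MemC12c.bddMeasOn_vpartial (hF : MemC12c U S F) (P : PartitionSeq T) (hU : IsOpen U)
    (hX : Continuous X) (hXU : ∀ t, X t ∈ U) (hA : IsCBV S A) (hJ : MeasurableSet J)
    (i : Fin d) : BddMeasOn (fun u => vpartial i F u X A) J :=
  (hF.vpartial_leftContinuous i).bddMeasOn_of_continuous (hF.vpartial_boundednessPreserving i)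
    P hU hX hXU hA hJ

theorem MemC12c.bddMeasOn_vpartial₂ (hF : MemC12c U S F) (P : PartitionSeq T) (hU : IsOpen U)
    (hX : Continuous X) (hXU : ∀ t, X t ∈ U) (hA : IsCBV S A) (hJ : MeasurableSet J)
    (i j : Fin d) : BddMeasOn (fun u => vpartial i (vpartial j F) u X A) J :=
  (hF.vpartial₂_leftContinuous i j).bddMeasOn_of_continuous
    (hF.vpartial₂_boundednessPreserving i j) P hU hX hXU hA hJ

theorem IsHorizontalDeriv.bddMeasOn_of_continuous (hD : IsHorizontalDeriv U S F D)
    (hDc : ∀ i, ContinuousAtFixedTimes U S (D i)) (P : PartitionSeq T) (hX : Continuous X)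
    (hXU : ∀ t, X t ∈ U) (hA : IsCBV S A) (hJ : MeasurableSet J) (i : Fin (m + 1)) :
    BddMeasOn (fun u => D i u X A) J :=
  ((hD.bddMeasOn hDc (P := P) (s₀ := ⊥) (fun n => (P.isPartition n).bot_mem)
    (.of_continuous hX hXU) (by simpa using hX) hA i ⊤).mono measurableSet_Ioi
    (Set.Ioc_top (a := ⊥)).ge).of_Ioi_bot hJ

/-- The terms of bounded variation in Itô's formula for `F` on `[0,t]` along a path `X` with
quadratic variation `Q`. -/
def itoDrift (F : Functional T d m) (D : Fin (m + 1) → Functional T d m)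
    (Q : Fin d → Fin d → Time T → ℝ) (X : PathFn T d) (A : PathFn T m) (t : Time T) : ℝ :=
  ∑ i, lsIntegral (fun u => D i u X A) (withTime A i) (Set.Iic t)
    + (1 / 2) * ∑ i, ∑ j, lsIntegral (fun u => vpartial i (vpartial j F) u X A) (Q i j)
      (Set.Iic t)

theorem hasItoIntegral_vgrad {P : PartitionSeq T} (hF : MemC12c U S F)
    (hD : IsHorizontalDeriv U S F D) (hDc : ∀ i, ContinuousAtFixedTimes U S (D i))
    (hU : IsOpen U) (hX : Continuous X) (hXU : ∀ t, X t ∈ U) (hA : IsCBV S A)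
    (hQ : HasCovariation P X Q) {ξ : Time T → PathFn T d → E d}
    (hξ : ∀ t Z, IsCadlag U Z → ξ t Z = vgrad F t Z A) (t : Time T) :
    HasItoIntegral P ξ X t (F t X A - F ⊥ X A - itoDrift F D Q X A t) := by
  have hito := ito_formula (s₀ := ⊥) hF hD hDc hU (fun n => (P.isPartition n).bot_mem)
    (.of_continuous hX hXU) (by simpa using hX) hA (by simpa using hQ) (bot_le (a := t))
  rw [itoDrift, ← sub_sub]
  simp only [lsIntegral_Iic (hA.isContBV_withTime _), lsIntegral_Iic (hQ.isContBV hX _ _)]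
  refine hito.congr fun n => Finset.sum_congr rfl fun r _ => ?_
  rw [hξ r _ (.approxLeft (P.isPartition n) hXU r), approxFrom_bot, max_bot_left, max_bot_left]

end FromZero

section Drift

variable {P : PartitionSeq T} {B : PathFn T p} {G : Functional T ν p}
  {DG : Fin (p + 1) → Functional T ν p} {F : Fin ν → Functional T d m}
  {D : Fin ν → Fin (m + 1) → Functional T d m}

theorem lsIntegral_covariation_imagePath (hU : IsOpen U) (hX : Continuous X)
    (hXU : ∀ t, X t ∈ U) (hQ : HasCovariation P X Q) (hA : IsCBV S A)
    (hF : ∀ l, MemC12c U S (F l)) {f : Time T → ℝ} (hJ : MeasurableSet J) (hf : BddMeasOn f J)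
    (i j : Fin ν) :
    lsIntegral f (fun t => ∑ k, ∑ l, lsIntegral
        (fun s => vpartial k (F i) s X A * vpartial l (F j) s X A) (Q k l) (Set.Iic t)) J
      = ∑ k, ∑ l, lsIntegral
        (fun s => f s * (vpartial k (F i) s X A * vpartial l (F j) s X A)) (Q k l) J := by
  have hbot : ∀ (g : Time T → ℝ) k l, lsIntegral g (Q k l) (Set.Iic ⊥) = 0 := fun g k l => by
    rw [lsIntegral_Iic (hQ.isContBV hX k l), Set.Ioc_self, lsIntegral_empty]
  rw [lsIntegral_of_sub_eq_sum_lsIntegral (ι := Fin d × Fin d) (g := fun q => Q q.1 q.2)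
    (k := fun q s => vpartial q.1 (F i) s X A * vpartial q.2 (F j) s X A)
    (fun q => hQ.isContBV hX q.1 q.2)
    (fun q => ((hF i).bddMeasOn_vpartial P hU hX hXU hA .univ q.1).mul
      ((hF j).bddMeasOn_vpartial P hU hX hXU hA .univ q.2))
    (fun b => by simp only [hbot, Finset.sum_const_zero, sub_zero, Fintype.sum_prod_type])
    hJ hf, Fintype.sum_prod_type]

omit [Fact (0 ≤ T)] in
@[simp]
theorem liftFunctional_pairVec (Φ : Functional T d m) (t : Time T) (X : PathFn T d)
    (A : PathFn T m) (B : PathFn T p) :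
    liftFunctional p Φ t X (fun u => pairVec (A u) (B u)) = Φ t X A := by
  simp only [liftFunctional, fstPart_pairVec]

omit [Fact (0 ≤ T)] in
@[simp]
theorem compFunctional_pairVec (Φ : Functional T ν p) (F : Fin ν → Functional T d m) (t : Time T)
    (X : PathFn T d) (A : PathFn T m) (B : PathFn T p) :
    compFunctional Φ F t X (fun u => pairVec (A u) (B u)) = Φ t (imagePath F X A) B := by
  simp only [compFunctional, fstPart_pairVec, sndPart_pairVec]

theorem pullbackIntegrand_eq_vgrad (hU : IsOpen U) (hG : MemC12c Set.univ W G)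
    (hF : ∀ l, MemC12c U S (F l)) (hA : IsCBV S A) (hB : IsCBV W B)
    {η : Time T → PathFn T ν → E ν}
    (hη : ∀ t Z, IsCadlag Set.univ Z → η t Z = vgrad G t Z B) (t : Time T) {Z : PathFn T d}
    (hZ : IsCadlag U Z) :
    pullbackIntegrand η F A t Z
      = vgrad (compFunctional G F) t Z fun u => pairVec (A u) (B u) := by
  rw [vgrad_compFunctional hU hG.nonAnticipative hG.vertical hF hZ (hA.pairVec hB)]
  simp only [pullbackIntegrand, hη t _ (isCadlag_imagePath hF hZ hA), compFunctional_pairVec,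
    fstPart_pairVec, vpartial]

theorem sum_lsIntegral_compDeriv_pairVec (P : PartitionSeq T) (hG : MemC12c Set.univ W G)
    (hDG : IsHorizontalDeriv Set.univ W G DG)
    (hDGc : ∀ i, ContinuousAtFixedTimes Set.univ W (DG i)) (hF : ∀ l, MemC12c U S (F l))
    (hD : ∀ l, IsHorizontalDeriv U S (F l) (D l))
    (hDc : ∀ l i, ContinuousAtFixedTimes U S (D l i)) (hX : Continuous X) (hXU : ∀ t, X t ∈ U)
    (hA : IsCBV S A) (hB : IsCBV W B) (hJ : MeasurableSet J) :
    ∑ i, lsIntegral (fun u => compDeriv G DG F D i u X fun u => pairVec (A u) (B u))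
        (withTime (fun u => pairVec (A u) (B u)) i) J
      = (∑ l, ∑ i, lsIntegral (fun u => vpartial l G u (imagePath F X A) B * D l i u X A)
          (withTime A i) J)
        + ∑ j, lsIntegral (fun u => DG j u (imagePath F X A) B) (withTime B j) J := by
  have hY := continuous_imagePath hF hX hXU hA
  have hYU : ∀ t, imagePath F X A t ∈ Set.univ := fun _ => Set.mem_univ _
  rw [sum_lsIntegral_compDeriv hJ]
  all_goals simp only [compFunctional_pairVec, liftFunctional_pairVec, fstPart_pairVec,
    sndPart_pairVec]
  · exact hG.bddMeasOn_vpartial P isOpen_univ hY hYU hB hJ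
  · exact fun l => (hD l).bddMeasOn_of_continuous (hDc l) P hX hXU hA hJ
  · exact hDG.bddMeasOn_of_continuous hDGc P hY hYU hB hJ

theorem lsIntegral_vpartial₂_compFunctional (P : PartitionSeq T) (hU : IsOpen U)
    (hG : MemC12c Set.univ W G) (hF : ∀ l, MemC12c U S (F l)) (hX : Continuous X)
    (hXU : ∀ t, X t ∈ U) (hA : IsCBV S A) (hB : IsCBV W B) (g : Time T → ℝ)
    (hJ : MeasurableSet J) (i j : Fin d) :
    lsIntegral (fun u => vpartial i (vpartial j (compFunctional G F)) u X
        fun u => pairVec (A u) (B u)) g J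
      = (∑ l, lsIntegral (fun u => vpartial l G u (imagePath F X A) B
          * vpartial i (vpartial j (F l)) u X A) g J)
        + ∑ k, ∑ l, lsIntegral (fun u => vpartial k (vpartial l G) u (imagePath F X A) B
          * (vpartial i (F k) u X A * vpartial j (F l) u X A)) g J := by
  have hY := continuous_imagePath hF hX hXU hA
  have hYU : ∀ t, imagePath F X A t ∈ Set.univ := fun _ => Set.mem_univ _
  have hFm := fun l => (hF l).bddMeasOn_vpartial P hU hX hXU hA hJ
  have hfst : ∀ l ∈ Finset.univ, BddMeasOn (fun u => vpartial l G u (imagePath F X A) B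
      * vpartial i (vpartial j (F l)) u X A) J := fun l _ =>
    (hG.bddMeasOn_vpartial P isOpen_univ hY hYU hB hJ l).mul
      ((hF l).bddMeasOn_vpartial₂ P hU hX hXU hA hJ i j)
  have hsnd : ∀ k, ∀ l ∈ Finset.univ, BddMeasOn
      (fun u => vpartial k (vpartial l G) u (imagePath F X A) B
        * (vpartial i (F k) u X A * vpartial j (F l) u X A)) J := fun k l _ =>
    (hG.bddMeasOn_vpartial₂ P isOpen_univ hY hYU hB hJ k l).mul ((hFm k i).mul (hFm l j))
  simp only [← lsIntegral_sum _ g hJ (hsnd _), ← lsIntegral_sum _ g hJ hfst]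
  rw [← lsIntegral_sum _ g hJ fun k _ => .sum _ hJ (hsnd k),
    ← lsIntegral_add g hJ (.sum _ hJ hfst) (.sum _ hJ fun k _ => .sum _ hJ (hsnd k))]
  refine lsIntegral_congr g fun u _ => ?_
  simp only [vpartial_vpartial_compFunctional hU hG hF i j (.of_continuous hX hXU)
    (hA.pairVec hB), compFunctional_pairVec, liftFunctional_pairVec, Finset.mul_sum]
  rw [Finset.sum_comm (f := fun k l => vpartial k (vpartial l G) u (imagePath F X A) B * _)]
  exact congrArg _ (Finset.sum_congr rfl fun l _ => Finset.sum_congr rfl fun k _ => by ring)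

omit [Fact (0 ≤ T)] in
theorem sum_comm_three {ι κ μ M : Type*} [Fintype ι] [Fintype κ] [Fintype μ] [AddCommMonoid M]
    (f : ι → κ → μ → M) : ∑ i, ∑ j, ∑ l, f i j l = ∑ l, ∑ i, ∑ j, f i j l :=
  (Finset.sum_congr rfl fun _ _ => Finset.sum_comm).trans Finset.sum_comm

theorem itoDrift_compFunctional (P : PartitionSeq T) (hU : IsOpen U)
    (hG : MemC12c Set.univ W G) (hDG : IsHorizontalDeriv Set.univ W G DG)
    (hDGc : ∀ i, ContinuousAtFixedTimes Set.univ W (DG i)) (hF : ∀ l, MemC12c U S (F l))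
    (hD : ∀ l, IsHorizontalDeriv U S (F l) (D l))
    (hDc : ∀ l i, ContinuousAtFixedTimes U S (D l i)) (hX : Continuous X) (hXU : ∀ t, X t ∈ U)
    (hQ : HasCovariation P X Q) (hA : IsCBV S A) (hB : IsCBV W B) (t : Time T) :
    itoDrift (compFunctional G F) (compDeriv G DG F D) Q X (fun u => pairVec (A u) (B u)) t
      = itoDrift G DG (fun i j t => ∑ k, ∑ l, lsIntegral
          (fun s => vpartial k (F i) s X A * vpartial l (F j) s X A) (Q k l) (Set.Iic t))
          (imagePath F X A) B t
        + ∑ l, (∑ i, lsIntegral (fun s => vpartial l G s (imagePath F X A) B * D l i s X A)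
            (withTime A i) (Set.Iic t)
          + (1 / 2) * ∑ i, ∑ j, lsIntegral (fun s => vpartial l G s (imagePath F X A) B
              * vpartial i (vpartial j (F l)) s X A) (Q i j) (Set.Iic t)) := by
  have hG₂ := hG.bddMeasOn_vpartial₂ P isOpen_univ (continuous_imagePath hF hX hXU hA)
    (fun _ => Set.mem_univ _) hB (measurableSet_Iic (a := t))
  simp only [itoDrift, sum_lsIntegral_compDeriv_pairVec P hG hDG hDGc hF hD hDc hX hXU hA hB
    measurableSet_Iic, lsIntegral_vpartial₂_compFunctional P hU hG hF hX hXU hA hB _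
    measurableSet_Iic, lsIntegral_covariation_imagePath hU hX hXU hQ hA hF measurableSet_Iic
    (hG₂ _ _), Finset.sum_add_distrib, ← Finset.mul_sum]
  rw [sum_comm_three fun i j l => lsIntegral (fun s => vpartial l G s (imagePath F X A) B
      * vpartial i (vpartial j (F l)) s X A) (Q i j) (Set.Iic t),
    sum_comm_three fun i j k => ∑ l, _, Finset.sum_congr rfl fun k _ => sum_comm_three _]
  ring

end Drift

theorem IsAdmissible.pullbackIntegrand (P : PartitionSeq T) (hU : IsOpen U) (hS : IsOpen S)
    {F : Fin ν → Functional T d m} (hF : ∀ l, MemC12c U S (F l)) (hA : IsCBV S A)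
    {η : Time T → PathFn T ν → E ν} (hη : IsAdmissible Set.univ η) :
    IsAdmissible U (FunctionalIto.pullbackIntegrand η F A) := by
  obtain ⟨p, W, B, G, hW, hB, hG, hηG⟩ := hη
  exact ⟨m + p, pairSet S W, _, compFunctional G F, isOpen_pairSet hS hW, hA.pairVec hB,
    hG.comp P hU hF, fun t _ => pullbackIntegrand_eq_vgrad hU hG hF hA hB hηG t⟩

end

end FunctionalIto

end

theorem corollary2p1 {T : ℝ} (hT : 0 < T) (P : PartitionSeq T) {d m ν : ℕ}
    {U : Set (E d)} (hU : IsOpen U) {S : Set (E m)} (hS : IsOpen S)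
    {X : PathFn T d} (hX : Continuous X) (hXU : ∀ t, X t ∈ U)
    {Q : Fin d → Fin d → Time T → ℝ} (hQ : HasCovariation P X Q)
    {A : PathFn T m} (hA : IsCBV S A)
    {F : Fin ν → Functional T d m} (hF : ∀ l, MemC12c U S (F l))
    {D : Fin ν → Fin (m + 1) → Functional T d m}
    (hD : ∀ l, IsHorizontalDeriv U S (F l) (D l))
    (hDc : ∀ l i, ContinuousAtFixedTimes U S (D l i))
    (hY : HasCovariation P (imagePath F X A) fun i j t =>
      ∑ k, ∑ l, lsIntegral (fun s => vpartial k (F i) s X A * vpartial l (F j) s X A)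
        (Q k l) (Set.Iic t))
    {η : Time T → PathFn T ν → E ν} (hη : IsAdmissible Set.univ η) :
    IsAdmissible U (pullbackIntegrand η F A) ∧
    (∀ t : Time T,
      (∀ l i, LSIntegrable (fun s => η s (imagePath F X A) l * D l i s X A)
        (withTime A i) (Set.Iic t)) ∧
      (∀ l i j, LSIntegrable
        (fun s => η s (imagePath F X A) l * vpartial i (vpartial j (F l)) s X A)
        (Q i j) (Set.Iic t)) ∧
      ∃ IY IX : ℝ,
        HasItoIntegral P η (imagePath F X A) t IY ∧
        HasItoIntegral P (pullbackIntegrand η F A) X t IX ∧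
        IY = IX + ∑ l,
          (∑ i, lsIntegral (fun s => η s (imagePath F X A) l * D l i s X A)
              (withTime A i) (Set.Iic t)
            + (1 / 2) * ∑ i, ∑ j,
              lsIntegral (fun s => η s (imagePath F X A) l * vpartial i (vpartial j (F l)) s X A)
                (Q i j) (Set.Iic t))) := by
  have : Fact (0 ≤ T) := ⟨hT.le⟩
  refine ⟨hη.pullbackIntegrand P hU hS hF hA, fun t => ?_⟩
  obtain ⟨p, W, B, G, -, hB, hG, hηG⟩ := hη
  obtain ⟨DG, hDG, hDGc⟩ := hG.horizontal
  have hYc := continuous_imagePath hF hX hXU hA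
  have hYU : ∀ t, imagePath F X A t ∈ Set.univ := fun _ => Set.mem_univ _
  have hηY : ∀ s l, η s (imagePath F X A) l = vpartial l G s (imagePath F X A) B := fun s l => by
    rw [hηG s _ (.of_continuous hYc hYU), vpartial]
  simp only [hηY]
  have hGm := hG.bddMeasOn_vpartial P isOpen_univ hYc hYU hB (measurableSet_Iic (a := t))
  have hFm := fun l => (hF l).bddMeasOn_vpartial₂ P hU hX hXU hA (measurableSet_Iic (a := t))
  have hDm := fun l => (hD l).bddMeasOn_of_continuous (hDc l) P hX hXU hA
    (measurableSet_Iic (a := t))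
  have hItoG := hasItoIntegral_vgrad hG hDG hDGc isOpen_univ hYc hYU hB hY hηG t
  have hItoGF := hasItoIntegral_vgrad (hG.comp P hU hF)
    (isHorizontalDeriv_compDeriv P hG hDG hDGc hF hD)
    (continuousAtFixedTimes_compDeriv hG hDGc hF hDc) hU hX hXU (hA.pairVec hB) hQ
    (fun _ _ => pullbackIntegrand_eq_vgrad hU hG hF hA hB hηG _) t
  refine ⟨fun l i => ((hGm l).mul (hDm l i)).integrableOn measurableSet_Iic _,
    fun l i j => ((hGm l).mul (hFm l i j)).integrableOn measurableSet_Iic _,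
    _, _, hItoG, hItoGF, ?_⟩
  rw [itoDrift_compFunctional P hU hG hDG hDGc hF hD hDc hX hXU hQ hA hB, compFunctional_pairVec,
    compFunctional_pairVec]
  ring
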